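/- For $n\ge 1$ let $J=J_n$ be the $n\times n$ matrix with all entries $1/n$, and let $A_1,A_2,\dots$ be a sequence of real doubly stochastic matrices (non-negative entries, all row and column sums $1$), with $A_n$ of order $n$. The sequence is of *moderate deviation* if * the rescaled deviations $X_n=n(A_n-J)$ are *weakly bounded*: for every real $p\ge1$, $\displaystyle\limsup_{n\to\infty}\frac1{n^2}\sum_{i,j=1}^n|X_n(i,j)|^p<\infty$; and * the *spectral gap* $\mathrm{Gap}(A_n)=1-\|A_n-J\|$ is bounded below: there is $C>0$ with $\mathrm{Gap}(A_n)\ge C$ for all $n$. Here $\|\cdot\|$ is the Euclidean operator norm, i.e. the largest singular value (for symmetric $A_n$, the largest absolute value of an eigenvalue of $A_n-J$). Write $\mathrm{per}(M)=\sum_\sigma\prod_i M_{i,\sigma(i)}$. For every moderate-deviation sequence $(A_n)$: 1. $\mathrm{per}(nA_n)>0$ and $\det(I+J-A_n'A_n)>0$ for all $n$, and, as $n\to\infty$, $$\log \mathrm{per}(nA_n)=\log n!-\tfrac12\log\det(I+J-A_n'A_n)+O(n^{-1}).$$ 2. The sequence $\mathrm{per}(nA_n)/n!$ is bounded. 3.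 With $t^2=n/(n-1)$, $\det(I+t^2J-t^2A_n'A_n)>0$ for all sufficiently large $n$, and $$\log \mathrm{per}(nA_n)=\log n!-\tfrac12\log\det(I+t^2J-t^2A_n'A_n)+O(n^{-1}).$$ The constants implied in $O(n^{-1})$ may depend on the sequence. -/

import Mathlib

open Filter Asymptotics
open scoped Matrix Nat

noncomputable section

namespace DetApprox

/-- The uniform matrix of order `n`, all of whose entries equal `1 / n`. -/
def J (n : ℕ) : Matrix (Fin n) (Fin n) ℝ :=
  Matrix.of fun _ _ => (n : ℝ)⁻¹

/-- The empirical absolute `p`th moment `n⁻² ∑ i j, |X i j| ^ p` of a matrix of order `n`. -/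
def absMoment (p : ℝ) {n : ℕ} (X : Matrix (Fin n) (Fin n) ℝ) : ℝ :=
  1 / (n : ℝ) ^ 2 * ∑ i, ∑ j, |X i j| ^ p

/-- A sequence of square matrices, the `n`th of order `n`, is weakly bounded if, for every real
`p ≥ 1`, the upper limit of its absolute `p`th moments is finite. The upper limit is taken in the
extended reals, so that it is a genuine one. -/
def WeaklyBounded (X : ∀ n : ℕ, Matrix (Fin n) (Fin n) ℝ) : Prop :=
  ∀ p : ℝ, 1 ≤ p → limsup (fun n : ℕ => (absMoment p (X n) : EReal)) atTop < ⊤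

/-- The spectral gap `1 - ‖A - J‖`, where `‖A - J‖` is the operator norm of `A - J` on Euclidean
space, that is, its spectral norm (largest singular value). For symmetric `A` this is the largest
absolute value of an eigenvalue of `A - J`. -/
def gap {n : ℕ} (A : Matrix (Fin n) (Fin n) ℝ) : ℝ :=
  1 - ‖Matrix.toEuclideanCLM (n := Fin n) (𝕜 := ℝ) (A - J n)‖

/-- Moderate-deviation sequences of doubly stochastic matrices. -/
structure ModerateDeviation (A : ∀ n : ℕ, Matrix (Fin n) (Fin n) ℝ) : Prop where
  doublyStochastic : ∀ n, A n ∈ doublyStochastic ℝ (Fin n)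
  weaklyBounded : WeaklyBounded fun n => (n : ℝ) • (A n - J n)
  gap_bounded_below : ∃ C : ℝ, 0 < C ∧ ∀ n, C ≤ gap (A n)

/-- The matrix `I + s J - s A'A`. -/
def detMatrix (s : ℝ) {n : ℕ} (A : Matrix (Fin n) (Fin n) ℝ) : Matrix (Fin n) (Fin n) ℝ :=
  1 + s • J n - s • (Aᵀ * A)

end DetApprox

end

/-!
Write `A = J + K`. The rows and columns of `K` sum to zero, its operator norm is at most some
`ρ < 1`, and `A'A = J + K'K`, so that the determinant in the theorem is `det (1 - K'K)`. Expanding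
the permanent of `n A` in powers of `K` gives

  `per (n A) / n! = ∑ k, c k * q k`,  `c k = n ^ k / (n (n - 1) ⋯ (n - k + 1))`,

where `q k` is the sum of the permanents of all `k × k` submatrices of `K`. It has to be compared
with `det (1 - K'K) ^ (-1/2) = ∑ k, d k`.

Both `q k` and `d k` are formal Gaussian moments. Let `B` be the symmetric matrix with off-diagonal
blocks `K` and `K'`, and let `E` be the functional on polynomials in the variables `X v`, indexed by
the rows and columns, that sums over perfect pairings with weights `B v w` (`wick`). Then `q k` is
the part of degree `2 k` of `E (∏ v, (1 + X v))` (`subPermSum_eq`). In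
`1 + x = exp (x - x² / 2) * ((1 + x) * exp (-x + x² / 2))` the product over `v` of the linear
exponents disappears, because `∑ v, X v` is null for `E`. The quadratic exponents produce the
normalization, whose coefficients are the `d k` (`tsum_detCoeff_sq_mul_det`), and change the
covariance `B` into `B (1 + B)⁻¹` (`gaussWick_X_mul`). The last factor `1 + O(x³)` has no terms of
degree one and two; it yields a sum over multi-indices `a` without entries `1` and `2`
(`wick_prod_one_add_eq`). Those of degree four and six contribute `O(1 / n)` by the moment bounds,
and those of larger degree by counting, as long as `k ≤ n ^ (3/5)`
(`sum_abs_subPermSum_sub_detCoeff_le`).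

For larger `k` a uniform bound suffices, `|c k * q k| ≤ exp (C √n)` up to powers of `n`
(`abs_sum_permSum_le`). It comes from the singular value decomposition of `K`, the expansion of the
permanent of a product over types of maps, and Cauchy's estimate on a torus. Replacing `K` by `z L`
with `z < 1`, where `L` still has operator norm less than `1`, supplies a factor `z ^ k` in front of
the coefficients of `L`; it absorbs this bound for `k > n ^ (3/5)`, as well as `c k` for
`k ≤ n ^ (3/5)` (`exists_abs_permanent_sub_detSeries_le`). Since `∑ k, d k` lies between `1` and a
constant, logarithms may be taken.

Positivity of the permanent is Birkhoff's theorem. The determinant with `t² = n / (n - 1)` is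
compared with `det (1 - K'K)` one eigenvalue at a time (`abs_log_det_sub_log_det_le`).
-/


noncomputable section
namespace DetApprox

/-! ### The Wick functional of a symmetric matrix -/

section Wick

open MvPolynomial

lemma pderiv_pderiv_comm {V : Type*} (v w : V) (f : MvPolynomial V ℝ) :
    pderiv v (pderiv w f) = pderiv w (pderiv v f) := by
  classical
  have h : ⁅(pderiv v : Derivation ℝ (MvPolynomial V ℝ) (MvPolynomial V ℝ)),
      (pderiv w : Derivation ℝ (MvPolynomial V ℝ) (MvPolynomial V ℝ))⁆ = 0 := by
    apply MvPolynomial.derivation_ext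
    intro i
    rw [Derivation.commutator_apply]
    simp [pderiv_X, Pi.single_apply, apply_ite]
  have h2 := congrArg (fun D => D f) h
  simp only [Derivation.commutator_apply, Derivation.coe_zero, Pi.zero_apply] at h2
  exact sub_eq_zero.mp h2

variable {V : Type*} [Fintype V]

/-- The operator `½ ∑ B v w ∂_v ∂_w` on polynomials in variables indexed by `V`. -/
def wickLaplacian (B : Matrix V V ℝ) : Module.End ℝ (MvPolynomial V ℝ) :=
  (1 / 2 : ℝ) • ∑ v, ∑ w, B v w •
    ((pderiv v : Derivation ℝ (MvPolynomial V ℝ) (MvPolynomial V ℝ)).toLinearMap ∘ₗ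
      (pderiv w : Derivation ℝ (MvPolynomial V ℝ) (MvPolynomial V ℝ)).toLinearMap)

lemma wickLaplacian_apply (B : Matrix V V ℝ) (f : MvPolynomial V ℝ) :
    wickLaplacian B f = (1 / 2 : ℝ) • ∑ v, ∑ w, B v w • pderiv v (pderiv w f) := by
  simp [wickLaplacian, LinearMap.sum_apply]

/-- The homogeneous part of degree `2 k` of the formal Gaussian expectation with covariance `B`:
it sends a monomial of degree `2 k` to the sum of the weights of its perfect pairings, and
monomials of any other degree to `0`. The matrix need not be positive. -/
def wick (B : Matrix V V ℝ) (k : ℕ) : MvPolynomial V ℝ →ₗ[ℝ] ℝ where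
  toFun f := ((k ! : ℝ))⁻¹ * constantCoeff ((wickLaplacian B ^ k) f)
  map_add' f g := by simp [mul_add]
  map_smul' c f := by simp [constantCoeff_smul]; ring

lemma wick_apply (B : Matrix V V ℝ) (k : ℕ) (f : MvPolynomial V ℝ) :
    wick B k f = ((k ! : ℝ))⁻¹ * constantCoeff ((wickLaplacian B ^ k) f) := rfl

lemma wick_zero (B : Matrix V V ℝ) (f : MvPolynomial V ℝ) :
    wick B 0 f = constantCoeff f := by simp [wick_apply]

lemma wick_zero_one (B : Matrix V V ℝ) : wick B 0 1 = 1 := by simp [wick_zero]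

lemma wick_zero_X_mul (B : Matrix V V ℝ) (v : V) (f : MvPolynomial V ℝ) :
    wick B 0 (X v * f) = 0 := by simp [wick_zero]

lemma wickLaplacian_pderiv (B : Matrix V V ℝ) (u : V) (f : MvPolynomial V ℝ) :
    wickLaplacian B (pderiv u f) = pderiv u (wickLaplacian B f) := by
  simp only [wickLaplacian_apply, Derivation.map_smul, map_sum]
  refine congrArg _ (Finset.sum_congr rfl fun v _ => Finset.sum_congr rfl fun w _ => ?_)
  rw [pderiv_pderiv_comm w u f, pderiv_pderiv_comm v u (pderiv w f)]

lemma wickLaplacian_pow_pderiv (B : Matrix V V ℝ) (k : ℕ) (u : V) (f : MvPolynomial V ℝ) :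
    (wickLaplacian B ^ k) (pderiv u f) = pderiv u ((wickLaplacian B ^ k) f) := by
  induction k with
  | zero => simp
  | succ k ih => rw [pow_succ', Module.End.mul_apply, ih, wickLaplacian_pderiv, Module.End.mul_apply]

lemma wickLaplacian_X_mul {B : Matrix V V ℝ} (hB : B.IsSymm) (v : V) (f : MvPolynomial V ℝ) :
    wickLaplacian B (X v * f) = X v * wickLaplacian B f + ∑ w, B v w • pderiv w f := by
  classical
  have h : ∀ a b : V, pderiv a (pderiv b (X v * f)) =
      X v * pderiv a (pderiv b f) + ((if v = b then pderiv a f else 0)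
        + if v = a then pderiv b f else 0) := by
    intro a b
    rw [pderiv_mul, map_add, pderiv_mul, pderiv_mul, pderiv_X, pderiv_X]
    simp only [Pi.single_apply]
    split_ifs <;> simp <;> ring
  simp only [wickLaplacian_apply, h, smul_add, Finset.sum_add_distrib, mul_smul_comm,
    Finset.mul_sum, smul_ite, smul_zero, Finset.sum_ite_eq, Finset.mem_univ, if_true]
  rw [Finset.sum_comm (f := fun x y => if v = x then B x y • pderiv y f else 0)]
  simp only [Finset.sum_ite_eq, Finset.mem_univ, if_true]
  have h3 : ∀ x, B x v = B v x := fun x => hB.apply v x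
  simp only [h3]
  rw [← smul_add, ← two_smul ℝ (∑ x, B v x • pderiv x f), smul_smul]
  norm_num

lemma wickLaplacian_pow_X_mul {B : Matrix V V ℝ} (hB : B.IsSymm) (k : ℕ) (v : V)
    (f : MvPolynomial V ℝ) :
    (wickLaplacian B ^ (k + 1)) (X v * f) = X v * (wickLaplacian B ^ (k + 1)) f +
      ((k : ℝ) + 1) • ∑ w, B v w • (wickLaplacian B ^ k) (pderiv w f) := by
  induction k with
  | zero => simp [wickLaplacian_X_mul hB]
  | succ k ih =>
    rw [pow_succ', Module.End.mul_apply, ih, map_add, wickLaplacian_X_mul hB, ← Module.End.mul_apply,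
      ← pow_succ', add_assoc]
    congr 1
    simp only [map_smul, map_sum, ← Module.End.mul_apply, ← pow_succ',
      ← wickLaplacian_pow_pderiv]
    push_cast
    module

/-- Integration by parts for the Wick functional. -/
lemma wick_succ_X_mul {B : Matrix V V ℝ} (hB : B.IsSymm) (k : ℕ) (v : V)
    (f : MvPolynomial V ℝ) :
    wick B (k + 1) (X v * f) = ∑ w, B v w * wick B k (pderiv w f) := by
  simp only [wick_apply, wickLaplacian_pow_X_mul hB, map_add, map_mul, constantCoeff_X, zero_mul,
    zero_add, constantCoeff_smul, map_sum, Finset.mul_sum, smul_eq_mul, Nat.factorial_succ]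
  refine Finset.sum_congr rfl fun w _ => ?_
  have : (k ! : ℝ) ≠ 0 := by positivity
  push_cast
  field_simp

lemma wickLaplacian_isHomogeneous (B : Matrix V V ℝ) {f : MvPolynomial V ℝ} {m : ℕ}
    (hf : f.IsHomogeneous m) : (wickLaplacian B f).IsHomogeneous (m - 2) := by
  rw [wickLaplacian_apply, smul_eq_C_mul]
  rw [show m - 2 = 0 + (m - 2) by omega]
  refine (isHomogeneous_C _ _).mul (IsHomogeneous.sum _ _ _ fun v _ =>
    IsHomogeneous.sum _ _ _ fun w _ => ?_)
  rw [smul_eq_C_mul, show m - 2 = 0 + (m - 1 - 1) by omega]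
  exact (isHomogeneous_C _ _).mul hf.pderiv.pderiv

/-- The Wick functional of index `k` only sees the homogeneous part of degree `2 k`. -/
lemma wick_eq_zero_of_isHomogeneous (B : Matrix V V ℝ) {k m : ℕ} (hm : m ≠ 2 * k)
    {f : MvPolynomial V ℝ} (hf : f.IsHomogeneous m) : wick B k f = 0 := by
  rw [wick_apply]
  suffices h : constantCoeff ((wickLaplacian B ^ k) f) = 0 by rw [h, mul_zero]
  induction k generalizing m f with
  | zero =>
    by_contra h0
    have h1 := hf (d := 0) (by simpa [constantCoeff_eq] using h0)
    simp at h1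
    omega
  | succ k ih =>
    rw [pow_succ, Module.End.mul_apply]
    rcases lt_or_ge m 2 with h | h
    · have : wickLaplacian B f = 0 := by
        rw [wickLaplacian_apply]
        have hz : ∀ v w : V, pderiv v (pderiv w f) = 0 := by
          intro v w
          have h1 : (pderiv w f).IsHomogeneous 0 := by
            have := hf.pderiv (i := w)
            rwa [show m - 1 = 0 by omega] at this
          obtain ⟨c, hc⟩ : ∃ c, pderiv w f = C c := by
            refine ⟨coeff 0 (pderiv w f), ?_⟩
            exact totalDegree_eq_zero_iff_eq_C.mp (Nat.le_zero.mp h1.totalDegree_le)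
          rw [hc, pderiv_C]
        simp [hz]
      rw [this, map_zero, map_zero]
    · exact ih (m := m - 2) (by omega) (wickLaplacian_isHomogeneous B hf)

/-- If the columns of `B` sum to zero, then the sum of all variables is null for the Wick
functional. -/
lemma wick_sum_X_mul {B : Matrix V V ℝ} (hB : B.IsSymm) (h0 : ∀ w, ∑ v, B v w = 0) (k : ℕ)
    (f : MvPolynomial V ℝ) : wick B k ((∑ v, X v) * f) = 0 := by
  rw [Finset.sum_mul, map_sum]
  cases k with
  | zero => simp [wick_zero]
  | succ k =>
    simp only [wick_succ_X_mul hB]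
    rw [Finset.sum_comm]
    simp [← Finset.sum_mul, h0]

end Wick

/-! ### Permanents and the Wick functional -/

section Pairings

open MvPolynomial

variable {ι : Type*} [Fintype ι] [DecidableEq ι]

/-- The symmetric matrix with off-diagonal blocks `L` and `Lᵀ`, indexed by rows and columns. -/
def bip (L : Matrix ι ι ℝ) : Matrix (ι ⊕ ι) (ι ⊕ ι) ℝ := Matrix.fromBlocks 0 L Lᵀ 0

omit [Fintype ι] [DecidableEq ι] in
lemma bip_isSymm (L : Matrix ι ι ℝ) : (bip L).IsSymm := by
  rw [bip, Matrix.IsSymm, Matrix.fromBlocks_transpose]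
  simp

/-- The sum over permutations `σ` of the products of the entries `L i (σ i)`, `i ∈ R`, where only
permutations mapping `R` into `S` contribute. -/
def permSum (L : Matrix ι ι ℝ) (R S : Finset ι) : ℝ :=
  ∑ σ : Equiv.Perm ι, ∏ i ∈ R, if σ i ∈ S then L i (σ i) else 0

lemma permSum_empty (L : Matrix ι ι ℝ) (S : Finset ι) :
    permSum L ∅ S = ((Fintype.card ι)! : ℝ) := by
  simp [permSum, Finset.card_univ, Fintype.card_perm]

/-- Any two positions outside `R` are equally likely to be mapped to `j`. -/
lemma permSum_fiber_eq (L : Matrix ι ι ℝ) {R S : Finset ι} {i i' : ι} (hi : i ∉ R) (hi' : i' ∉ R)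
    (j : ι) :
    (∑ σ : Equiv.Perm ι, if σ i' = j then ∏ a ∈ R, (if σ a ∈ S then L a (σ a) else 0) else 0) =
    ∑ σ : Equiv.Perm ι, if σ i = j then ∏ a ∈ R, (if σ a ∈ S then L a (σ a) else 0) else 0 := by
  refine Fintype.sum_equiv (Equiv.mulRight (Equiv.swap i i')) _ _ fun σ => ?_
  simp only [Equiv.coe_mulRight, Equiv.Perm.mul_apply, Equiv.swap_apply_left]
  congr 1
  refine Finset.prod_congr rfl fun a ha => ?_
  have h : (σ * Equiv.swap i i') a = σ a := by
    rw [Equiv.Perm.mul_apply, Equiv.swap_apply_of_ne_of_ne (by rintro rfl; exact hi ha)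
      (by rintro rfl; exact hi' ha)]
  change _ = if (σ * Equiv.swap i i') a ∈ S then L a ((σ * Equiv.swap i i') a) else 0
  simp only [h]

/-- Expansion along the row `i`. The factor on the left is the number of positions outside `R`; it
appears because restricting `σ` to avoid `j` on `R` amounts to choosing which of those positions is
mapped to `j`. -/
lemma permSum_insert (L : Matrix ι ι ℝ) {R : Finset ι} (S : Finset ι) {i : ι} (hi : i ∉ R) :
    ((Fintype.card ι - R.card : ℕ) : ℝ) * permSum L (insert i R) S =
      ∑ j ∈ S, L i j * permSum L R (S.erase j) := by
  have h1 : permSum L (insert i R) S = ∑ j ∈ S, L i j *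
      ∑ σ : Equiv.Perm ι, if σ i = j then ∏ a ∈ R, (if σ a ∈ S then L a (σ a) else 0) else 0 := by
    simp only [permSum, Finset.prod_insert hi, Finset.mul_sum]
    rw [Finset.sum_comm]
    refine Finset.sum_congr rfl fun σ _ => ?_
    simp only [mul_ite, mul_zero, Finset.sum_ite_eq]
    split_ifs <;> simp
  have h2 : ∀ j ∈ S, permSum L R (S.erase j) = ((Fintype.card ι - R.card : ℕ) : ℝ) *
      ∑ σ : Equiv.Perm ι, if σ i = j then ∏ a ∈ R, (if σ a ∈ S then L a (σ a) else 0) else 0 := by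
    intro j _
    have h3 : ∀ σ : Equiv.Perm ι, (∏ a ∈ R, if σ a ∈ S.erase j then L a (σ a) else 0) =
        ∑ i' ∈ Rᶜ, if σ i' = j then ∏ a ∈ R, (if σ a ∈ S then L a (σ a) else 0) else 0 := by
      intro σ
      have h4 : ∀ i', (σ i' = j) = (i' = σ.symm j) := fun i' => by
        rw [Equiv.eq_symm_apply]
      simp only [h4, Finset.sum_ite_eq', Finset.mem_compl]
      by_cases h : σ.symm j ∈ R
      · rw [if_neg (not_not.mpr h)]
        exact Finset.prod_eq_zero h (by simp)
      · rw [if_pos h]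
        refine Finset.prod_congr rfl fun a ha => ?_
        have : σ a ≠ j := by rintro rfl; simp at h; exact h ha
        simp [this]
    rw [permSum]
    simp only [h3]
    rw [Finset.sum_comm, ← Finset.card_compl, ← nsmul_eq_mul]
    refine Finset.sum_eq_card_nsmul fun i' hi' => ?_
    exact permSum_fiber_eq L hi (Finset.mem_compl.mp hi') j
  rw [h1, Finset.mul_sum]
  refine Finset.sum_congr rfl fun j hj => ?_
  rw [h2 j hj]
  ring

omit [DecidableEq ι] in
lemma wick_bip_X_inl (L : Matrix ι ι ℝ) (k : ℕ) (i : ι) (f : MvPolynomial (ι ⊕ ι) ℝ) :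
    wick (bip L) (k + 1) (X (Sum.inl i) * f) =
      ∑ j, L i j * wick (bip L) k (pderiv (Sum.inr j) f) := by
  rw [wick_succ_X_mul (bip_isSymm L), Fintype.sum_sum_type]
  simp [bip]

omit [DecidableEq ι] in
lemma wick_bip_X_inr (L : Matrix ι ι ℝ) (k : ℕ) (j : ι) (f : MvPolynomial (ι ⊕ ι) ℝ) :
    wick (bip L) (k + 1) (X (Sum.inr j) * f) =
      ∑ i, L i j * wick (bip L) k (pderiv (Sum.inl i) f) := by
  rw [wick_succ_X_mul (bip_isSymm L), Fintype.sum_sum_type]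
  simp [bip]

omit [Fintype ι] in
lemma pderiv_inl_prod_inr (S : Finset ι) (i : ι) :
    pderiv (Sum.inl i) (∏ j ∈ S, (1 + X (Sum.inr j)) : MvPolynomial (ι ⊕ ι) ℝ) = 0 := by
  induction S using Finset.induction_on with
  | empty => simp
  | insert j S hj ih => rw [Finset.prod_insert hj, pderiv_mul, ih]; simp

omit [Fintype ι] in
lemma pderiv_inr_prod_inl (R : Finset ι) (j : ι) :
    pderiv (Sum.inr j) (∏ i ∈ R, X (Sum.inl i) : MvPolynomial (ι ⊕ ι) ℝ) = 0 := by
  induction R using Finset.induction_on with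
  | empty => simp
  | insert j R hj ih => rw [Finset.prod_insert hj, pderiv_mul, ih]; simp

omit [Fintype ι] in
lemma pderiv_inr_prod_inr (S : Finset ι) (i : ι) :
    pderiv (Sum.inr i) (∏ j ∈ S, (1 + X (Sum.inr j)) : MvPolynomial (ι ⊕ ι) ℝ) =
      if i ∈ S then ∏ j ∈ S.erase i, (1 + X (Sum.inr j)) else 0 := by
  induction S using Finset.induction_on with
  | empty => simp
  | insert j S hj ih =>
    rw [Finset.prod_insert hj, pderiv_mul, ih]
    by_cases h : i = j
    · subst h
      simp [hj]
    · have h' : j ≠ i := fun e => h e.symm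
      simp only [map_add, pderiv_one, zero_add, Finset.mem_insert, h, false_or]
      rw [pderiv_X_of_ne (by simpa using h'), zero_mul, zero_add]
      split_ifs with h2
      · rw [Finset.erase_insert_of_ne h', Finset.prod_insert (by simp [hj])]
      · simp

lemma wick_bip_prod_inr (L : Matrix ι ι ℝ) (k : ℕ) (S : Finset ι) :
    wick (bip L) k (∏ j ∈ S, (1 + X (Sum.inr j))) = if k = 0 then 1 else 0 := by
  cases k with
  | zero => simp [wick_zero]
  | succ k =>
    induction S using Finset.induction_on with
    | empty =>
      rw [Finset.prod_empty]
      exact wick_eq_zero_of_isHomogeneous _ (m := 0) (by omega) (isHomogeneous_one _ _)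
    | insert j S hj ih =>
      rw [Finset.prod_insert hj, add_mul, one_mul, map_add, ih, wick_bip_X_inr]
      simp [pderiv_inl_prod_inr]

/-- Moments of products of row variables: pairing off the row variables one at a time is the
expansion of `permSum` along rows. -/
lemma wick_bip_prod (L : Matrix ι ι ℝ) (R : Finset ι) (k : ℕ) (S : Finset ι) :
    wick (bip L) k ((∏ i ∈ R, X (Sum.inl i)) * ∏ j ∈ S, (1 + X (Sum.inr j))) =
      if k = R.card then permSum L R S / ((Fintype.card ι - R.card)! : ℝ) else 0 := by
  induction R using Finset.induction_on generalizing k S with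
  | empty =>
    rw [Finset.prod_empty, one_mul, wick_bip_prod_inr, permSum_empty]
    have : ((Fintype.card ι)! : ℝ) ≠ 0 := by positivity
    simp [this]
  | insert i R hi ih =>
    rw [Finset.prod_insert hi, mul_assoc, Finset.card_insert_of_notMem hi]
    cases k with
    | zero => rw [wick_zero_X_mul, if_neg (by omega)]
    | succ k =>
      rw [wick_bip_X_inl]
      have h1 : ∀ j, wick (bip L) k (pderiv (Sum.inr j)
          ((∏ i ∈ R, X (Sum.inl i)) * ∏ j ∈ S, (1 + X (Sum.inr j)))) =
          if j ∈ S then (if k = R.card then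
            permSum L R (S.erase j) / ((Fintype.card ι - R.card)! : ℝ) else 0) else 0 := by
        intro j
        rw [pderiv_mul, pderiv_inr_prod_inl, zero_mul, zero_add, pderiv_inr_prod_inr]
        by_cases h2 : j ∈ S
        · rw [if_pos h2, if_pos h2, ih]
        · simp [h2]
      simp only [h1]
      by_cases hk : k = R.card
      · simp only [hk, if_true, mul_ite, mul_zero, ← Finset.sum_filter]
        rw [Finset.filter_mem_eq_inter, Finset.univ_inter]
        simp only [← mul_div_assoc]
        rw [← Finset.sum_div, ← permSum_insert L S hi]
        have hlt : R.card < Fintype.card ι := by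
          rw [← Finset.card_univ]
          exact Finset.card_lt_card (Finset.ssubset_univ_iff.mpr (by rintro rfl; simp at hi))
        obtain ⟨c, hc⟩ : ∃ c, Fintype.card ι - R.card = c + 1 := ⟨Fintype.card ι - R.card - 1, by omega⟩
        rw [show Fintype.card ι - (R.card + 1) = c by omega, hc, Nat.factorial_succ]
        push_cast
        have h3 : (c ! : ℝ) ≠ 0 := by positivity
        have h4 : (c : ℝ) + 1 ≠ 0 := by positivity
        field_simp
      · rw [if_neg (by omega)]
        simp [hk]

/-- The sum of all permanents of `k × k` submatrices of `L`, encoded as a Wick moment. -/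
def subPermSum (L : Matrix ι ι ℝ) (k : ℕ) : ℝ :=
  wick (bip L) k (∏ v : ι ⊕ ι, (1 + X v))

/-- Each permanent of a `k × k` submatrix with rows `R` is counted on the right once for every way
of extending an injection of `R` to a permutation, that is, `(n - k)!` times. -/
lemma subPermSum_eq (L : Matrix ι ι ℝ) (k : ℕ) :
    subPermSum L k = ∑ R ∈ Finset.powersetCard k (Finset.univ : Finset ι),
      permSum L R Finset.univ / ((Fintype.card ι - k)! : ℝ) := by
  rw [subPermSum, Fintype.prod_sum_type, Finset.prod_one_add, Finset.sum_mul, map_sum]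
  simp only [wick_bip_prod]
  rw [← Finset.sum_filter]
  have : Finset.filter (fun R => k = R.card) (Finset.univ : Finset ι).powerset =
      Finset.powersetCard k Finset.univ := by
    ext R; simp [Finset.mem_powersetCard, eq_comm]
  rw [this]
  refine Finset.sum_congr rfl fun R hR => ?_
  rw [(Finset.mem_powersetCard.mp hR).2]

end Pairings

/-! ### Power series with quadratic exponents -/

section QuadExp

open PowerSeries

variable {R : Type*} [CommRing R] [Algebra ℝ R]

/-- The coefficients of the formal power series `exp (c x + d x² / 2)`. -/
def quadExpCoeff (c d : R) : ℕ → R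
  | 0 => 1
  | 1 => c
  | m + 2 => ((m + 2 : ℝ))⁻¹ • (c * quadExpCoeff c d (m + 1) + d * quadExpCoeff c d m)

/-- The formal power series `exp (c x + d x² / 2)`. -/
def quadExp (c d : R) : R⟦X⟧ := PowerSeries.mk (quadExpCoeff c d)

omit [Algebra ℝ R] in
lemma coeff_succ_quadratic_mul (c d : R) (f : R⟦X⟧) (m : ℕ) :
    coeff (m + 1) ((C c + C d * X) * f) = c * coeff (m + 1) f + d * coeff m f := by
  rw [add_mul, map_add, coeff_C_mul, mul_assoc, coeff_C_mul, coeff_succ_X_mul]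

lemma derivative_quadExp (c d : R) :
    derivative R (quadExp c d) = (C c + C d * X) * quadExp c d := by
  ext m
  rw [coeff_derivative]
  cases m with
  | zero => simp [quadExp, quadExpCoeff, add_mul, mul_assoc]
  | succ m =>
    rw [coeff_succ_quadratic_mul]
    simp only [quadExp, coeff_mk, quadExpCoeff]
    rw [← Nat.cast_add_one, mul_comm, ← nsmul_eq_mul, ← Nat.cast_smul_eq_nsmul ℝ, smul_smul]
    push_cast
    rw [show ((m : ℝ) + 1 + 1) = m + 2 by ring, mul_inv_cancel₀ (by positivity), one_smul]

/-- The differential equation characterizes `quadExp`. -/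
lemma eq_quadExp {c d : R} {f : R⟦X⟧} (h0 : coeff 0 f = 1)
    (h : derivative R f = (C c + C d * X) * f) : f = quadExp c d := by
  have key : ∀ m, coeff (m + 2) f = ((m + 2 : ℝ))⁻¹ • (c * coeff (m + 1) f + d * coeff m f) := by
    intro m
    have h1 := congrArg (coeff (m + 1)) h
    rw [coeff_derivative, coeff_succ_quadratic_mul] at h1
    rw [← h1, ← Nat.cast_add_one, mul_comm, ← nsmul_eq_mul, ← Nat.cast_smul_eq_nsmul ℝ, smul_smul]
    push_cast
    rw [show ((m : ℝ) + 1 + 1) = m + 2 by ring, inv_mul_cancel₀ (by positivity), one_smul]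
  have main : ∀ m, coeff m f = quadExpCoeff c d m ∧ coeff (m + 1) f = quadExpCoeff c d (m + 1) := by
    intro m
    induction m with
    | zero =>
      refine ⟨h0, ?_⟩
      have h1 := congrArg (coeff 0) h
      rw [coeff_derivative] at h1
      simp only [coeff_zero_eq_constantCoeff] at h0
      simpa [quadExpCoeff, add_mul, mul_assoc, h0] using h1
    | succ m ih =>
      refine ⟨ih.2, ?_⟩
      rw [key, ih.1, ih.2]
      rfl
  ext m
  rw [(main m).1, quadExp, coeff_mk]

lemma quadExp_mul (c d c' d' : R) :
    quadExp c d * quadExp c' d' = quadExp (c + c') (d + d') := by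
  apply eq_quadExp
  · simp [quadExp, quadExpCoeff]
  · rw [Derivation.leibniz, derivative_quadExp, derivative_quadExp]
    simp only [smul_eq_mul, map_add]
    ring

lemma quadExp_zero : quadExp (0 : R) 0 = 1 := by
  symm
  apply eq_quadExp <;> simp

lemma quadExp_prod {V : Type*} (s : Finset V) (c d : V → R) :
    ∏ v ∈ s, quadExp (c v) (d v) = quadExp (∑ v ∈ s, c v) (∑ v ∈ s, d v) := by
  classical
  induction s using Finset.induction_on with
  | empty => simp [quadExp_zero]
  | insert a s ha ih => rw [Finset.prod_insert ha, ih, quadExp_mul, Finset.sum_insert ha,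
      Finset.sum_insert ha]

lemma quadExpCoeff_zero_odd (d : R) (j : ℕ) : quadExpCoeff 0 d (2 * j + 1) = 0 := by
  induction j with
  | zero => simp [quadExpCoeff]
  | succ j ih => simp [Nat.mul_succ, quadExpCoeff, ih]

/-- Modulo `c`, the linear part of the exponent may be dropped. -/
lemma quadExpCoeff_sub_dvd (c d : R) (m : ℕ) :
    c ∣ quadExpCoeff c d m - quadExpCoeff 0 d m ∧
      c ∣ quadExpCoeff c d (m + 1) - quadExpCoeff 0 d (m + 1) := by
  induction m with
  | zero => simp [quadExpCoeff]
  | succ m ih =>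
    refine ⟨ih.2, ?_⟩
    simp only [quadExpCoeff]
    rw [← smul_sub]
    have h : c ∣ c * quadExpCoeff c d (m + 1) + d * quadExpCoeff c d m -
        (0 * quadExpCoeff 0 d (m + 1) + d * quadExpCoeff 0 d m) := by
      have := (Dvd.intro (quadExpCoeff c d (m + 1)) rfl).add (ih.1.mul_left d)
      convert this using 1
      ring
    obtain ⟨e, he⟩ := h
    rw [he]
    exact ⟨_, (mul_smul_comm _ _ _).symm⟩

lemma quadExpCoeff_homog (γ : R) (m : ℕ) :
    quadExpCoeff (-γ) (γ ^ 2) m = quadExpCoeff (-1 : ℝ) 1 m • γ ^ m ∧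
      quadExpCoeff (-γ) (γ ^ 2) (m + 1) = quadExpCoeff (-1 : ℝ) 1 (m + 1) • γ ^ (m + 1) := by
  induction m with
  | zero => simp [quadExpCoeff]
  | succ m ih =>
    refine ⟨ih.2, ?_⟩
    simp only [quadExpCoeff, ih.1, ih.2]
    simp only [smul_eq_mul, mul_smul, mul_smul_comm, add_smul, smul_add, neg_mul, one_mul, neg_smul]
    congr 2
    · rw [smul_neg, neg_inj]; congr 1; ring_nf
    · congr 1; ring_nf

/-- The coefficients of `(1 + x) exp (-x + x² / 2)`. -/
def kappa (l : ℕ) : ℝ := coeff l ((1 + X) * quadExp (-1 : ℝ) 1)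

lemma kappa_zero : kappa 0 = 1 := by simp [kappa, quadExp, quadExpCoeff]

lemma kappa_succ (l : ℕ) :
    kappa (l + 1) = quadExpCoeff (-1 : ℝ) 1 (l + 1) + quadExpCoeff (-1 : ℝ) 1 l := by
  rw [kappa, add_mul, map_add, coeff_succ_X_mul, one_mul]
  simp [quadExp]

lemma kappa_one : kappa 1 = 0 := by
  rw [kappa_succ]; simp [quadExpCoeff]

lemma kappa_two : kappa 2 = 0 := by
  rw [kappa_succ]; simp [quadExpCoeff]; norm_num

lemma abs_quadExpCoeff_le_one (m : ℕ) :
    |quadExpCoeff (-1 : ℝ) 1 m| ≤ 1 ∧ |quadExpCoeff (-1 : ℝ) 1 (m + 1)| ≤ 1 := by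
  induction m with
  | zero => simp [quadExpCoeff]
  | succ m ih =>
    refine ⟨ih.2, ?_⟩
    simp only [quadExpCoeff, smul_eq_mul, abs_mul, abs_inv]
    rw [inv_mul_le_iff₀ (by positivity), abs_of_pos (by positivity : (0 : ℝ) < m + 2)]
    have h1 := abs_le.mp ih.1
    have h2 := abs_le.mp ih.2
    rw [abs_le]
    have : (0 : ℝ) ≤ m := by positivity
    constructor <;> linarith

lemma abs_kappa_le (l : ℕ) : |kappa l| ≤ 2 := by
  cases l with
  | zero => simp [kappa_zero]
  | succ l =>
    rw [kappa_succ]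
    have := abs_quadExpCoeff_le_one l
    exact (abs_add_le _ _).trans (by linarith [this.1, this.2])

lemma coeff_one_add_mul_quadExp (γ : R) (l : ℕ) :
    coeff l ((1 + C γ * X) * quadExp (-γ) (γ ^ 2)) = kappa l • γ ^ l := by
  cases l with
  | zero => simp [kappa_zero, quadExp, quadExpCoeff]
  | succ l =>
    rw [kappa_succ, add_mul, map_add, mul_assoc, coeff_C_mul, coeff_succ_X_mul, one_mul]
    simp only [quadExp, coeff_mk, (quadExpCoeff_homog γ l).1, (quadExpCoeff_homog γ l).2]
    rw [add_smul, mul_smul_comm, pow_succ']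

end QuadExp

/-! ### Resummation of the quadratic part -/

section Resummation

open MvPolynomial

variable {V : Type*} [Fintype V]

/-- The polynomial `(- ½ ∑ X v ^ 2) ^ j / j!`, the part of degree `2 j` of
`exp (- ½ ∑ X v ^ 2)`. -/
def gaussPart (V : Type*) [Fintype V] (j : ℕ) : MvPolynomial V ℝ :=
  quadExpCoeff 0 (-∑ v, X v ^ 2) (2 * j)

lemma gaussPart_zero : gaussPart V 0 = 1 := rfl

lemma gaussPart_succ (j : ℕ) :
    gaussPart V (j + 1) = -((2 * j + 2 : ℝ)⁻¹ • ((∑ v, X v ^ 2) * gaussPart V j)) := by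
  simp [gaussPart, Nat.mul_succ, quadExpCoeff]

lemma pderiv_sum_sq (w : V) :
    pderiv w (∑ v, X v ^ 2 : MvPolynomial V ℝ) = 2 * X w := by
  classical
  rw [map_sum]
  simp only [pderiv_pow, pderiv_X, Pi.single_apply]
  simp

lemma pderiv_gaussPart_succ (w : V) (j : ℕ) :
    pderiv w (gaussPart V (j + 1)) = -(X w * gaussPart V j) := by
  induction j with
  | zero =>
    rw [gaussPart_succ, gaussPart_zero, map_neg, Derivation.map_smul, mul_one, pderiv_sum_sq, mul_one,
      smul_eq_C_mul, show (2 : MvPolynomial V ℝ) = C 2 from (map_ofNat C 2).symm, ← mul_assoc, ← C_mul]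
    norm_num
  | succ j ih =>
    rw [gaussPart_succ (j + 1), map_neg, Derivation.map_smul, pderiv_mul, ih, pderiv_sum_sq]
    have h : (∑ v, X v ^ 2) * -(X w * gaussPart V j) =
        (2 * j + 2 : ℝ) • (X w * gaussPart V (j + 1)) := by
      rw [gaussPart_succ, mul_neg, mul_neg, smul_neg, mul_smul_comm, smul_smul,
        mul_inv_cancel₀ (by positivity), one_smul]
      ring
    rw [h, mul_assoc, show (2 : MvPolynomial V ℝ) = C 2 from (map_ofNat C 2).symm, ← smul_eq_C_mul,
      ← add_smul, smul_smul]
    push_cast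
    rw [show (2 * ((j : ℝ) + 1) + 2)⁻¹ * (2 + (2 * (j : ℝ) + 2)) = 1 by field_simp; ring, one_smul]

variable [DecidableEq V]

omit [Fintype V] [DecidableEq V] in
lemma isHomogeneous_prod_X (S : Finset V) :
    (∏ v ∈ S, X v : MvPolynomial V ℝ).IsHomogeneous S.card := by
  have := IsHomogeneous.prod S (fun v => (X v : MvPolynomial V ℝ)) (fun _ => 1)
    (fun v _ => isHomogeneous_X ℝ v)
  simpa using this

omit [DecidableEq V] in
lemma coeff_prod_one_add (m : ℕ) :
    PowerSeries.coeff m (∏ v : V, (1 + PowerSeries.C (X v : MvPolynomial V ℝ) * PowerSeries.X)) =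
      ∑ S ∈ Finset.powersetCard m (Finset.univ : Finset V), ∏ v ∈ S, X v := by
  rw [Finset.prod_one_add, map_sum]
  simp only [Finset.prod_mul_distrib, Finset.prod_const, ← map_prod, PowerSeries.coeff_C_mul,
    PowerSeries.coeff_X_pow, mul_ite, mul_one, mul_zero]
  rw [← Finset.sum_filter]
  refine Finset.sum_congr ?_ fun _ _ => rfl
  ext R; simp [Finset.mem_powersetCard, eq_comm]

omit [DecidableEq V] in
lemma wick_prod_one_add (B : Matrix V V ℝ) (k : ℕ) :
    wick B k (∏ v : V, (1 + X v)) =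
      wick B k (PowerSeries.coeff (2 * k)
        (∏ v : V, (1 + PowerSeries.C (X v : MvPolynomial V ℝ) * PowerSeries.X))) := by
  rw [coeff_prod_one_add, Finset.prod_one_add, map_sum, map_sum]
  symm
  refine Finset.sum_subset (by simp) fun S _ hS => ?_
  refine wick_eq_zero_of_isHomogeneous B ?_ (isHomogeneous_prod_X S)
  simpa [Finset.mem_powersetCard] using hS

omit [DecidableEq V] in
/-- The factorization `1 + x = exp (x - x² / 2) * ((1 + x) * exp (-x + x² / 2))`, multiplied over
all variables. -/
lemma prod_one_add_eq :
    ∏ v : V, (1 + PowerSeries.C (X v : MvPolynomial V ℝ) * PowerSeries.X) =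
      quadExp (∑ v, X v) (-∑ v, X v ^ 2) *
        ∏ v : V, ((1 + PowerSeries.C (X v : MvPolynomial V ℝ) * PowerSeries.X) *
          quadExp (-X v) (X v ^ 2)) := by
  rw [Finset.prod_mul_distrib, quadExp_prod, mul_left_comm, quadExp_mul, Finset.sum_neg_distrib,
    add_neg_cancel, neg_add_cancel, quadExp_zero, mul_one]

lemma coeff_prod_kappa (m : ℕ) :
    PowerSeries.coeff m (∏ v : V, ((1 + PowerSeries.C (X v : MvPolynomial V ℝ) * PowerSeries.X) *
          quadExp (-X v) (X v ^ 2))) =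
      ∑ a ∈ Finset.finsuppAntidiag Finset.univ m, (∏ v, kappa (a v)) • monomial a (1 : ℝ) := by
  rw [PowerSeries.coeff_prod]
  refine Finset.sum_congr rfl fun a _ => ?_
  simp only [coeff_one_add_mul_quadExp]
  rw [Finset.prod_smul, monomial_eq, C_1, one_mul, Finsupp.prod_fintype _ _ (by simp)]

/-- The quadratic part of the exponent is split off exactly. As `kappa 1 = kappa 2 = 0`, only
multi-indices none of whose entries is `1` or `2` contribute. -/
lemma wick_prod_one_add_eq {B : Matrix V V ℝ} (hB : B.IsSymm) (h0 : ∀ w, ∑ v, B v w = 0) (k : ℕ) :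
    wick B k (∏ v : V, (1 + X v)) = ∑ p ∈ Finset.HasAntidiagonal.antidiagonal k,
      ∑ a ∈ Finset.finsuppAntidiag Finset.univ (2 * p.2), (∏ v, kappa (a v)) *
        wick B k (gaussPart V p.1 * monomial a 1) := by
  rw [wick_prod_one_add, prod_one_add_eq, PowerSeries.coeff_mul, map_sum]
  have h1 : ∀ p : ℕ × ℕ, wick B k (PowerSeries.coeff p.1
      (quadExp (∑ v, X v) (-∑ v, X v ^ 2 : MvPolynomial V ℝ)) * PowerSeries.coeff p.2
      (∏ v : V, ((1 + PowerSeries.C (X v : MvPolynomial V ℝ) * PowerSeries.X) *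
          quadExp (-X v) (X v ^ 2)))) =
      ∑ a ∈ Finset.finsuppAntidiag Finset.univ p.2, (∏ v, kappa (a v)) *
        wick B k (quadExpCoeff 0 (-∑ v, X v ^ 2) p.1 * monomial a 1) := by
    intro p
    obtain ⟨e, he⟩ := (quadExpCoeff_sub_dvd (∑ v, X v : MvPolynomial V ℝ) (-∑ v, X v ^ 2) p.1).1
    rw [quadExp, PowerSeries.coeff_mk, sub_eq_iff_eq_add.mp he, add_mul, map_add, mul_assoc,
      wick_sum_X_mul hB h0, zero_add, coeff_prod_kappa, Finset.mul_sum, map_sum]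
    simp only [mul_smul_comm, map_smul, smul_eq_mul]
  simp only [h1]
  symm
  refine Finset.sum_of_injOn (fun p => (2 * p.1, 2 * p.2)) ?_ ?_ ?_ ?_
  · rintro ⟨a, b⟩ _ ⟨c, d⟩ _ h
    simp at h
    simp [h]
  · rintro ⟨a, b⟩ h
    simp at h ⊢
    omega
  · rintro ⟨a, b⟩ hab hn
    simp only [Finset.HasAntidiagonal.mem_antidiagonal] at hab
    obtain ⟨c, rfl | rfl⟩ : ∃ c, a = 2 * c ∨ a = 2 * c + 1 := ⟨a / 2, by omega⟩
    · exfalso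
      apply hn
      refine ⟨(c, b / 2), ?_, ?_⟩
      · simp; omega
      · simp; omega
    · simp [quadExpCoeff_zero_odd]
  · rintro ⟨a, b⟩ _
    rfl

end Resummation

/-! ### Moments of the resummed functional -/

section Moments

open MvPolynomial

variable {V : Type*} [Fintype V] [DecidableEq V]

/-- The Wick functional applied to `f` times the part of degree `2 j` of `exp (- ½ ∑ X v ^ 2)`,
where `f` is thought of as having degree `2 r`. -/
def gaussWick (B : Matrix V V ℝ) (j r : ℕ) (f : MvPolynomial V ℝ) : ℝ :=
  wick B (j + r) (gaussPart V j * f)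

omit [DecidableEq V] in
lemma gaussWick_zero_succ {B : Matrix V V ℝ} (hB : B.IsSymm) (r : ℕ) (v : V)
    (f : MvPolynomial V ℝ) :
    gaussWick B 0 (r + 1) (X v * f) = ∑ w, B v w * gaussWick B 0 r (pderiv w f) := by
  simp only [gaussWick, gaussPart_zero, one_mul, zero_add]
  exact wick_succ_X_mul hB r v f

omit [DecidableEq V] in
lemma gaussWick_succ_succ {B : Matrix V V ℝ} (hB : B.IsSymm) (j r : ℕ) (v : V)
    (f : MvPolynomial V ℝ) :
    gaussWick B (j + 1) (r + 1) (X v * f) = ∑ w, B v w *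
      (gaussWick B (j + 1) r (pderiv w f) - gaussWick B j (r + 1) (X w * f)) := by
  simp only [gaussWick]
  rw [← add_assoc, mul_left_comm, wick_succ_X_mul hB]
  refine Finset.sum_congr rfl fun w _ => ?_
  rw [pderiv_mul, pderiv_gaussPart_succ, map_add, neg_mul, map_neg,
    show j + (r + 1) = j + 1 + r by ring, mul_left_comm (gaussPart V j), mul_assoc]
  ring

/-- Integration by parts for the resummed functional: the covariance `B` is replaced by
`B (1 + B)⁻¹ = B - B² + …`. -/
lemma gaussWick_X_mul {B : Matrix V V ℝ} (hB : B.IsSymm) (j r : ℕ) (v : V)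
    (f : MvPolynomial V ℝ) :
    gaussWick B j (r + 1) (X v * f) = ∑ i ∈ Finset.range (j + 1), (-1) ^ i *
      ∑ w, (B ^ (i + 1)) v w * gaussWick B (j - i) r (pderiv w f) := by
  induction j generalizing v with
  | zero => simp [gaussWick_zero_succ hB]
  | succ j ih =>
    rw [gaussWick_succ_succ hB, Finset.sum_range_succ']
    simp only [ih, mul_sub, Finset.sum_sub_distrib, pow_zero, one_mul, zero_add, pow_one,
      Nat.sub_zero]
    rw [sub_eq_add_neg, add_comm]
    congr 1
    simp only [Finset.mul_sum]
    rw [Finset.sum_comm, ← Finset.sum_neg_distrib]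
    refine Finset.sum_congr rfl fun i _ => ?_
    rw [Finset.sum_comm, ← Finset.sum_neg_distrib]
    refine Finset.sum_congr rfl fun w _ => ?_
    rw [pow_succ' B (i + 1), Matrix.mul_apply, Finset.sum_mul, Finset.mul_sum,
      ← Finset.sum_neg_distrib, show j + 1 - (i + 1) = j - i by omega]
    refine Finset.sum_congr rfl fun x _ => ?_
    ring

/-- The entrywise majorant `∑ |B ^ (i + 1)|` of the covariance `B (1 + B)⁻¹`. -/
def absCov (B : Matrix V V ℝ) (N : ℕ) (v w : V) : ℝ :=
  ∑ i ∈ Finset.range (N + 1), |(B ^ (i + 1)) v w|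

lemma absCov_nonneg (B : Matrix V V ℝ) (N : ℕ) (v w : V) : 0 ≤ absCov B N v w :=
  Finset.sum_nonneg fun _ _ => abs_nonneg _

/-- The sum of the absolute values of the coefficients of the resummed moment of order `a`. -/
def absMom (B : Matrix V V ℝ) (N r : ℕ) (a : V →₀ ℕ) : ℝ :=
  ∑ j ∈ Finset.range (N + 1), |gaussWick B j r (monomial a 1)|

omit [DecidableEq V] in
lemma absMom_nonneg (B : Matrix V V ℝ) (N r : ℕ) (a : V →₀ ℕ) : 0 ≤ absMom B N r a :=
  Finset.sum_nonneg fun _ _ => abs_nonneg _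

lemma sum_range_sum_range_sub_le {F : ℕ → ℕ → ℝ} (hF : ∀ i l, 0 ≤ F i l) (N : ℕ) :
    ∑ j ∈ Finset.range (N + 1), ∑ i ∈ Finset.range (j + 1), F i (j - i) ≤
      ∑ i ∈ Finset.range (N + 1), ∑ l ∈ Finset.range (N + 1), F i l := by
  rw [Finset.sum_comm' (t' := Finset.range (N + 1)) (s' := fun i => Finset.Ico i (N + 1))
    (by intro x y; simp; omega)]
  refine Finset.sum_le_sum fun i hi => ?_
  rw [Finset.sum_Ico_eq_sum_range]
  simp only [add_tsub_cancel_left]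
  exact Finset.sum_le_sum_of_subset_of_nonneg (Finset.range_mono (by omega)) fun _ _ _ => hF _ _

/-- Integration by parts in the variable `X v`, with absolute values. -/
lemma absMom_succ_le {B : Matrix V V ℝ} (hB : B.IsSymm) (N r : ℕ) (v : V) (a : V →₀ ℕ) :
    absMom B N (r + 1) (a + Finsupp.single v 1) ≤
      ∑ w, absCov B N v w * (a w * absMom B N r (a - Finsupp.single w 1)) := by
  have hm : (monomial (a + Finsupp.single v 1) (1 : ℝ)) = X v * monomial a 1 := by
    rw [X, monomial_mul, add_comm, one_mul]
  have hd : ∀ w, pderiv w (monomial a (1 : ℝ)) =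
      (a w : ℝ) • monomial (a - Finsupp.single w 1) (1 : ℝ) := by
    intro w
    rw [pderiv_monomial, smul_monomial]
    simp
  have h1 : ∀ j, |gaussWick B j (r + 1) (monomial (a + Finsupp.single v 1) 1)| ≤
      ∑ i ∈ Finset.range (j + 1), ∑ w, |(B ^ (i + 1)) v w| *
        (a w * |gaussWick B (j - i) r (monomial (a - Finsupp.single w 1) 1)|) := by
    intro j
    rw [hm, gaussWick_X_mul hB]
    refine (Finset.abs_sum_le_sum_abs _ _).trans (Finset.sum_le_sum fun i _ => ?_)
    rw [abs_mul, abs_pow, abs_neg, abs_one, one_pow, one_mul]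
    refine (Finset.abs_sum_le_sum_abs _ _).trans (Finset.sum_le_sum fun w _ => ?_)
    rw [hd, abs_mul, gaussWick, mul_smul_comm, map_smul, smul_eq_mul, abs_mul, Nat.abs_cast]
    exact le_rfl
  refine (Finset.sum_le_sum fun j _ => h1 j).trans ?_
  refine (sum_range_sum_range_sub_le (F := fun i l => ∑ w, |(B ^ (i + 1)) v w| *
        (a w * |gaussWick B l r (monomial (a - Finsupp.single w 1) 1)|))
    (fun i l => Finset.sum_nonneg fun w _ => by positivity) N).trans_eq ?_
  simp only [absCov, absMom, Finset.sum_mul, Finset.mul_sum]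
  rw [Finset.sum_comm]
  rw [Finset.sum_congr rfl fun l _ => Finset.sum_comm]
  rw [Finset.sum_comm]

/-- The trivial bound for a moment, counting pairings. -/
lemma absMom_le {B : Matrix V V ℝ} (hB : B.IsSymm) {N : ℕ} {b : ℝ} (hb0 : 0 ≤ b)
    (hb : ∀ v w, absCov B N v w ≤ b) (r : ℕ) (a : V →₀ ℕ) (ha : ∑ v, a v = 2 * r) :
    absMom B N r a ≤ absMom B N 0 0 * (2 * r * b) ^ r := by
  induction r generalizing a with
  | zero =>
    have : a = 0 := by
      ext v
      have := (Finset.sum_eq_zero_iff (s := Finset.univ)).mp ha v (Finset.mem_univ v)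
      simpa using this
    simp [this]
  | succ r ih =>
    obtain ⟨v, hv⟩ : ∃ v, a v ≠ 0 := by
      by_contra h
      push Not at h
      simp [h] at ha
    obtain ⟨a', rfl⟩ : ∃ a', a = a' + Finsupp.single v 1 :=
      ⟨a - Finsupp.single v 1, by
        rw [tsub_add_cancel_of_le]
        simpa using Nat.one_le_iff_ne_zero.mpr hv⟩
    have hs : ∑ w, a' w = 2 * r + 1 := by
      simp [Finset.sum_add_distrib] at ha
      omega
    refine (absMom_succ_le hB N r v a').trans ?_
    have h1 : ∀ w, absCov B N v w * (a' w * absMom B N r (a' - Finsupp.single w 1)) ≤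
        a' w * (b * (absMom B N 0 0 * (2 * r * b) ^ r)) := by
      intro w
      by_cases hw : a' w = 0
      · simp [hw]
      · have hsum : ∑ x, (a' - Finsupp.single w 1 : V →₀ ℕ) x = 2 * r := by
          have e : a' - Finsupp.single w 1 + Finsupp.single w 1 = a' := by
            rw [tsub_add_cancel_of_le]
            simpa using Nat.one_le_iff_ne_zero.mpr hw
          have : ∑ x, (a' - Finsupp.single w 1 + Finsupp.single w 1 : V →₀ ℕ) x = 2 * r + 1 := by rw [e, hs]
          simp only [Finsupp.add_apply, Finset.sum_add_distrib] at this
          simp at this ⊢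
          omega
        calc absCov B N v w * (a' w * absMom B N r (a' - Finsupp.single w 1))
            ≤ b * (a' w * (absMom B N 0 0 * (2 * r * b) ^ r)) := by
              gcongr
              · exact mul_nonneg (by positivity) (absMom_nonneg _ _ _ _)
              · exact hb v w
              · exact ih _ hsum
          _ = _ := by ring
    refine (Finset.sum_le_sum fun w _ => h1 w).trans ?_
    rw [← Finset.sum_mul, ← Nat.cast_sum, hs]
    have hD := absMom_nonneg B N 0 0
    push_cast
    calc (2 * (r : ℝ) + 1) * (b * (absMom B N 0 0 * (2 * r * b) ^ r))
        = absMom B N 0 0 * ((2 * r * b) ^ r * ((2 * r + 1) * b)) := by ring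
      _ ≤ absMom B N 0 0 * ((2 * (r + 1) * b) ^ r * ((2 * (r + 1)) * b)) := by
          gcongr <;> linarith
      _ = _ := by ring

lemma absMom_single_le {B : Matrix V V ℝ} (hB : B.IsSymm) (N r p : ℕ) (v : V) :
    absMom B N (r + 1) (Finsupp.single v (p + 1)) ≤
      absCov B N v v * (p * absMom B N r (Finsupp.single v (p - 1))) := by
  rw [Finsupp.single_add]
  refine (absMom_succ_le hB N r v _).trans_eq ?_
  rw [Finset.sum_eq_single v]
  · rw [← Finsupp.single_tsub]; simp
  · intro w _ hw
    simp [hw.symm]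
  · simp

lemma absMom_pair_le {B : Matrix V V ℝ} (hB : B.IsSymm) (N r p q : ℕ) {v w : V} (h : v ≠ w) :
    absMom B N (r + 1) (Finsupp.single v (p + 1) + Finsupp.single w q) ≤
      absCov B N v v * (p * absMom B N r (Finsupp.single v (p - 1) + Finsupp.single w q)) +
      absCov B N v w * (q * absMom B N r (Finsupp.single v p + Finsupp.single w (q - 1))) := by
  rw [Finsupp.single_add, add_right_comm]
  refine (absMom_succ_le hB N r v _).trans_eq ?_
  rw [Finset.sum_eq_add v w h]
  · congr 3
    · simp [h]
    · congr 1
      ext x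
      by_cases hx : x = v
      · subst hx; simp [h.symm]
      · have : v ≠ x := fun e => hx e.symm
        simp [Finsupp.single_apply, this]
    · simp [h]
    · congr 1
      ext x
      by_cases hx : x = w
      · subst hx; simp [h]
      · have : w ≠ x := fun e => hx e.symm
        simp [Finsupp.single_apply, this]
  · intro x _ hx
    simp [hx.1.symm, hx.2.symm]
  · simp
  · simp

lemma absMom_two_le {B : Matrix V V ℝ} (hB : B.IsSymm) (N : ℕ) (v : V) :
    absMom B N 1 (Finsupp.single v 2) ≤ absCov B N v v * absMom B N 0 0 := by
  simpa using absMom_single_le hB N 0 1 v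

lemma absMom_four_le {B : Matrix V V ℝ} (hB : B.IsSymm) (N : ℕ) (v : V) :
    absMom B N 2 (Finsupp.single v 4) ≤ 3 * absCov B N v v ^ 2 * absMom B N 0 0 := by
  have h0 := absCov_nonneg B N v v
  calc _ ≤ absCov B N v v * ((3 : ℕ) * absMom B N 1 (Finsupp.single v 2)) :=
        absMom_single_le hB N 1 3 v
    _ ≤ absCov B N v v * ((3 : ℕ) * (absCov B N v v * absMom B N 0 0)) := by
        gcongr; exact absMom_two_le hB N v
    _ = _ := by push_cast; ring

lemma absMom_six_le {B : Matrix V V ℝ} (hB : B.IsSymm) (N : ℕ) (v : V) :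
    absMom B N 3 (Finsupp.single v 6) ≤ 15 * absCov B N v v ^ 3 * absMom B N 0 0 := by
  have h0 := absCov_nonneg B N v v
  calc _ ≤ absCov B N v v * ((5 : ℕ) * absMom B N 2 (Finsupp.single v 4)) :=
        absMom_single_le hB N 2 5 v
    _ ≤ absCov B N v v * ((5 : ℕ) * (3 * absCov B N v v ^ 2 * absMom B N 0 0)) := by
        gcongr; exact absMom_four_le hB N v
    _ = _ := by push_cast; ring

lemma absMom_three_three_le {B : Matrix V V ℝ} (hB : B.IsSymm) (N : ℕ) {v w : V} (h : v ≠ w) :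
    absMom B N 3 (Finsupp.single v 3 + Finsupp.single w 3) ≤
      (9 * (absCov B N v v * absCov B N w w * absCov B N v w) + 6 * absCov B N v w ^ 3) *
        absMom B N 0 0 := by
  have hD := absMom_nonneg B N 0 0
  have hvv := absCov_nonneg B N v v
  have hww := absCov_nonneg B N w w
  have hvw := absCov_nonneg B N v w
  have h11 : absMom B N 1 (Finsupp.single v 1 + Finsupp.single w 1) ≤
      absCov B N v w * absMom B N 0 0 := by
    simpa using absMom_pair_le hB N 0 0 1 h
  have h22 : absMom B N 2 (Finsupp.single v 2 + Finsupp.single w 2) ≤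
      absCov B N v v * (absCov B N w w * absMom B N 0 0) +
        absCov B N v w * (2 * (absCov B N v w * absMom B N 0 0)) := by
    have := absMom_pair_le hB N 1 1 2 h
    simp only [Nat.cast_one, one_mul, Nat.sub_self, Finsupp.single_zero, zero_add, Nat.cast_ofNat,
      Nat.reduceSub, Nat.reduceAdd] at this
    refine this.trans ?_
    gcongr
    exact absMom_two_le hB N w
  have h13 : absMom B N 2 (Finsupp.single v 1 + Finsupp.single w 3) ≤
      absCov B N v w * (3 * (absCov B N w w * absMom B N 0 0)) := by
    have := absMom_pair_le hB N 1 0 3 h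
    simp only [Nat.cast_zero, zero_mul, mul_zero, zero_add, Nat.cast_ofNat, Nat.reduceSub,
      Finsupp.single_zero, Nat.reduceAdd] at this
    refine this.trans ?_
    gcongr
    exact absMom_two_le hB N w
  calc _ ≤ absCov B N v v * ((2 : ℕ) * absMom B N 2 (Finsupp.single v 1 + Finsupp.single w 3)) +
      absCov B N v w * ((3 : ℕ) * absMom B N 2 (Finsupp.single v 2 + Finsupp.single w 2)) :=
        absMom_pair_le hB N 2 2 3 h
    _ ≤ absCov B N v v * ((2 : ℕ) * (absCov B N v w * (3 * (absCov B N w w * absMom B N 0 0)))) +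
      absCov B N v w * ((3 : ℕ) * (absCov B N v v * (absCov B N w w * absMom B N 0 0) +
        absCov B N v w * (2 * (absCov B N v w * absMom B N 0 0)))) := by gcongr
    _ = _ := by push_cast; ring

end Moments

/-! ### Summation over multi-indices -/

section Counting

open MvPolynomial

variable {V : Type*} [Fintype V] [DecidableEq V]

/-- The total contribution of multi-indices of degree `2 r` to the moments of order at most `N`. -/
def levelSum (B : Matrix V V ℝ) (N r : ℕ) : ℝ :=
  ∑ a ∈ Finset.finsuppAntidiag (Finset.univ : Finset V) (2 * r),
    (∏ v, |kappa (a v)|) * absMom B N r a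

/-- The multi-index `0` contributes the coefficients of the normalization; all others are collected
by degree. -/
lemma sum_abs_wick_sub_le {B : Matrix V V ℝ} (hB : B.IsSymm) (h0 : ∀ w, ∑ v, B v w = 0) (N : ℕ) :
    ∑ k ∈ Finset.range (N + 1), |wick B k (∏ v : V, (1 + X v)) - gaussWick B k 0 1| ≤
      ∑ r ∈ Finset.Ico 1 (N + 1), levelSum B N r := by
  have h1 : ∀ k, |wick B k (∏ v : V, (1 + X v)) - gaussWick B k 0 1| ≤
      ∑ j ∈ Finset.range k, ∑ a ∈ Finset.finsuppAntidiag (Finset.univ : Finset V) (2 * (k - j)),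
        (∏ v, |kappa (a v)|) * |gaussWick B j (k - j) (monomial a 1)| := by
    intro k
    rw [wick_prod_one_add_eq hB h0, Finset.Nat.sum_antidiagonal_eq_sum_range_succ_mk,
      Finset.sum_range_succ]
    simp only [Nat.sub_self, mul_zero, Finset.finsuppAntidiag_zero, Finset.sum_singleton,
      Finsupp.coe_zero, Pi.zero_apply, kappa_zero, Finset.prod_const_one, one_mul]
    rw [show wick B k (gaussPart V k * monomial 0 1) = gaussWick B k 0 1 from rfl, add_sub_cancel_right]
    refine (Finset.abs_sum_le_sum_abs _ _).trans (Finset.sum_le_sum fun j hj => ?_)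
    refine (Finset.abs_sum_le_sum_abs _ _).trans (Finset.sum_le_sum fun a _ => ?_)
    rw [abs_mul, Finset.abs_prod, gaussWick, Nat.add_sub_cancel' (Finset.mem_range.mp hj).le]
  refine (Finset.sum_le_sum fun k _ => h1 k).trans ?_
  rw [Finset.sum_comm' (t' := Finset.range (N + 1)) (s' := fun j => Finset.Ico (j + 1) (N + 1))
    (by intro x y; simp; omega)]
  have h2 : ∀ j ∈ Finset.range (N + 1), ∑ k ∈ Finset.Ico (j + 1) (N + 1),
      ∑ a ∈ Finset.finsuppAntidiag (Finset.univ : Finset V) (2 * (k - j)),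
        (∏ v, |kappa (a v)|) * |gaussWick B j (k - j) (monomial a 1)| ≤
      ∑ r ∈ Finset.Ico 1 (N + 1),
      ∑ a ∈ Finset.finsuppAntidiag (Finset.univ : Finset V) (2 * r),
        (∏ v, |kappa (a v)|) * |gaussWick B j r (monomial a 1)| := by
    intro j _
    rw [Finset.sum_Ico_eq_sum_range, Finset.sum_Ico_eq_sum_range]
    simp only [show ∀ i, j + 1 + i - j = 1 + i by omega]
    exact Finset.sum_le_sum_of_subset_of_nonneg (Finset.range_mono (by omega)) fun _ _ _ =>
      Finset.sum_nonneg fun _ _ => mul_nonneg (Finset.prod_nonneg fun _ _ => abs_nonneg _)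
        (abs_nonneg _)
  refine (Finset.sum_le_sum h2).trans_eq ?_
  rw [Finset.sum_comm]
  refine Finset.sum_congr rfl fun r _ => ?_
  rw [Finset.sum_comm, levelSum]
  refine Finset.sum_congr rfl fun a _ => ?_
  rw [absMom, Finset.mul_sum]

lemma sum_range_abs_kappa_le {x : ℝ} (hx : 0 ≤ x) (hx2 : x ≤ 1 / 2) (m : ℕ) :
    ∑ l ∈ Finset.range (m + 1), |kappa l| * x ^ l ≤ Real.exp (4 * x ^ 3) := by
  have h1 : ∑ l ∈ Finset.range (m + 1), |kappa l| * x ^ l ≤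
      ∑ l ∈ Finset.range (m + 1 + 2), |kappa l| * x ^ l :=
    Finset.sum_le_sum_of_subset_of_nonneg (Finset.range_mono (by omega))
      fun _ _ _ => by positivity
  have h2 : ∑ l ∈ Finset.range (m + 1 + 2), |kappa l| * x ^ l ≤ 1 + 4 * x ^ 3 := by
    rw [show m + 1 + 2 = 3 + m by ring, Finset.sum_range_add]
    simp only [Finset.sum_range_succ, Finset.sum_range_zero, kappa_zero, kappa_one, kappa_two]
    have h3 : ∑ l ∈ Finset.range m, |kappa (3 + l)| * x ^ (3 + l) ≤
        ∑ l ∈ Finset.range m, 2 * x ^ 3 * (1 / 2) ^ l := by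
      refine Finset.sum_le_sum fun l _ => ?_
      rw [pow_add, ← mul_assoc]
      gcongr
      exact abs_kappa_le _
    rw [← Finset.mul_sum] at h3
    have h4 : ∑ l ∈ Finset.range m, (1 / 2 : ℝ) ^ l ≤ 2 := by
      rw [geom_sum_eq (by norm_num)]
      have : (0 : ℝ) ≤ (1 / 2) ^ m := by positivity
      rw [show (1 / 2 - 1 : ℝ) = -(1 / 2) by norm_num, div_neg, ← neg_div, neg_sub,
        div_le_iff₀ (by norm_num)]
      linarith
    have h5 : 2 * x ^ 3 * ∑ l ∈ Finset.range m, (1 / 2 : ℝ) ^ l ≤ 2 * x ^ 3 * 2 := by gcongr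
    norm_num
    linarith
  refine (h1.trans h2).trans ?_
  have := Real.add_one_le_exp (4 * x ^ 3)
  linarith

/-- The weighted number of admissible multi-indices of degree `m`, by Rankin's trick. -/
lemma sum_prod_abs_kappa_le {x : ℝ} (hx : 0 ≤ x) (hx2 : x ≤ 1 / 2) (m : ℕ) :
    x ^ m * ∑ a ∈ Finset.finsuppAntidiag (Finset.univ : Finset V) m, ∏ v, |kappa (a v)| ≤
      Real.exp (4 * Fintype.card V * x ^ 3) := by
  have h1 : x ^ m * ∑ a ∈ Finset.finsuppAntidiag (Finset.univ : Finset V) m, ∏ v, |kappa (a v)| =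
      ∑ a ∈ Finset.finsuppAntidiag (Finset.univ : Finset V) m, ∏ v, (|kappa (a v)| * x ^ (a v)) := by
    rw [Finset.mul_sum]
    refine Finset.sum_congr rfl fun a ha => ?_
    rw [Finset.prod_mul_distrib, Finset.prod_pow_eq_pow_sum, (Finset.mem_finsuppAntidiag.mp ha).1,
      mul_comm]
  have h2 : ∑ a ∈ Finset.finsuppAntidiag (Finset.univ : Finset V) m, ∏ v, (|kappa (a v)| * x ^ (a v))
      ≤ ∑ f ∈ Fintype.piFinset fun _ : V => Finset.range (m + 1),
        ∏ v, (|kappa (f v)| * x ^ (f v)) := by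
    rw [← Finset.sum_image (g := fun a : V →₀ ℕ => (a : V → ℕ))
      (f := fun f : V → ℕ => ∏ v, (|kappa (f v)| * x ^ (f v))) (by
        intro a _ b _ h; exact DFunLike.coe_injective h)]
    refine Finset.sum_le_sum_of_subset_of_nonneg ?_ fun _ _ _ =>
      Finset.prod_nonneg fun _ _ => by positivity
    intro f hf
    obtain ⟨a, ha, rfl⟩ := Finset.mem_image.mp hf
    rw [Fintype.mem_piFinset]
    intro v
    have := (Finset.mem_finsuppAntidiag.mp ha).1
    have h3 : a v ≤ ∑ w, a w := Finset.single_le_sum (fun _ _ => Nat.zero_le _) (Finset.mem_univ v)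
    exact Finset.mem_range.mpr (Nat.lt_succ_of_le (h3.trans_eq this))
  rw [h1]
  refine h2.trans ?_
  rw [Finset.sum_prod_piFinset (s := Finset.range (m + 1)) (g := fun _ l => |kappa l| * x ^ l)]
  rw [Finset.prod_const]
  calc _ ≤ Real.exp (4 * x ^ 3) ^ (Finset.univ : Finset V).card := by
        gcongr
        exact sum_range_abs_kappa_le hx hx2 m
    _ = _ := by rw [← Real.exp_nat_mul, Finset.card_univ]; ring_nf

/-- The bound for high levels, with the parameter of Rankin's trick optimized. -/
lemma levelSum_le {B : Matrix V V ℝ} (hB : B.IsSymm) {N r : ℕ} {b x : ℝ} (hb0 : 0 ≤ b)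
    (hb : ∀ v w, absCov B N v w ≤ b) (hx : 0 < x) (hx2 : x ≤ 1 / 2)
    (hr : (Fintype.card V : ℝ) * x ^ 3 = 2 * r) :
    levelSum B N r ≤ absMom B N 0 0 * (Fintype.card V * b * x * Real.exp 8) ^ r := by
  have hD := absMom_nonneg B N 0 0
  have h1 : levelSum B N r ≤ (∑ a ∈ Finset.finsuppAntidiag (Finset.univ : Finset V) (2 * r),
      ∏ v, |kappa (a v)|) * (absMom B N 0 0 * (2 * r * b) ^ r) := by
    rw [levelSum, Finset.sum_mul]
    refine Finset.sum_le_sum fun a ha => ?_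
    refine mul_le_mul_of_nonneg_left ?_ (Finset.prod_nonneg fun _ _ => abs_nonneg _)
    exact absMom_le hB hb0 hb r a (Finset.mem_finsuppAntidiag.mp ha).1
  refine h1.trans ?_
  have h2 := sum_prod_abs_kappa_le (V := V) hx.le hx2 (2 * r)
  have h3 : 2 * (r : ℝ) * b = x ^ 2 * (Fintype.card V * b * x) := by rw [← hr]; ring
  rw [h3, mul_pow, ← pow_mul]
  have h4 : Real.exp (4 * Fintype.card V * x ^ 3) = Real.exp 8 ^ r := by
    rw [← Real.exp_nat_mul, mul_assoc, hr]; ring_nf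
  rw [h4] at h2
  calc _ = (x ^ (2 * r) * ∑ a ∈ Finset.finsuppAntidiag (Finset.univ : Finset V) (2 * r),
      ∏ v, |kappa (a v)|) * (absMom B N 0 0 * (Fintype.card V * b * x) ^ r) := by ring
    _ ≤ Real.exp 8 ^ r * (absMom B N 0 0 * (Fintype.card V * b * x) ^ r) := by
        gcongr
    _ = _ := by rw [mul_pow _ (Real.exp 8)]; ring

omit [DecidableEq V] in
lemma prod_abs_kappa_eq_zero {a : V →₀ ℕ} {v : V} (h : a v = 1 ∨ a v = 2) :
    ∏ v, |kappa (a v)| = 0 := by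
  refine Finset.prod_eq_zero (Finset.mem_univ v) ?_
  rcases h with h | h <;> simp [h, kappa_one, kappa_two]

omit [DecidableEq V] in
lemma prod_abs_kappa_single_le (v : V) (p : ℕ) :
    ∏ w, |kappa (Finsupp.single v p w)| ≤ 2 := by
  rw [Finset.prod_eq_single v]
  · simpa using abs_kappa_le p
  · intro w _ hw
    simp [hw.symm, kappa_zero]
  · simp

lemma prod_abs_kappa_pair_le {v w : V} (h : v ≠ w) (p q : ℕ) :
    ∏ x, |kappa ((Finsupp.single v p + Finsupp.single w q) x)| ≤ 4 := by
  have h1 : ∀ x, |kappa ((Finsupp.single v p + Finsupp.single w q) x)| =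
      |kappa (Finsupp.single v p x)| * |kappa (Finsupp.single w q x)| := by
    intro x
    by_cases hx : x = v
    · subst hx; simp [h.symm, kappa_zero]
    · have : v ≠ x := fun e => hx e.symm
      simp [this, kappa_zero]
  simp only [h1, Finset.prod_mul_distrib]
  have h2 := prod_abs_kappa_single_le v p
  have h3 := prod_abs_kappa_single_le w q
  calc _ ≤ (2 : ℝ) * 2 := mul_le_mul h2 h3 (Finset.prod_nonneg fun _ _ => abs_nonneg _) (by norm_num)
    _ = 4 := by norm_num

omit [DecidableEq V] in
/-- A nonempty multi-index without entries `1` and `2` has an entry that is at least `3`. -/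
lemma exists_three_le {a : V →₀ ℕ} (ha : ∑ v, a v ≠ 0) (h : ∀ v, a v ≠ 1 ∧ a v ≠ 2) :
    ∃ v, 3 ≤ a v := by
  by_contra hc
  push Not at hc
  apply ha
  refine Finset.sum_eq_zero fun v _ => ?_
  have := hc v
  have := h v
  omega

lemma sum_eq_add_sum_erase (a : V →₀ ℕ) (v : V) : ∑ x, a x = a v + ∑ x, (a.erase v) x := by
  rw [← Finset.add_sum_erase _ _ (Finset.mem_univ v)]
  congr 1
  rw [← Finset.add_sum_erase _ _ (Finset.mem_univ v)]
  rw [Finsupp.erase_same, zero_add]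
  refine Finset.sum_congr rfl fun x hx => ?_
  rw [Finsupp.erase_ne (Finset.ne_of_mem_erase hx)]

/-- Peeling off one entry of an admissible multi-index. -/
lemma exists_eq_single_add {a : V →₀ ℕ} (ha : ∑ v, a v ≠ 0) (h : ∀ v, a v ≠ 1 ∧ a v ≠ 2) :
    ∃ v p, ∃ a' : V →₀ ℕ, 3 ≤ p ∧ a = Finsupp.single v p + a' ∧ a' v = 0 ∧
      (∀ v, a' v ≠ 1 ∧ a' v ≠ 2) ∧ ∑ v, a v = p + ∑ v, a' v := by
  obtain ⟨v, hv⟩ := exists_three_le ha h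
  refine ⟨v, a v, a.erase v, hv, (Finsupp.single_add_erase v a).symm, by simp, fun w => ?_,
    sum_eq_add_sum_erase a v⟩
  by_cases hw : w = v
  · subst hw; simp
  · rw [Finsupp.erase_ne hw]; exact h w

omit [DecidableEq V] in
lemma eq_zero_of_sum_eq_zero {a : V →₀ ℕ} (h : ∑ v, a v = 0) : a = 0 := by
  ext v
  simpa using (Finset.sum_eq_zero_iff (s := Finset.univ)).mp h v (Finset.mem_univ v)

lemma sum_le_sum_of_support {α : Type*} {f : α → ℝ} (hf : ∀ a, 0 ≤ f a) {s t : Finset α}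
    (h : ∀ a ∈ s, f a ≠ 0 → a ∈ t) : ∑ a ∈ s, f a ≤ ∑ a ∈ t, f a := by
  rw [← Finset.sum_filter_ne_zero s]
  refine Finset.sum_le_sum_of_subset_of_nonneg (fun a ha => ?_) fun a _ _ => hf a
  exact h a (Finset.mem_filter.mp ha).1 (Finset.mem_filter.mp ha).2

lemma sum_union_le_of_nonneg {α : Type*} [DecidableEq α] {f : α → ℝ} (hf : ∀ a, 0 ≤ f a)
    {s t : Finset α} : ∑ a ∈ s ∪ t, f a ≤ ∑ a ∈ s, f a + ∑ a ∈ t, f a := by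
  rw [← Finset.sum_union_inter]
  exact le_add_of_nonneg_right (Finset.sum_nonneg fun a _ => hf a)

/-- No multi-index of degree `2` is admissible. -/
lemma levelSum_one (B : Matrix V V ℝ) (N : ℕ) : levelSum B N 1 = 0 := by
  refine Finset.sum_eq_zero fun a ha => ?_
  have hs := (Finset.mem_finsuppAntidiag.mp ha).1
  by_cases h : ∃ v, a v = 1 ∨ a v = 2
  · obtain ⟨v, hv⟩ := h
    rw [prod_abs_kappa_eq_zero hv, zero_mul]
  · push Not at h
    obtain ⟨v, hv⟩ := exists_three_le (hs.trans_ne (by norm_num)) h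
    have : a v ≤ ∑ v, a v := Finset.single_le_sum (fun _ _ => Nat.zero_le _) (Finset.mem_univ v)
    have := hs ▸ this
    omega

/-- In degree `4` the only admissible multi-indices are `4` at a single place. -/
lemma levelSum_two_le {B : Matrix V V ℝ} (hB : B.IsSymm) (N : ℕ) :
    levelSum B N 2 ≤ 6 * absMom B N 0 0 * ∑ v, absCov B N v v ^ 2 := by
  have h1 : levelSum B N 2 ≤ ∑ a ∈ Finset.image (fun v : V => Finsupp.single v 4) Finset.univ,
      (∏ v, |kappa (a v)|) * absMom B N 2 a := by
    refine sum_le_sum_of_support (fun a => mul_nonneg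
      (Finset.prod_nonneg fun _ _ => abs_nonneg _) (absMom_nonneg _ _ _ _)) fun a ha hne => ?_
    have hs : ∑ v, a v = _ := (Finset.mem_finsuppAntidiag.mp ha).1
    have h : ∀ v, a v ≠ 1 ∧ a v ≠ 2 := by
      intro v
      by_contra hc
      exact hne (by rw [prod_abs_kappa_eq_zero (v := v) (by tauto), zero_mul])
    obtain ⟨v, p, a', hp, rfl, -, h', hsum⟩ := exists_eq_single_add (by omega) h
    rcases Nat.eq_zero_or_pos (∑ v, a' v) with h0 | h0
    · rw [eq_zero_of_sum_eq_zero h0, add_zero]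
      have : p = 4 := by omega
      subst this
      exact Finset.mem_image_of_mem _ (Finset.mem_univ v)
    · obtain ⟨w, hw⟩ := exists_three_le h0.ne' h'
      have : a' w ≤ ∑ v, a' v := Finset.single_le_sum (fun _ _ => Nat.zero_le _) (Finset.mem_univ w)
      omega
  refine h1.trans ?_
  rw [Finset.sum_image (by intro v _ w _ h; exact (Finsupp.single_left_injective (by norm_num)) h),
    Finset.mul_sum]
  refine Finset.sum_le_sum fun v _ => ?_
  calc _ ≤ 2 * (3 * absCov B N v v ^ 2 * absMom B N 0 0) :=
        mul_le_mul (prod_abs_kappa_single_le v 4) (absMom_four_le hB N v) (absMom_nonneg _ _ _ _)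
          (by norm_num)
    _ = _ := by ring

/-- In degree `6` the admissible multi-indices are `6` at a single place and `3` at two places. -/
lemma levelSum_three_le {B : Matrix V V ℝ} (hB : B.IsSymm) (N : ℕ) :
    levelSum B N 3 ≤ absMom B N 0 0 * (36 * ∑ v, ∑ w, absCov B N v w ^ 3 +
      (30 + 24 * Fintype.card V) * ∑ v, absCov B N v v ^ 3) := by
  have hD := absMom_nonneg B N 0 0
  have h1 : levelSum B N 3 ≤ ∑ a ∈ Finset.image (fun v : V => Finsupp.single v 6) Finset.univ ∪
      Finset.image (fun p : V × V => Finsupp.single p.1 3 + Finsupp.single p.2 3)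
        (Finset.univ.filter fun p : V × V => p.1 ≠ p.2),
      (∏ v, |kappa (a v)|) * absMom B N 3 a := by
    refine sum_le_sum_of_support (fun a => mul_nonneg
      (Finset.prod_nonneg fun _ _ => abs_nonneg _) (absMom_nonneg _ _ _ _)) fun a ha hne => ?_
    have hs : ∑ v, a v = _ := (Finset.mem_finsuppAntidiag.mp ha).1
    have h : ∀ v, a v ≠ 1 ∧ a v ≠ 2 := by
      intro v
      by_contra hc
      exact hne (by rw [prod_abs_kappa_eq_zero (v := v) (by tauto), zero_mul])
    obtain ⟨v, p, a', hp, rfl, hv, h', hsum⟩ := exists_eq_single_add (by omega) h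
    rw [Finset.mem_union]
    rcases Nat.eq_zero_or_pos (∑ v, a' v) with h0 | h0
    · left
      rw [eq_zero_of_sum_eq_zero h0, add_zero]
      have : p = 6 := by omega
      subst this
      exact Finset.mem_image_of_mem _ (Finset.mem_univ v)
    · right
      obtain ⟨w, q, a'', hq, rfl, hw, h'', hsum'⟩ := exists_eq_single_add h0.ne' h'
      have h0' : ∑ v, a'' v = 0 := by omega
      have e1 : p = 3 := by omega
      have e2 : q = 3 := by omega
      rw [eq_zero_of_sum_eq_zero h0', add_zero] at hv ⊢
      subst e1 e2
      refine Finset.mem_image.mpr ⟨(v, w), ?_, rfl⟩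
      simp only [Finset.mem_filter, Finset.mem_univ, true_and]
      rintro rfl
      simp at hv
  have hnn : ∀ a, 0 ≤ (∏ v, |kappa (a v)|) * absMom B N 3 a := fun a =>
    mul_nonneg (Finset.prod_nonneg fun _ _ => abs_nonneg _) (absMom_nonneg _ _ _ _)
  have h2 : ∑ v : V, (∏ w, |kappa (Finsupp.single v 6 w)|) * absMom B N 3 (Finsupp.single v 6) ≤
      absMom B N 0 0 * (30 * ∑ v, absCov B N v v ^ 3) := by
    rw [Finset.mul_sum, Finset.mul_sum]
    refine Finset.sum_le_sum fun v _ => ?_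
    calc _ ≤ 2 * (15 * absCov B N v v ^ 3 * absMom B N 0 0) :=
          mul_le_mul (prod_abs_kappa_single_le v 6) (absMom_six_le hB N v) (absMom_nonneg _ _ _ _)
            (by norm_num)
      _ = _ := by ring
  have h3 : ∀ p ∈ Finset.univ.filter fun p : V × V => p.1 ≠ p.2,
      (∏ x, |kappa ((Finsupp.single p.1 3 + Finsupp.single p.2 3 : V →₀ ℕ) x)|) *
        absMom B N 3 (Finsupp.single p.1 3 + Finsupp.single p.2 3) ≤
      absMom B N 0 0 * (36 * absCov B N p.1 p.2 ^ 3 + 12 * absCov B N p.1 p.1 ^ 3 +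
        12 * absCov B N p.2 p.2 ^ 3) := by
    rintro ⟨v, w⟩ hp
    have hne : v ≠ w := (Finset.mem_filter.mp hp).2
    have hvv := absCov_nonneg B N v v
    have hww := absCov_nonneg B N w w
    have hvw := absCov_nonneg B N v w
    have hag : absCov B N v v * absCov B N w w * absCov B N v w ≤
        (absCov B N v v ^ 3 + absCov B N w w ^ 3 + absCov B N v w ^ 3) / 3 := by
      generalize absCov B N v v = x at *
      generalize absCov B N w w = y at *
      generalize absCov B N v w = z at *
      nlinarith [mul_nonneg (add_nonneg (add_nonneg hvv hww) hvw)
        (add_nonneg (add_nonneg (sq_nonneg (x - y)) (sq_nonneg (y - z))) (sq_nonneg (z - x)))]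
    calc _ ≤ 4 * ((9 * (absCov B N v v * absCov B N w w * absCov B N v w) +
            6 * absCov B N v w ^ 3) * absMom B N 0 0) :=
          mul_le_mul (prod_abs_kappa_pair_le hne 3 3) (absMom_three_three_le hB N hne)
            (absMom_nonneg _ _ _ _) (by norm_num)
      _ ≤ 4 * ((9 * ((absCov B N v v ^ 3 + absCov B N w w ^ 3 + absCov B N v w ^ 3) / 3) +
            6 * absCov B N v w ^ 3) * absMom B N 0 0) := by gcongr
      _ = _ := by ring
  have h4 : ∑ p ∈ Finset.univ.filter (fun p : V × V => p.1 ≠ p.2),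
      (∏ x, |kappa ((Finsupp.single p.1 3 + Finsupp.single p.2 3 : V →₀ ℕ) x)|) *
        absMom B N 3 (Finsupp.single p.1 3 + Finsupp.single p.2 3) ≤
      absMom B N 0 0 * (36 * ∑ v, ∑ w, absCov B N v w ^ 3 +
        24 * Fintype.card V * ∑ v, absCov B N v v ^ 3) := by
    refine (Finset.sum_le_sum h3).trans ?_
    refine (Finset.sum_le_sum_of_subset_of_nonneg (Finset.filter_subset _ _)
      fun p _ _ => ?_).trans_eq ?_
    · have h5 := absCov_nonneg B N p.1 p.2
      have h6 := absCov_nonneg B N p.1 p.1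
      have h7 := absCov_nonneg B N p.2 p.2
      positivity
    · rw [← Finset.mul_sum, Fintype.sum_prod_type]
      simp only [Finset.sum_add_distrib, Finset.sum_const, Finset.card_univ, nsmul_eq_mul,
        ← Finset.mul_sum]
      ring
  calc levelSum B N 3 ≤ _ := h1
    _ ≤ _ := sum_union_le_of_nonneg hnn
    _ ≤ absMom B N 0 0 * (30 * ∑ v, absCov B N v v ^ 3) + absMom B N 0 0 *
        (36 * ∑ v, ∑ w, absCov B N v w ^ 3 + 24 * Fintype.card V * ∑ v, absCov B N v v ^ 3) := by
        refine add_le_add ?_ ?_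
        · rw [Finset.sum_image (by
            intro v _ w _ h; exact (Finsupp.single_left_injective (by norm_num)) h)]
          exact h2
        · exact (Finset.sum_image_le_of_nonneg fun a _ => hnn a).trans h4
    _ = _ := by ring

end Counting

/-! ### Symmetric contractions -/

section Contractions

variable {V : Type*} [Fintype V] [DecidableEq V]

omit [DecidableEq V] in
lemma dotProduct_sq_le (x y : V → ℝ) : (x ⬝ᵥ y) ^ 2 ≤ (x ⬝ᵥ x) * (y ⬝ᵥ y) := by
  have := Finset.sum_mul_sq_le_sq_mul_sq Finset.univ x y
  simpa [dotProduct, sq] using this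

omit [DecidableEq V] in
lemma dotProduct_self_nonneg' (x : V → ℝ) : 0 ≤ x ⬝ᵥ x :=
  Finset.sum_nonneg fun _ _ => mul_self_nonneg _

/-- `B` has operator norm at most `ρ`, in terms of sums of squares. -/
def NormLE (B : Matrix V V ℝ) (ρ : ℝ) : Prop :=
  ∀ x : V → ℝ, (B *ᵥ x) ⬝ᵥ (B *ᵥ x) ≤ ρ ^ 2 * (x ⬝ᵥ x)

lemma NormLE.pow {B : Matrix V V ℝ} {ρ : ℝ} (h : NormLE B ρ) (i : ℕ) : NormLE (B ^ i) (ρ ^ i) := by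
  induction i with
  | zero => intro x; simp
  | succ i ih =>
    intro x
    rw [pow_succ', ← Matrix.mulVec_mulVec]
    calc _ ≤ ρ ^ 2 * ((B ^ i *ᵥ x) ⬝ᵥ (B ^ i *ᵥ x)) := h _
      _ ≤ ρ ^ 2 * ((ρ ^ i) ^ 2 * (x ⬝ᵥ x)) := by gcongr; exact ih x
      _ = _ := by ring

/-- The Euclidean norm of a row. -/
def rowNorm (B : Matrix V V ℝ) (v : V) : ℝ := √(∑ w, B v w ^ 2)

omit [DecidableEq V] in
lemma rowNorm_nonneg (B : Matrix V V ℝ) (v : V) : 0 ≤ rowNorm B v := Real.sqrt_nonneg _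

omit [DecidableEq V] in
lemma rowNorm_sq (B : Matrix V V ℝ) (v : V) : rowNorm B v ^ 2 = ∑ w, B v w ^ 2 :=
  Real.sq_sqrt (Finset.sum_nonneg fun _ _ => sq_nonneg _)

lemma abs_pow_add_two_apply_le {B : Matrix V V ℝ} (hB : B.IsSymm) {ρ : ℝ} (hρ : 0 ≤ ρ)
    (h : NormLE B ρ) (i : ℕ) (v w : V) :
    |(B ^ (i + 2)) v w| ≤ ρ ^ i * (rowNorm B v * rowNorm B w) := by
  have h1 : (B ^ (i + 2)) v w = B v ⬝ᵥ (B ^ i *ᵥ B w) := by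
    have e : B ^ (i + 2) = B * (B ^ i * B) := by rw [pow_succ, pow_succ', mul_assoc]
    rw [e, Matrix.mul_apply]
    simp only [dotProduct, Matrix.mulVec, Matrix.mul_apply]
    refine Finset.sum_congr rfl fun x _ => congrArg _ (Finset.sum_congr rfl fun y _ => ?_)
    rw [hB.apply w y]
  have h2 : ∀ v, B v ⬝ᵥ B v = rowNorm B v ^ 2 := by
    intro v
    rw [rowNorm_sq]
    simp [dotProduct, sq]
  apply abs_le_of_sq_le_sq _ (by have := rowNorm_nonneg B v; have := rowNorm_nonneg B w; positivity)
  rw [h1]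
  calc _ ≤ (B v ⬝ᵥ B v) * ((B ^ i *ᵥ B w) ⬝ᵥ (B ^ i *ᵥ B w)) := dotProduct_sq_le _ _
    _ ≤ (B v ⬝ᵥ B v) * ((ρ ^ i) ^ 2 * (B w ⬝ᵥ B w)) := by
        gcongr
        · exact dotProduct_self_nonneg' _
        · exact h.pow i _
    _ = _ := by rw [h2, h2]; ring

/-- The covariance of the resummed functional is bounded by the sum of `|B|` and a matrix of rank
one. -/
lemma absCov_le {B : Matrix V V ℝ} (hB : B.IsSymm) {ρ : ℝ} (hρ : 0 ≤ ρ) (hρ1 : ρ < 1)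
    (h : NormLE B ρ) (N : ℕ) (v w : V) :
    absCov B N v w ≤ |B v w| + (1 - ρ)⁻¹ * (rowNorm B v * rowNorm B w) := by
  rw [absCov, Finset.sum_range_succ', add_comm, zero_add, pow_one]
  gcongr
  calc _ ≤ ∑ i ∈ Finset.range N, ρ ^ i * (rowNorm B v * rowNorm B w) :=
        Finset.sum_le_sum fun i _ => abs_pow_add_two_apply_le hB hρ h i v w
    _ = (∑ i ∈ Finset.range N, ρ ^ i) * (rowNorm B v * rowNorm B w) := by rw [Finset.sum_mul]
    _ ≤ _ := by
        have := rowNorm_nonneg B v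
        have := rowNorm_nonneg B w
        gcongr
        rw [← tsum_geometric_of_lt_one hρ hρ1]
        exact (summable_geometric_of_lt_one hρ hρ1).sum_le_tsum _ fun i _ => by positivity

lemma abs_trace_pow_add_two_le {B : Matrix V V ℝ} (hB : B.IsSymm) {ρ : ℝ} (hρ : 0 ≤ ρ)
    (h : NormLE B ρ) (i : ℕ) :
    |(B ^ (i + 2)).trace| ≤ ρ ^ i * ∑ v, ∑ w, B v w ^ 2 := by
  rw [Matrix.trace, Finset.mul_sum]
  refine (Finset.abs_sum_le_sum_abs _ _).trans (Finset.sum_le_sum fun v _ => ?_)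
  refine (abs_pow_add_two_apply_le hB hρ h i v v).trans_eq ?_
  rw [← sq, rowNorm_sq]

/-- The spectral theorem for real symmetric matrices in coordinates. -/
lemma exists_orthogonal_diagonalization {B : Matrix V V ℝ} (hB : B.IsSymm) :
    ∃ (U : Matrix V V ℝ) (μ : V → ℝ), U * Uᵀ = 1 ∧ Uᵀ * U = 1 ∧
      B = U * Matrix.diagonal μ * Uᵀ := by
  have hH : B.IsHermitian := by
    rw [Matrix.IsHermitian, Matrix.conjTranspose_eq_transpose_of_trivial]; exact hB
  have hs : star (hH.eigenvectorUnitary : Matrix V V ℝ) =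
      (hH.eigenvectorUnitary : Matrix V V ℝ)ᵀ := by
    rw [Matrix.star_eq_conjTranspose, Matrix.conjTranspose_eq_transpose_of_trivial]
  refine ⟨hH.eigenvectorUnitary, hH.eigenvalues, ?_, ?_, ?_⟩
  · rw [← hs]; exact Unitary.mul_star_self_of_mem hH.eigenvectorUnitary.2
  · rw [← hs]; exact Unitary.star_mul_self_of_mem hH.eigenvectorUnitary.2
  · have := hH.spectral_theorem
    rw [Unitary.conjStarAlgAut_apply] at this
    rw [← hs]
    simpa using this

lemma trace_pow_eq_sum {B U : Matrix V V ℝ} {μ : V → ℝ}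
    (hU : Uᵀ * U = 1) (hB : B = U * Matrix.diagonal μ * Uᵀ) (i : ℕ) :
    (B ^ i).trace = ∑ v, μ v ^ i := by
  have h : ∀ i, B ^ i = U * Matrix.diagonal (fun v => μ v ^ i) * Uᵀ := by
    intro i
    induction i with
    | zero =>
      simp only [pow_zero, Matrix.diagonal_one, mul_one]
      exact (mul_eq_one_comm.mp hU).symm
    | succ i ih =>
      rw [pow_succ, ih, hB]
      calc _ = U * (Matrix.diagonal (fun v => μ v ^ i) * (Uᵀ * U) * Matrix.diagonal μ) * Uᵀ := by
            simp only [mul_assoc]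
        _ = _ := by rw [hU, mul_one, Matrix.diagonal_mul_diagonal]; simp only [pow_succ]
  rw [h, Matrix.trace_mul_comm, ← mul_assoc, hU, one_mul, Matrix.trace_diagonal]

lemma det_one_add_smul_eq_prod {B U : Matrix V V ℝ} {μ : V → ℝ}
    (hU : Uᵀ * U = 1) (hB : B = U * Matrix.diagonal μ * Uᵀ) (z : ℝ) :
    (1 + z • B).det = ∏ v, (1 + z * μ v) := by
  have hU' : U * Uᵀ = 1 := mul_eq_one_comm.mp hU
  have h : 1 + z • B = U * Matrix.diagonal (fun v => 1 + z * μ v) * Uᵀ := by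
    have : Matrix.diagonal (fun v => 1 + z * μ v) = 1 + z • Matrix.diagonal μ := by
      rw [← Matrix.diagonal_one, ← Matrix.diagonal_smul, Matrix.diagonal_add]
      rfl
    rw [this, mul_add, add_mul, mul_one, hU', hB]
    simp
  rw [h, Matrix.det_mul_right_comm, hU', one_mul, Matrix.det_diagonal]

end Contractions

/-! ### The Gaussian normalization -/

section Normalization

open MvPolynomial

variable {V : Type*} [Fintype V] [DecidableEq V]

/-- The coefficients of `det (1 + z B) ^ (-1/2)`, as moments of the Wick functional. -/
def detCoeff (B : Matrix V V ℝ) (j : ℕ) : ℝ := gaussWick B j 0 1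

omit [DecidableEq V] in
lemma detCoeff_zero (B : Matrix V V ℝ) : detCoeff B 0 = 1 := by
  simp [detCoeff, gaussWick, gaussPart_zero, wick_zero_one]

/-- The recursion that results from differentiating `det (1 + z B) ^ (-1/2)`; it is derived here from
integration by parts. -/
lemma detCoeff_succ {B : Matrix V V ℝ} (hB : B.IsSymm) (j : ℕ) :
    ((j : ℝ) + 1) * detCoeff B (j + 1) =
      ∑ i ∈ Finset.range (j + 1), (-1 / 2) * (-1) ^ i * (B ^ (i + 1)).trace * detCoeff B (j - i) := by
  have h1 : detCoeff B (j + 1) = -((2 * j + 2 : ℝ)⁻¹ * ∑ v, gaussWick B j 1 (X v * X v)) := by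
    rw [detCoeff, gaussWick, gaussPart_succ, mul_one, map_neg, map_smul, Finset.sum_mul, map_sum,
      smul_eq_mul]
    congr 2
    refine Finset.sum_congr rfl fun v _ => ?_
    rw [gaussWick, sq, mul_comm (gaussPart V j)]
  have h2 : ∀ v, gaussWick B j 1 (X v * X v) = ∑ i ∈ Finset.range (j + 1), (-1) ^ i *
      ((B ^ (i + 1)) v v * detCoeff B (j - i)) := by
    intro v
    rw [gaussWick_X_mul hB]
    refine Finset.sum_congr rfl fun i _ => ?_
    rw [Finset.sum_eq_single v]
    · rw [pderiv_X_self, detCoeff]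
    · intro w _ hw
      rw [pderiv_X_of_ne hw.symm]
      simp [gaussWick]
    · simp
  rw [h1]
  simp only [h2]
  rw [Finset.sum_comm]
  simp only [← Finset.mul_sum, ← Finset.sum_mul]
  rw [← mul_neg, ← mul_assoc, show ((j : ℝ) + 1) * (2 * (j : ℝ) + 2)⁻¹ = 1 / 2 by field_simp,
    ← Finset.sum_neg_distrib, Finset.mul_sum]
  refine Finset.sum_congr rfl fun i _ => ?_
  rw [Matrix.trace]
  simp only [Matrix.diag_apply]
  ring

/-- Only traces of even powers of `B` occur in the recursion, and these are nonnegative. -/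
lemma detCoeff_nonneg {B : Matrix V V ℝ} (hB : B.IsSymm)
    (hodd : ∀ i, (B ^ (2 * i + 1)).trace = 0) (j : ℕ) : 0 ≤ detCoeff B j := by
  induction j using Nat.strong_induction_on with
  | _ j ih =>
    cases j with
    | zero => rw [detCoeff_zero]; norm_num
    | succ j =>
      refine nonneg_of_mul_nonneg_right ?_ (by positivity : (0 : ℝ) < (j : ℝ) + 1)
      rw [detCoeff_succ hB]
      refine Finset.sum_nonneg fun i hi => mul_nonneg ?_ (ih _ (by omega))
      rcases Nat.even_or_odd' i with ⟨c, rfl | rfl⟩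
      · rw [hodd, mul_zero]
      · rw [show 2 * c + 1 + 1 = (c + 1) + (c + 1) by ring, pow_add B, Odd.neg_one_pow ⟨c, rfl⟩]
        have : 0 ≤ (B ^ (c + 1) * B ^ (c + 1)).trace := by
          rw [Matrix.trace]
          refine Finset.sum_nonneg fun v _ => ?_
          rw [Matrix.diag_apply, Matrix.mul_apply]
          refine Finset.sum_nonneg fun w _ => ?_
          rw [(hB.pow (c + 1)).apply v w]
          exact mul_self_nonneg _
        linarith

/-- The coefficients of `(1 - ρ x) ^ (-m)`. -/
def negBinom (ρ m : ℝ) : ℕ → ℝ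
  | 0 => 1
  | j + 1 => ρ * (j + m) / (j + 1) * negBinom ρ m j

lemma negBinom_pos {ρ m : ℝ} (hρ : 0 < ρ) (hm : 0 < m) (j : ℕ) : 0 < negBinom ρ m j := by
  induction j with
  | zero => simp [negBinom]
  | succ j ih => rw [negBinom]; positivity

lemma negBinom_succ (ρ m : ℝ) (j : ℕ) : ((j : ℝ) + 1) * negBinom ρ m (j + 1) =
    ∑ i ∈ Finset.range (j + 1), m * ρ ^ (i + 1) * negBinom ρ m (j - i) := by
  have h : ∀ j : ℕ, ((j : ℝ) + 1) * negBinom ρ m (j + 1) = ρ * (j + m) * negBinom ρ m j := by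
    intro j
    rw [negBinom]
    field_simp
  induction j with
  | zero => rw [h]; simp [negBinom, mul_comm]
  | succ j ih =>
    rw [h, Finset.sum_range_succ']
    have e : ρ * (((j + 1 : ℕ) : ℝ) + m) * negBinom ρ m (j + 1) =
        ρ * ((j + 1) * negBinom ρ m (j + 1)) + ρ * m * negBinom ρ m (j + 1) := by push_cast; ring
    rw [e, ih, Finset.mul_sum]
    congr 1
    · refine Finset.sum_congr rfl fun i _ => ?_
      rw [show j + 1 - (i + 1) = j - i by omega]
      ring
    · rw [zero_add, pow_one, Nat.sub_zero, mul_comm ρ m]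

/-- The recursion for `detCoeff` is dominated by that for `negBinom`. -/
lemma detCoeff_le_negBinom {B : Matrix V V ℝ} (hB : B.IsSymm)
    (hodd : ∀ i, (B ^ (2 * i + 1)).trace = 0) {ρ m : ℝ} (hρ : 0 < ρ) (hm : 0 < m)
    (h : NormLE B ρ) (hT : ∑ v, ∑ w, B v w ^ 2 ≤ 2 * m * ρ ^ 2) (j : ℕ) :
    detCoeff B j ≤ negBinom ρ m j := by
  induction j using Nat.strong_induction_on with
  | _ j ih =>
    cases j with
    | zero => rw [detCoeff_zero, negBinom]
    | succ j =>
      refine le_of_mul_le_mul_left ?_ (by positivity : (0 : ℝ) < (j : ℝ) + 1)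
      rw [detCoeff_succ hB, negBinom_succ]
      refine Finset.sum_le_sum fun i hi => mul_le_mul ?_ (ih _ (by omega))
        (detCoeff_nonneg hB hodd _) (by positivity)
      cases i with
      | zero =>
        have := hodd 0
        simp only [mul_zero, zero_add, pow_one] at this
        rw [zero_add, pow_one, this, mul_zero]
        positivity
      | succ i =>
        refine (le_abs_self _).trans ?_
        rw [abs_mul, abs_mul, abs_pow, abs_neg, abs_one, one_pow, mul_one]
        calc _ ≤ |-1 / 2| * (ρ ^ i * ∑ v, ∑ w, B v w ^ 2) := by
              gcongr
              exact abs_trace_pow_add_two_le hB hρ.le h i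
          _ ≤ |-1 / 2| * (ρ ^ i * (2 * m * ρ ^ 2)) := by gcongr
          _ = _ := by rw [abs_of_neg (by norm_num)]; ring

lemma summable_negBinom {ρ m : ℝ} (hρ : 0 < ρ) (hρ1 : ρ < 1) (hm : 0 < m) :
    Summable fun j : ℕ => ((j : ℝ) + 1) ^ 2 * negBinom ρ m j := by
  refine summable_of_ratio_test_tendsto_lt_one hρ1 (.of_forall fun j => ?_) ?_
  · have := negBinom_pos hρ hm j
    positivity
  · have h1 : ∀ c : ℝ, Tendsto (fun j : ℕ => ((j : ℝ) + c) / (j + 1)) atTop (nhds 1) := by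
      intro c
      have := (tendsto_const_nhds (x := (1 : ℝ))).add
        (tendsto_one_div_add_atTop_nhds_zero_nat (𝕜 := ℝ) |>.const_mul (c - 1))
      rw [mul_zero, add_zero] at this
      refine this.congr fun j => ?_
      have : (j : ℝ) + 1 ≠ 0 := by positivity
      field_simp
      ring
    have h2 := ((h1 m).mul ((h1 2).pow 2)).const_mul ρ
    simp only [one_pow, mul_one] at h2
    refine h2.congr fun j => ?_
    have hj := negBinom_pos hρ hm j
    have hj1 := negBinom_pos hρ hm (j + 1)
    rw [Real.norm_of_nonneg (by positivity), Real.norm_of_nonneg (by positivity), negBinom]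
    push_cast
    field_simp
    ring

end Normalization

/-! ### The generating function of the normalization -/

section DetSeries

open PowerSeries

/-- The power series `f` converges absolutely at `z`, with value `s`. -/
def HasEval (f : ℝ⟦X⟧) (z s : ℝ) : Prop :=
  Summable (fun k => ‖coeff k f * z ^ k‖) ∧ ∑' k, coeff k f * z ^ k = s

lemma HasEval.mul {f g : ℝ⟦X⟧} {z s t : ℝ} (hf : HasEval f z s) (hg : HasEval g z t) :
    HasEval (f * g) z (s * t) := by
  have h : ∀ k, coeff k (f * g) * z ^ k = ∑ p ∈ Finset.HasAntidiagonal.antidiagonal k,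
      (coeff p.1 f * z ^ p.1) * (coeff p.2 g * z ^ p.2) := by
    intro k
    rw [coeff_mul, Finset.sum_mul]
    refine Finset.sum_congr rfl fun p hp => ?_
    rw [← Finset.HasAntidiagonal.mem_antidiagonal.mp hp, pow_add]
    ring
  have h1 := summable_norm_sum_mul_antidiagonal_of_summable_norm (f := fun k => coeff k f * z ^ k)
    (g := fun k => coeff k g * z ^ k) hf.1 hg.1
  have h2 := tsum_mul_tsum_eq_tsum_sum_antidiagonal_of_summable_norm
    (f := fun k => coeff k f * z ^ k) (g := fun k => coeff k g * z ^ k) hf.1 hg.1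
  rw [hf.2, hg.2] at h2
  constructor
  · exact h1.congr fun k => by rw [h k]
  · rw [h2]
    exact tsum_congr h

lemma hasEval_one (z : ℝ) : HasEval 1 z 1 := by
  have h : ∀ k ∉ ({0} : Finset ℕ), coeff k (1 : ℝ⟦X⟧) * z ^ k = 0 := by
    intro k hk
    rw [coeff_one, if_neg (by simpa using hk), zero_mul]
  refine ⟨summable_of_ne_finset_zero (s := {0}) fun k hk => by rw [h k hk, norm_zero], ?_⟩
  rw [tsum_eq_sum h]
  simp

lemma hasEval_linear (μ z : ℝ) : HasEval (1 + C μ * X) z (1 + z * μ) := by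
  have h : ∀ k ∉ ({0, 1} : Finset ℕ), coeff k (1 + C μ * X : ℝ⟦X⟧) * z ^ k = 0 := by
    intro k hk
    simp only [Finset.mem_insert, Finset.mem_singleton, not_or] at hk
    rw [map_add, coeff_one, if_neg hk.1, coeff_C_mul, coeff_X, if_neg hk.2]
    simp
  refine ⟨summable_of_ne_finset_zero (s := {0, 1}) fun k hk => by rw [h k hk, norm_zero], ?_⟩
  rw [tsum_eq_sum h, Finset.sum_pair (by norm_num)]
  simp [coeff_one]
  ring

lemma hasEval_prod {V : Type*} (s : Finset V) (μ : V → ℝ) (z : ℝ) :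
    HasEval (∏ v ∈ s, (1 + C (μ v) * X)) z (∏ v ∈ s, (1 + z * μ v)) := by
  classical
  induction s using Finset.induction_on with
  | empty => simpa using hasEval_one z
  | insert a s ha ih =>
    rw [Finset.prod_insert ha, Finset.prod_insert ha]
    exact (hasEval_linear _ _).mul ih

/-- The power series of `μ / (1 + μ x)`. -/
def logDer (μ : ℝ) : ℝ⟦X⟧ := PowerSeries.mk fun i => (-1) ^ i * μ ^ (i + 1)

lemma linear_mul_logDer (μ : ℝ) : (1 + C μ * X) * logDer μ = C μ := by
  ext k
  rw [add_mul, one_mul, mul_assoc, map_add, coeff_C_mul]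
  cases k with
  | zero => simp [logDer]
  | succ k =>
    rw [coeff_succ_X_mul, coeff_C, if_neg (by omega)]
    simp only [logDer, coeff_mk]
    ring

lemma derivative_prod_linear {V : Type*} (s : Finset V) (μ : V → ℝ) :
    derivative ℝ (∏ v ∈ s, (1 + C (μ v) * X)) =
      (∑ v ∈ s, logDer (μ v)) * ∏ v ∈ s, (1 + C (μ v) * X) := by
  classical
  induction s using Finset.induction_on with
  | empty => simp
  | insert a s ha ih =>
    rw [Finset.prod_insert ha, Finset.sum_insert ha, Derivation.leibniz, ih]
    have h1 : derivative ℝ (1 + C (μ a) * X) = C (μ a) := by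
      rw [map_add, Derivation.leibniz]
      simp
    rw [h1]
    simp only [smul_eq_mul]
    linear_combination (-∏ v ∈ s, (1 + C (μ v) * X)) * linear_mul_logDer (μ a)

variable {V : Type*} [Fintype V] [DecidableEq V]

lemma derivative_detCoeff {B U : Matrix V V ℝ} {μ : V → ℝ} (hB : B.IsSymm) (hU : Uᵀ * U = 1)
    (hD : B = U * Matrix.diagonal μ * Uᵀ) :
    2 * derivative ℝ (PowerSeries.mk (detCoeff B)) =
      -((∑ v, logDer (μ v)) * PowerSeries.mk (detCoeff B)) := by
  ext j
  rw [show (2 : ℝ⟦X⟧) = C 2 from (map_ofNat C 2).symm, coeff_C_mul, coeff_derivative, coeff_mk,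
    map_neg, coeff_mul, Finset.Nat.sum_antidiagonal_eq_sum_range_succ_mk, mul_comm (detCoeff B _),
    detCoeff_succ hB, Finset.mul_sum, ← Finset.sum_neg_distrib]
  refine Finset.sum_congr rfl fun i _ => ?_
  rw [trace_pow_eq_sum hU hD, map_sum]
  simp only [logDer, coeff_mk, ← Finset.mul_sum]
  ring

/-- Both sides satisfy the same differential equation. -/
lemma sq_detCoeff_mul_prod {B U : Matrix V V ℝ} {μ : V → ℝ} (hB : B.IsSymm) (hU : Uᵀ * U = 1)
    (hD : B = U * Matrix.diagonal μ * Uᵀ) :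
    PowerSeries.mk (detCoeff B) * PowerSeries.mk (detCoeff B) * ∏ v, (1 + C (μ v) * X) = 1 := by
  apply derivative.ext
  · rw [Derivation.leibniz, Derivation.leibniz, derivative_prod_linear]
    simp only [smul_eq_mul, Derivation.map_one_eq_zero]
    have h := derivative_detCoeff hB hU hD
    linear_combination PowerSeries.mk (detCoeff B) * (∏ v, (1 + C (μ v) * X)) * h
  · have h : constantCoeff (PowerSeries.mk (detCoeff B)) = 1 := by
      rw [← coeff_zero_eq_constantCoeff_apply, coeff_mk, detCoeff_zero]
    simp [map_prod, h]

/-- The moments `detCoeff` sum to `det (1 + z B) ^ (-1/2)`. -/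
lemma tsum_detCoeff_sq_mul_det {B : Matrix V V ℝ} (hB : B.IsSymm) {z : ℝ}
    (hs : Summable fun k => ‖detCoeff B k * z ^ k‖) :
    (∑' k, detCoeff B k * z ^ k) ^ 2 * (1 + z • B).det = 1 := by
  obtain ⟨U, μ, -, hU, hD⟩ := exists_orthogonal_diagonalization hB
  have h1 : HasEval (PowerSeries.mk (detCoeff B)) z (∑' k, detCoeff B k * z ^ k) := by
    constructor
    · simpa using hs
    · simp
  have h2 := (h1.mul h1).mul (hasEval_prod Finset.univ μ z)
  rw [sq_detCoeff_mul_prod hB hU hD] at h2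
  rw [det_one_add_smul_eq_prod hU hD, sq, ← h2.2, (hasEval_one z).2]

end DetSeries

/-! ### The bipartite matrix -/

section Bipartite

variable {ι : Type*} [Fintype ι] [DecidableEq ι]

omit [DecidableEq ι] in
lemma sum_bip {L : Matrix ι ι ℝ} (hr : ∀ i, ∑ j, L i j = 0) (hc : ∀ j, ∑ i, L i j = 0)
    (w : ι ⊕ ι) : ∑ v, bip L v w = 0 := by
  rcases w with i | j <;> simp [bip, hr, hc]

lemma bip_pow_two_mul (L : Matrix ι ι ℝ) (i : ℕ) :
    bip L ^ (2 * i) = Matrix.fromBlocks ((L * Lᵀ) ^ i) 0 0 ((Lᵀ * L) ^ i) := by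
  rw [pow_mul, sq, bip, Matrix.fromBlocks_multiply]
  simp [Matrix.fromBlocks_diagonal_pow]

/-- Closed walks in a bipartite graph have even length. -/
lemma trace_bip_pow_odd (L : Matrix ι ι ℝ) (i : ℕ) : (bip L ^ (2 * i + 1)).trace = 0 := by
  rw [pow_succ, bip_pow_two_mul, bip, Matrix.fromBlocks_multiply]
  simp [Matrix.trace]

omit [DecidableEq ι] in
lemma normLE_bip {L : Matrix ι ι ℝ} {ρ : ℝ} (h : NormLE L ρ) (h' : NormLE Lᵀ ρ) :
    NormLE (bip L) ρ := by
  intro x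
  obtain ⟨y, z, rfl⟩ : ∃ y z, x = Sum.elim y z := ⟨x ∘ Sum.inl, x ∘ Sum.inr, by simp⟩
  rw [bip, Matrix.fromBlocks_mulVec]
  simp only [Sum.elim_comp_inl, Sum.elim_comp_inr, Matrix.zero_mulVec, zero_add, add_zero]
  rw [sumElim_dotProduct_sumElim, sumElim_dotProduct_sumElim]
  linarith [h z, h' y]

lemma det_one_add_smul_bip (L : Matrix ι ι ℝ) (z : ℝ) :
    (1 + z • bip L).det = (1 - (z ^ 2) • (Lᵀ * L)).det := by
  have : 1 + z • bip L = Matrix.fromBlocks 1 (z • L) (z • Lᵀ) 1 := by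
    rw [bip, Matrix.fromBlocks_smul, ← Matrix.fromBlocks_one, Matrix.fromBlocks_add]
    simp
  rw [this, Matrix.det_fromBlocks_one₁₁, Matrix.smul_mul, Matrix.mul_smul, smul_smul, sq]

omit [DecidableEq ι] in
lemma sum_sum_bip (L : Matrix ι ι ℝ) {g : ℝ → ℝ} (hg : g 0 = 0) :
    ∑ v, ∑ w, g (bip L v w) = 2 * ∑ i, ∑ j, g (L i j) := by
  simp only [Fintype.sum_sum_type, bip, Matrix.fromBlocks_apply₁₁, Matrix.fromBlocks_apply₁₂,
    Matrix.fromBlocks_apply₂₁, Matrix.fromBlocks_apply₂₂, Matrix.zero_apply, hg,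
    Finset.sum_const_zero, zero_add, add_zero, Matrix.transpose_apply]
  rw [Finset.sum_comm (f := fun x y => g (L y x))]
  ring

omit [Fintype ι] [DecidableEq ι] in
lemma bip_self_eq_zero (L : Matrix ι ι ℝ) (v : ι ⊕ ι) : bip L v v = 0 := by
  rcases v with i | j <;> simp [bip]

omit [Fintype ι] [DecidableEq ι] in
lemma abs_bip_le {L : Matrix ι ι ℝ} {c : ℝ} (hc : 0 ≤ c) (h : ∀ i j, |L i j| ≤ c) (v w : ι ⊕ ι) :
    |bip L v w| ≤ c := by
  rcases v with i | i <;> rcases w with j | j <;> simp [bip, hc, h]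

omit [DecidableEq ι] in
lemma rowNorm_bip_sq_le {L : Matrix ι ι ℝ} {c : ℝ} (h : ∀ i j, |L i j| ≤ c) (v : ι ⊕ ι) :
    rowNorm (bip L) v ^ 2 ≤ Fintype.card ι * c ^ 2 := by
  have h1 : ∀ i j, L i j ^ 2 ≤ c ^ 2 := fun i j => sq_le_sq' (by linarith [abs_le.mp (h i j)])
    (abs_le.mp (h i j)).2
  rw [rowNorm_sq, Fintype.sum_sum_type]
  rcases v with i | j
  · simp only [bip, Matrix.fromBlocks_apply₁₁, Matrix.fromBlocks_apply₁₂, Matrix.zero_apply]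
    calc _ ≤ ∑ _j : ι, c ^ 2 := by
          simp only [ne_eq, OfNat.ofNat_ne_zero, not_false_eq_true, zero_pow, Finset.sum_const_zero,
            zero_add]
          exact Finset.sum_le_sum fun j _ => h1 i j
      _ = _ := by simp [Finset.card_univ]
  · simp only [bip, Matrix.fromBlocks_apply₂₁, Matrix.fromBlocks_apply₂₂, Matrix.zero_apply]
    calc _ ≤ ∑ _i : ι, c ^ 2 := by
          simp only [ne_eq, OfNat.ofNat_ne_zero, not_false_eq_true, zero_pow, Finset.sum_const_zero,
            add_zero, Matrix.transpose_apply]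
          exact Finset.sum_le_sum fun i _ => h1 i j
      _ = _ := by simp [Finset.card_univ]

omit [DecidableEq ι] in
lemma sum_rowNorm_bip_pow_le (L : Matrix ι ι ℝ) (p : ℕ) :
    ∑ v, (rowNorm (bip L) v ^ 2) ^ (p + 1) ≤
      (2 * Fintype.card ι) ^ p * (2 * ∑ i, ∑ j, L i j ^ (2 * (p + 1))) := by
  rw [← sum_sum_bip L (g := fun x => x ^ (2 * (p + 1))) (by simp), Finset.mul_sum]
  refine Finset.sum_le_sum fun v _ => ?_
  rw [rowNorm_sq]
  refine (pow_sum_le_card_mul_sum_pow (s := Finset.univ) (fun w _ => sq_nonneg (bip L v w)) p).trans_eq ?_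
  rw [Finset.card_univ, Fintype.card_sum, ← two_mul]
  push_cast
  simp only [pow_mul]

/-- The sums of powers of the covariance that bound the first levels. -/
lemma absCov_bip_sums {L : Matrix ι ι ℝ} {ρ : ℝ} (hρ : 0 ≤ ρ) (hρ1 : ρ < 1) (h : NormLE L ρ)
    (h' : NormLE Lᵀ ρ) (N : ℕ) {n M a : ℝ} (hn : n = Fintype.card ι) (hn0 : 0 < n)
    (ha : a = (1 - ρ)⁻¹) (hM3 : ∑ i, ∑ j, |L i j| ^ 3 ≤ M / n)
    (hM4 : ∑ i, ∑ j, L i j ^ 4 ≤ M / n ^ 2) (hM6 : ∑ i, ∑ j, L i j ^ 6 ≤ M / n ^ 4) :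
    ∑ v, absCov (bip L) N v v ^ 2 ≤ 4 * a ^ 2 * M / n ∧
    ∑ v, absCov (bip L) N v v ^ 3 ≤ 8 * a ^ 3 * M / n ^ 2 ∧
    ∑ v, ∑ w, absCov (bip L) N v w ^ 3 ≤ (8 + 64 * a ^ 3) * M / n := by
  have ha0 : 0 ≤ a := by rw [ha]; exact inv_nonneg.mpr (by linarith)
  have hG : ∀ v w, absCov (bip L) N v w ≤ |bip L v w| + a * (rowNorm (bip L) v * rowNorm (bip L) w) :=
    fun v w => ha ▸ absCov_le (bip_isSymm L) hρ hρ1 (normLE_bip h h') N v w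
  have hGv : ∀ v, absCov (bip L) N v v ≤ a * rowNorm (bip L) v ^ 2 := by
    intro v
    have := hG v v
    rwa [bip_self_eq_zero, abs_zero, zero_add, ← sq] at this
  have h0 := absCov_nonneg (bip L) N
  have hr := rowNorm_nonneg (bip L)
  have h2 := sum_rowNorm_bip_pow_le L 1
  have h3 := sum_rowNorm_bip_pow_le L 2
  rw [← hn] at h2 h3
  simp only [Nat.reduceAdd, Nat.reduceMul, pow_one] at h2 h3
  have h2' : ∑ v, (rowNorm (bip L) v ^ 2) ^ 2 ≤ 4 * M / n := by
    refine h2.trans ?_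
    calc 2 * n * (2 * ∑ i, ∑ j, L i j ^ 4) ≤ 2 * n * (2 * (M / n ^ 2)) := by gcongr
      _ = _ := by field_simp; ring
  have h3' : ∑ v, (rowNorm (bip L) v ^ 2) ^ 3 ≤ 8 * M / n ^ 2 := by
    refine h3.trans ?_
    calc (2 * n) ^ 2 * (2 * ∑ i, ∑ j, L i j ^ 6) ≤ (2 * n) ^ 2 * (2 * (M / n ^ 4)) := by gcongr
      _ = _ := by field_simp; ring
  refine ⟨?_, ?_, ?_⟩
  · calc _ ≤ ∑ v, (a * rowNorm (bip L) v ^ 2) ^ 2 :=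
          Finset.sum_le_sum fun v _ => pow_le_pow_left₀ (h0 v v) (hGv v) 2
      _ = a ^ 2 * ∑ v, (rowNorm (bip L) v ^ 2) ^ 2 := by simp only [mul_pow, Finset.mul_sum]
      _ ≤ a ^ 2 * (4 * M / n) := by gcongr
      _ = _ := by ring
  · calc _ ≤ ∑ v, (a * rowNorm (bip L) v ^ 2) ^ 3 :=
          Finset.sum_le_sum fun v _ => pow_le_pow_left₀ (h0 v v) (hGv v) 3
      _ = a ^ 3 * ∑ v, (rowNorm (bip L) v ^ 2) ^ 3 := by simp only [mul_pow, Finset.mul_sum]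
      _ ≤ a ^ 3 * (8 * M / n ^ 2) := by gcongr
      _ = _ := by ring
  · have hcube : ∀ x y : ℝ, 0 ≤ x → 0 ≤ y → (x + y) ^ 3 ≤ 4 * (x ^ 3 + y ^ 3) := by
      intro x y hx hy
      nlinarith [mul_nonneg (add_nonneg hx hy) (sq_nonneg (x - y))]
    have hcs : (∑ v, rowNorm (bip L) v ^ 3) ^ 2 ≤ 16 * M / n := by
      calc _ ≤ ((Finset.univ : Finset (ι ⊕ ι)).card : ℝ) * ∑ v, (rowNorm (bip L) v ^ 3) ^ 2 :=
            sq_sum_le_card_mul_sum_sq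
        _ = 2 * n * ∑ v, (rowNorm (bip L) v ^ 2) ^ 3 := by
            rw [Finset.card_univ, Fintype.card_sum, hn]
            push_cast
            rw [two_mul]
            congr 1
            exact Finset.sum_congr rfl fun v _ => by ring
        _ ≤ 2 * n * (8 * M / n ^ 2) := by gcongr
        _ = _ := by field_simp; ring
    calc _ ≤ ∑ v, ∑ w, 4 * (|bip L v w| ^ 3 +
            (a * (rowNorm (bip L) v * rowNorm (bip L) w)) ^ 3) := by
          refine Finset.sum_le_sum fun v _ => Finset.sum_le_sum fun w _ => ?_
          refine (pow_le_pow_left₀ (h0 v w) (hG v w) 3).trans (hcube _ _ (abs_nonneg _) ?_)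
          have := hr v
          have := hr w
          positivity
      _ = 4 * (∑ v, ∑ w, |bip L v w| ^ 3) + 4 * a ^ 3 * (∑ v, rowNorm (bip L) v ^ 3) ^ 2 := by
          rw [sq, Finset.sum_mul_sum]
          simp only [mul_add, Finset.sum_add_distrib, Finset.mul_sum]
          congr 1
          refine Finset.sum_congr rfl fun v _ => Finset.sum_congr rfl fun w _ => ?_
          ring
      _ ≤ 4 * (2 * (M / n)) + 4 * a ^ 3 * (16 * M / n) := by
          rw [sum_sum_bip L (g := fun x => |x| ^ 3) (by simp)]
          gcongr
      _ = _ := by ring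

end Bipartite

/-! ### Coefficients of low order -/

section LowOrder

lemma summable_levelWeight : Summable fun s : ℕ => ((s : ℝ) + 4) ^ 2 * (1 / 2) ^ s := by
  have h := summable_pow_mul_geometric_of_norm_lt_one (R := ℝ) 2 (r := 1 / 2) (by norm_num)
  have h2 := ((summable_nat_add_iff 4).mpr h).mul_left 16
  refine h2.congr fun s => ?_
  push_cast
  rw [pow_add]
  ring

/-- A constant bounding the contribution of the levels `r ≥ 4`. -/
def levelConst : ℝ := ∑' s : ℕ, ((s : ℝ) + 4) ^ 2 * (1 / 2) ^ s

lemma levelSum_nonneg {V : Type*} [Fintype V] [DecidableEq V] (B : Matrix V V ℝ) (N r : ℕ) :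
    0 ≤ levelSum B N r :=
  Finset.sum_nonneg fun _ _ =>
    mul_nonneg (Finset.prod_nonneg fun _ _ => abs_nonneg _) (absMom_nonneg _ _ _ _)

variable {n : ℕ} {L : Matrix (Fin n) (Fin n) ℝ}

lemma absMom_bip_zero_eq (L : Matrix (Fin n) (Fin n) ℝ) (N : ℕ) :
    absMom (bip L) N 0 0 = ∑ j ∈ Finset.range (N + 1), |detCoeff (bip L) j| := rfl

/-- The entries of the covariance are at most of order `h ^ 2 / n`. -/
lemma absCov_bip_le {h c ρ : ℝ} (hn : h ^ 30 = n) (h1 : 1 ≤ h)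
    (hc : 0 ≤ c) (hρ : 0 ≤ ρ) (hρ1 : ρ < 1) (hL : NormLE L ρ) (hL' : NormLE Lᵀ ρ)
    (hmax : ∀ i j, |L i j| ≤ c * h / n) (N : ℕ) (v w : Fin n ⊕ Fin n) :
    absCov (bip L) N v w ≤ (c + (1 - ρ)⁻¹ * c ^ 2) * h ^ 2 / n := by
  have hn0 : (0 : ℝ) < n := hn ▸ by positivity
  have ha : 0 ≤ (1 - ρ)⁻¹ := inv_nonneg.mpr (by linarith)
  have hq : ∀ v, rowNorm (bip L) v ^ 2 ≤ (c * h) ^ 2 / n := by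
    intro v
    refine (rowNorm_bip_sq_le hmax v).trans_eq ?_
    rw [Fintype.card_fin]
    field_simp
  have hvw : rowNorm (bip L) v * rowNorm (bip L) w ≤ (c * h) ^ 2 / n := by
    have h2 := hq v
    have h3 := hq w
    nlinarith [sq_nonneg (rowNorm (bip L) v - rowNorm (bip L) w)]
  calc _ ≤ |bip L v w| + (1 - ρ)⁻¹ * (rowNorm (bip L) v * rowNorm (bip L) w) :=
        absCov_le (bip_isSymm L) hρ hρ1 (normLE_bip hL hL') N v w
    _ ≤ c * h / n + (1 - ρ)⁻¹ * ((c * h) ^ 2 / n) := by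
        gcongr
        exact abs_bip_le (by positivity) hmax v w
    _ = (c * h + (1 - ρ)⁻¹ * c ^ 2 * h ^ 2) / n := by ring
    _ ≤ (c * h ^ 2 + (1 - ρ)⁻¹ * c ^ 2 * h ^ 2) / n := by
        gcongr
        nlinarith
    _ = _ := by ring

/-- The contribution of a single level `r ≥ 4`, where `r ≤ h ^ 18 = n ^ (3/5)`. -/
lemma levelSum_bip_le {h c ρ : ℝ} (hn : h ^ 30 = n) (h2 : 2 ≤ h)
    (hc : 0 ≤ c) (hρ : 0 ≤ ρ) (hρ1 : ρ < 1) (hL : NormLE L ρ) (hL' : NormLE Lᵀ ρ)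
    (hmax : ∀ i j, |L i j| ≤ c * h / n) {Q : ℝ}
    (hQ : Q = 2 * (c + (1 - ρ)⁻¹ * c ^ 2) * Real.exp 8) (hQ1 : 2 * Q ≤ h ^ 2) (hQ2 : Q ^ 4 ≤ h ^ 2)
    (N s : ℕ) (hs : ((s + 4 : ℕ) : ℝ) ≤ h ^ 18) :
    levelSum (bip L) N (s + 4) ≤
      absMom (bip L) N 0 0 / n * (((s : ℝ) + 4) ^ 2 * (1 / 2) ^ s) := by
  have hn0 : (0 : ℝ) < n := hn ▸ by positivity
  have ha : 0 ≤ (1 - ρ)⁻¹ := inv_nonneg.mpr (by linarith)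
  have hQ0 : 0 ≤ Q := by rw [hQ]; positivity
  have hD := absMom_nonneg (bip L) N 0 0
  -- the parameter of `levelSum_le` is `x = y / h ^ 10`, a cube root of `(s + 4) / n`
  obtain ⟨y, hy1, hy3⟩ : ∃ y : ℝ, 1 ≤ y ∧ y ^ 3 = ((s + 4 : ℕ) : ℝ) := by
    refine ⟨((s + 4 : ℕ) : ℝ) ^ (1 / 3 : ℝ), Real.one_le_rpow ?_ (by norm_num), ?_⟩
    · push_cast; linarith [(Nat.cast_nonneg s : (0 : ℝ) ≤ s)]
    · rw [← Real.rpow_natCast, ← Real.rpow_mul (by positivity)]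
      norm_num
  have hy0 : 0 < y := by linarith
  have hyh : y ≤ h ^ 6 := by
    refine le_of_pow_le_pow_left₀ (n := 3) (by norm_num) (by positivity) ?_
    rw [hy3, ← pow_mul]
    exact hs
  have hx2 : y / h ^ 10 ≤ 1 / 2 := by
    rw [div_le_div_iff₀ (by positivity) (by norm_num)]
    have : (2 : ℝ) ≤ h ^ 4 := le_trans (by norm_num) (pow_le_pow_left₀ (by norm_num) h2 4)
    calc y * 2 ≤ h ^ 6 * h ^ 4 := by gcongr
      _ = _ := by ring
  have hcard : (Fintype.card (Fin n ⊕ Fin n) : ℝ) = 2 * h ^ 30 := by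
    rw [hn]; simp; ring
  have key := levelSum_le (bip_isSymm L) (N := N) (r := s + 4) (x := y / h ^ 10) (by positivity)
    (absCov_bip_le hn (by linarith) hc hρ hρ1 hL hL' hmax N) (by positivity) hx2 (by
      rw [hcard, div_pow, hy3]
      field_simp)
  refine key.trans ?_
  have hbase : (Fintype.card (Fin n ⊕ Fin n) : ℝ) * ((c + (1 - ρ)⁻¹ * c ^ 2) * h ^ 2 / n) *
      (y / h ^ 10) * Real.exp 8 = Q * y / h ^ 8 := by
    rw [hcard, hQ, ← hn]
    field_simp
  rw [hbase]
  have hhalf : Q * y / h ^ 8 ≤ 1 / 2 := by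
    rw [div_le_div_iff₀ (by positivity) (by norm_num)]
    calc Q * y * 2 = (2 * Q) * y := by ring
      _ ≤ h ^ 2 * h ^ 6 := by gcongr
      _ = _ := by ring
  -- four of the `s + 4` factors supply the factor `1 / n`, the others a geometric series
  have hfour : (Q * y / h ^ 8) ^ 4 ≤ ((s : ℝ) + 4) ^ 2 / n := by
    have e : ((s : ℝ) + 4) ^ 2 = y ^ 6 := by
      have : (s : ℝ) + 4 = y ^ 3 := by rw [hy3]; push_cast; ring
      rw [this]; ring
    rw [e, ← hn, div_pow, div_le_div_iff₀ (by positivity) (by positivity)]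
    calc (Q * y) ^ 4 * h ^ 30 = Q ^ 4 * y ^ 4 * h ^ 30 := by ring
      _ ≤ h ^ 2 * y ^ 6 * h ^ 30 := by
          gcongr
          norm_num
      _ = _ := by ring
  calc _ = absMom (bip L) N 0 0 * ((Q * y / h ^ 8) ^ s * (Q * y / h ^ 8) ^ 4) := by rw [pow_add]
    _ ≤ absMom (bip L) N 0 0 * ((1 / 2) ^ s * (((s : ℝ) + 4) ^ 2 / n)) := by gcongr
    _ = _ := by ring

/-- For coefficients of order `k ≤ n ^ (3/5)`, the sum of the permanents of the `k × k`
submatrices is given by the determinant up to a total error of order `1 / n`. -/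
lemma sum_abs_subPermSum_sub_detCoeff_le {h c ρ M S : ℝ} (hn : h ^ 30 = n) (h2 : 2 ≤ h)
    (hc : 0 ≤ c) (hρ : 0 ≤ ρ) (hρ1 : ρ < 1) (hL : NormLE L ρ) (hL' : NormLE Lᵀ ρ)
    (hrow : ∀ i, ∑ j, L i j = 0) (hcol : ∀ j, ∑ i, L i j = 0)
    (hmax : ∀ i j, |L i j| ≤ c * h / n) {Q : ℝ}
    (hQ : Q = 2 * (c + (1 - ρ)⁻¹ * c ^ 2) * Real.exp 8) (hQ1 : 2 * Q ≤ h ^ 2) (hQ2 : Q ^ 4 ≤ h ^ 2)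
    (hM3 : ∑ i, ∑ j, |L i j| ^ 3 ≤ M / n)
    (hM4 : ∑ i, ∑ j, L i j ^ 4 ≤ M / n ^ 2) (hM6 : ∑ i, ∑ j, L i j ^ 6 ≤ M / n ^ 4) {N : ℕ}
    (hN : (N : ℝ) ≤ h ^ 18) (hS : ∑ j ∈ Finset.range (N + 1), |detCoeff (bip L) j| ≤ S) {a : ℝ}
    (ha : a = (1 - ρ)⁻¹) :
    ∑ k ∈ Finset.range (N + 1), |subPermSum L k - detCoeff (bip L) k| ≤
      S * (24 * a ^ 2 * M + (36 * ((8 + 64 * a ^ 3) * M) + 78 * (8 * a ^ 3 * M)) + levelConst) / n := by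
  have hn0 : (0 : ℝ) < n := hn ▸ by positivity
  have hn1 : (1 : ℝ) ≤ n := by rw [← hn]; exact one_le_pow₀ (by linarith)
  have ha0 : 0 ≤ a := by rw [ha]; exact inv_nonneg.mpr (by linarith)
  have hM0 : 0 ≤ M := by
    have : 0 ≤ M / n := le_trans (Finset.sum_nonneg fun _ _ => Finset.sum_nonneg fun _ _ =>
      by positivity) hM3
    simpa using (div_nonneg_iff.mp this).elim (fun h => h.1) (fun h => absurd h.2 (by linarith))
  have hD := absMom_nonneg (bip L) N 0 0
  have hDS : absMom (bip L) N 0 0 ≤ S := by rw [absMom_bip_zero_eq]; exact hS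
  have hS0 := hD.trans hDS
  obtain ⟨g2, g3, gg⟩ := absCov_bip_sums hρ hρ1 hL hL' N (n := (n : ℝ)) (by simp) hn0 ha hM3 hM4 hM6
  have hl2 : levelSum (bip L) N 2 ≤ S * (24 * a ^ 2 * M) / n := by
    calc _ ≤ 6 * absMom (bip L) N 0 0 * ∑ v, absCov (bip L) N v v ^ 2 :=
          levelSum_two_le (bip_isSymm L) N
      _ ≤ 6 * S * (4 * a ^ 2 * M / n) := by gcongr
      _ = _ := by ring
  have hl3 : levelSum (bip L) N 3 ≤
      S * (36 * ((8 + 64 * a ^ 3) * M) + 78 * (8 * a ^ 3 * M)) / n := by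
    have hcard : (Fintype.card (Fin n ⊕ Fin n) : ℝ) = 2 * n := by simp; ring
    refine (levelSum_three_le (bip_isSymm L) N).trans ?_
    rw [hcard]
    calc _ ≤ S * (36 * ((8 + 64 * a ^ 3) * M / n) + (30 * n + 24 * (2 * n)) *
            (8 * a ^ 3 * M / n ^ 2)) := by
          have h30 : (30 : ℝ) + 24 * (2 * n) ≤ 30 * n + 24 * (2 * n) := by linarith
          have hc3 : 0 ≤ ∑ v, absCov (bip L) N v v ^ 3 :=
            Finset.sum_nonneg fun v _ => pow_nonneg (absCov_nonneg _ _ _ _) 3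
          have hg3 := (Finset.sum_nonneg fun v _ => Finset.sum_nonneg fun w _ =>
            pow_nonneg (absCov_nonneg (bip L) N v w) 3).trans gg
          refine mul_le_mul hDS (add_le_add (mul_le_mul_of_nonneg_left gg (by norm_num))
            (mul_le_mul h30 g3 hc3 (by positivity))) ?_ hS0
          exact add_nonneg (mul_nonneg (by norm_num) (Finset.sum_nonneg fun v _ =>
              Finset.sum_nonneg fun w _ => pow_nonneg (absCov_nonneg _ _ _ _) 3))
              (mul_nonneg (by positivity) hc3)
      _ = _ := by field_simp; ring
  have hl4 : ∑ r ∈ Finset.Ico 4 (N + 1), levelSum (bip L) N r ≤ S * levelConst / n := by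
    rw [Finset.sum_Ico_eq_sum_range]
    calc _ ≤ ∑ s ∈ Finset.range (N + 1 - 4), S / n * (((s : ℝ) + 4) ^ 2 * (1 / 2) ^ s) := by
          refine Finset.sum_le_sum fun s hs => ?_
          rw [add_comm 4 s]
          have hsN : s + 4 ≤ N := by rw [Finset.mem_range] at hs; omega
          refine (levelSum_bip_le hn h2 hc hρ hρ1 hL hL' hmax hQ hQ1 hQ2 N s
            ((Nat.cast_le.mpr hsN).trans hN)).trans ?_
          gcongr
      _ ≤ S / n * levelConst := by
          rw [← Finset.mul_sum]
          gcongr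
          exact summable_levelWeight.sum_le_tsum _ fun s _ => by positivity
      _ = _ := by ring
  calc _ ≤ ∑ r ∈ Finset.Ico 1 (N + 1), levelSum (bip L) N r :=
        sum_abs_wick_sub_le (bip_isSymm L) (sum_bip hrow hcol) N
    _ ≤ ∑ r ∈ ({1, 2, 3} : Finset ℕ) ∪ Finset.Ico 4 (N + 1), levelSum (bip L) N r := by
        refine Finset.sum_le_sum_of_subset_of_nonneg (fun r hr => ?_) fun r _ _ => levelSum_nonneg _ _ _
        simp at hr ⊢
        omega
    _ ≤ ∑ r ∈ ({1, 2, 3} : Finset ℕ), levelSum (bip L) N r +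
          ∑ r ∈ Finset.Ico 4 (N + 1), levelSum (bip L) N r :=
        sum_union_le_of_nonneg fun r => levelSum_nonneg _ _ _
    _ = levelSum (bip L) N 2 + levelSum (bip L) N 3 +
          ∑ r ∈ Finset.Ico 4 (N + 1), levelSum (bip L) N r := by
        simp [levelSum_one, add_assoc]
    _ ≤ S * (24 * a ^ 2 * M) / n + S * (36 * ((8 + 64 * a ^ 3) * M) + 78 * (8 * a ^ 3 * M)) / n +
          S * levelConst / n := by gcongr
    _ = _ := by ring

end LowOrder

/-! ### Permanents of products of matrices -/

section PermanentOfProduct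

variable {ι I : Type*} [Fintype ι] [DecidableEq ι] [Fintype I] [DecidableEq I]

/-- The number of times that each value is taken by a map. -/
def fiberCard (f : ι → I) (a : I) : ℕ := (Finset.univ.filter fun i => f i = a).card

/-- The coefficient of the monomial `X ^ m` in the product over `i` of the linear forms
`∑ a, G i a * X a`. -/
def columnCoeff (G : Matrix ι I ℝ) (m : I → ℕ) : ℝ :=
  ∑ f : ι → I with fiberCard f = m, ∏ i, G i (f i)

omit [DecidableEq ι] in
lemma sum_fiberCard (f : ι → I) : ∑ a, fiberCard f a = Fintype.card ι := by
  simp only [fiberCard]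
  rw [← Finset.card_eq_sum_card_fiberwise (fun i _ => Finset.mem_coe.mpr (Finset.mem_univ (f i)))]
  rfl

omit [DecidableEq ι] [Fintype I] in
lemma fiberCard_le (f : ι → I) (a : I) : fiberCard f a ≤ Fintype.card ι :=
  Finset.card_le_univ _

omit [DecidableEq ι] in
lemma prod_comp_eq_prod_pow {R : Type*} [CommMonoid R] (f : ι → I) (r : I → R) :
    ∏ i, r (f i) = ∏ a, r a ^ fiberCard f a := by
  rw [← Finset.prod_fiberwise' Finset.univ f r]
  simp [fiberCard]

omit [Fintype I] [DecidableEq ι] in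
lemma fiberCard_comp_perm (f : ι → I) (τ : Equiv.Perm ι) : fiberCard (f ∘ τ) = fiberCard f := by
  funext a
  exact Finset.card_bij (fun i _ => τ i) (by simp) (by simp)
    fun b hb => ⟨τ.symm b, by simpa using hb, by simp⟩

omit [Fintype I] [DecidableEq ι] in
lemma exists_perm_comp_eq {f g : ι → I} (h : fiberCard g = fiberCard f) :
    ∃ τ : Equiv.Perm ι, f ∘ τ = g := by
  have hc : ∀ a, Fintype.card {i // g i = a} = Fintype.card {i // f i = a} := fun a => by
    simpa [Fintype.card_subtype, fiberCard] using congrFun h a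
  refine ⟨(Equiv.sigmaFiberEquiv g).symm.trans ((Equiv.sigmaCongrRight fun a =>
    Fintype.equivOfCardEq (hc a)).trans (Equiv.sigmaFiberEquiv f)), ?_⟩
  funext i
  exact (Fintype.equivOfCardEq (hc (g i)) ⟨i, rfl⟩).2

lemma card_perm_comp_eq {f g : ι → I} (h : fiberCard g = fiberCard f) :
    (Finset.univ.filter fun τ : Equiv.Perm ι => f ∘ τ = g).card = ∏ a, (fiberCard f a)! := by
  obtain ⟨τ₀, rfl⟩ := exists_perm_comp_eq h
  have h1 := DomMulAct.stabilizer_card f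
  simp only [Fintype.card_subtype] at h1
  simp only [fiberCard]
  rw [← h1]
  refine Finset.card_bij (fun τ _ => τ * τ₀⁻¹) (fun τ hτ => ?_) (fun _ _ _ _ h => by simpa using h)
    fun b hb => ⟨b * τ₀, ?_, by simp⟩
  · simp only [Finset.mem_filter, Finset.mem_univ, true_and] at hτ ⊢
    funext i
    simpa using congrFun hτ (τ₀⁻¹ i)
  · simp only [Finset.mem_filter, Finset.mem_univ, true_and] at hb ⊢
    funext i
    simpa using congrFun hb (τ₀ i)

/-- A sum over permutations of `f` is a sum over the maps of the same type, each of which is hit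
equally often. -/
lemma sum_perm_comp (f : ι → I) (F : (ι → I) → ℝ) :
    ∑ τ : Equiv.Perm ι, F (f ∘ τ) =
      (∏ a, ((fiberCard f a)! : ℝ)) * ∑ g : ι → I with fiberCard g = fiberCard f, F g := by
  rw [Finset.mul_sum, ← Finset.sum_fiberwise_of_maps_to (t := Finset.univ.filter
    fun g : ι → I => fiberCard g = fiberCard f) (g := fun τ : Equiv.Perm ι => f ∘ τ)
    (fun τ _ => by simpa using fiberCard_comp_perm f τ)]
  refine Finset.sum_congr rfl fun g hg => ?_
  rw [Finset.mem_filter] at hg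
  have := card_perm_comp_eq hg.2
  rw [Finset.sum_congr rfl (g := fun _ => F g) fun τ hτ => by
    rw [(Finset.mem_filter.mp hτ).2], Finset.sum_const, this, nsmul_eq_mul]
  push_cast
  rfl

omit [DecidableEq ι] in
/-- The arithmetic-geometric mean inequality, normalized. -/
lemma prod_le_one_of_sum_le_card {y : ι → ℝ} (h0 : ∀ i, 0 ≤ y i)
    (h : ∑ i, y i ≤ Fintype.card ι) : ∏ i, y i ≤ 1 := by
  calc ∏ i, y i ≤ ∏ i, Real.exp (y i - 1) := Finset.prod_le_prod (fun i _ => h0 i) fun i _ => by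
        linarith [Real.add_one_le_exp (y i - 1)]
    _ = Real.exp (∑ i, (y i - 1)) := (Real.exp_sum _ _).symm
    _ ≤ 1 := by
        rw [Real.exp_le_one_iff]
        simp
        linarith

lemma sum_range_pow_of_pow_eq_one {N : ℕ} {x : ℂ} (hx : x ^ N = 1) (hx1 : x ≠ 1) :
    ∑ t ∈ Finset.range N, x ^ t = 0 := by
  rw [geom_sum_eq hx1, hx, sub_self, zero_div]

omit [DecidableEq ι] [DecidableEq I] in
/-- Parseval for a matrix with orthogonal columns of length at most `1`. -/
lemma sum_sq_mulVec_le {G : Matrix ι I ℝ} (hG : ∀ a b, a ≠ b → ∑ i, G i a * G i b = 0)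
    (hG1 : ∀ a, ∑ i, G i a ^ 2 ≤ 1) (p : I → ℝ) :
    ∑ i, (∑ a, G i a * p a) ^ 2 ≤ ∑ a, p a ^ 2 := by
  calc _ = ∑ a, ∑ b, p a * p b * ∑ i, G i a * G i b := by
        simp_rw [sq, Finset.sum_mul_sum, Finset.mul_sum]
        rw [Finset.sum_comm]
        refine Finset.sum_congr rfl fun a _ => ?_
        rw [Finset.sum_comm]
        exact Finset.sum_congr rfl fun b _ => Finset.sum_congr rfl fun i _ => by ring
    _ = ∑ a, p a * p a * ∑ i, G i a * G i a := by
        refine Finset.sum_congr rfl fun a _ => ?_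
        refine Finset.sum_eq_single a (fun b _ hb => ?_) (by simp)
        rw [hG a b hb.symm, mul_zero]
    _ ≤ _ := Finset.sum_le_sum fun a _ => by
        have := hG1 a
        simp_rw [sq] at this ⊢
        nlinarith [mul_self_nonneg (p a)]

/-- Cauchy's estimate for the coefficients of the product of the linear forms given by the rows of
a matrix with orthogonal columns of length at most `1`: by the arithmetic-geometric mean
inequality, the product is at most `1` in absolute value on the torus where the squared radii are
the exponents `m a`. -/
lemma columnCoeff_sq_mul_prod_le {G : Matrix ι I ℝ}
    (hG : ∀ a b, a ≠ b → ∑ i, G i a * G i b = 0) (hG1 : ∀ a, ∑ i, G i a ^ 2 ≤ 1) {m : I → ℕ}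
    (hm : ∑ a, m a = Fintype.card ι) :
    columnCoeff G m ^ 2 * ∏ a, (m a : ℝ) ^ m a ≤ 1 := by
  set N := Fintype.card ι + 1 with hN
  have hN0 : N ≠ 0 := by omega
  obtain ⟨ζ, hζ⟩ : ∃ ζ : ℂ, IsPrimitiveRoot ζ N := ⟨_, Complex.isPrimitiveRoot_exp N hN0⟩
  have hζ1 : ‖ζ‖ = 1 := hζ.norm'_eq_one hN0
  set r : I → ℝ := fun a => Real.sqrt (m a) with hr
  have hmle : ∀ a, m a ≤ Fintype.card ι := fun a =>
    hm ▸ Finset.single_le_sum (fun a _ => Nat.zero_le (m a)) (Finset.mem_univ a)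
  -- the values on the torus
  set y : (I → ℕ) → ι → ℂ := fun θ i => ∑ a, (G i a : ℂ) * (r a * ζ ^ θ a) with hy
  set Θ := Fintype.piFinset fun _ : I => Finset.range N with hΘ
  have hcard : (Θ.card : ℝ) = (N : ℝ) ^ Fintype.card I := by
    simp [hΘ, Fintype.card_piFinset]
  have hbound : ∀ θ, ‖∏ i, y θ i‖ ≤ 1 := by
    intro θ
    rw [norm_prod]
    have h1 : ∏ i, ‖y θ i‖ ^ 2 ≤ 1 := by
      refine prod_le_one_of_sum_le_card (fun i => by positivity) ?_
      have e : ∀ i, ‖y θ i‖ ^ 2 = (∑ a, G i a * (r a * (ζ ^ θ a).re)) ^ 2 +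
          (∑ a, G i a * (r a * (ζ ^ θ a).im)) ^ 2 := by
        intro i
        rw [← Complex.normSq_eq_norm_sq, Complex.normSq_apply, hy]
        simp only [Complex.re_sum, Complex.im_sum, Complex.re_ofReal_mul, Complex.im_ofReal_mul]
        ring
      calc ∑ i, ‖y θ i‖ ^ 2 ≤ ∑ a, (r a * (ζ ^ θ a).re) ^ 2 + ∑ a, (r a * (ζ ^ θ a).im) ^ 2 := by
            simp_rw [e]
            rw [Finset.sum_add_distrib]
            exact add_le_add (sum_sq_mulVec_le hG hG1 _) (sum_sq_mulVec_le hG hG1 _)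
        _ = ∑ a, (m a : ℝ) := by
            rw [← Finset.sum_add_distrib]
            refine Finset.sum_congr rfl fun a _ => ?_
            have h2 : (ζ ^ θ a).re ^ 2 + (ζ ^ θ a).im ^ 2 = 1 := by
              have := Complex.normSq_eq_norm_sq (ζ ^ θ a)
              rw [Complex.normSq_apply, norm_pow, hζ1] at this
              simpa [sq] using this
            rw [mul_pow, mul_pow, ← mul_add, h2, mul_one, hr, Real.sq_sqrt (Nat.cast_nonneg _)]
        _ = Fintype.card ι := by rw [← hm]; push_cast; rfl
        _ ≤ _ := le_rfl
    rw [Finset.prod_pow] at h1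
    exact (sq_le_one_iff₀ (Finset.prod_nonneg fun _ _ => norm_nonneg _)).mp h1
  -- averaging over the torus extracts the coefficient
  have key : ∑ θ ∈ Θ, (∏ a, ζ ^ (θ a * (N - m a))) * ∏ i, y θ i =
      (N : ℂ) ^ Fintype.card I * ((∏ a, r a ^ m a) * columnCoeff G m : ℝ) := by
    have e1 : ∀ θ : I → ℕ, (∏ a, ζ ^ (θ a * (N - m a))) * ∏ i, y θ i =
        ∑ f : ι → I, ((∏ i, G i (f i) : ℝ) : ℂ) * ((∏ a, r a ^ fiberCard f a : ℝ) : ℂ) *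
          ∏ a, (ζ ^ (N - m a + fiberCard f a)) ^ θ a := by
      intro θ
      rw [hy, Fintype.prod_sum, Finset.mul_sum]
      refine Finset.sum_congr rfl fun f _ => ?_
      rw [Finset.prod_mul_distrib, prod_comp_eq_prod_pow f fun a => (r a : ℂ) * ζ ^ θ a]
      push_cast
      rw [mul_left_comm, mul_assoc, ← Finset.prod_mul_distrib, ← Finset.prod_mul_distrib]
      congr 1
      refine Finset.prod_congr rfl fun a _ => ?_
      ring
    simp_rw [e1]
    rw [Finset.sum_comm]
    have e2 : ∀ f : ι → I, ∑ θ ∈ Θ, ((∏ i, G i (f i) : ℝ) : ℂ) *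
        ((∏ a, r a ^ fiberCard f a : ℝ) : ℂ) * ∏ a, (ζ ^ (N - m a + fiberCard f a)) ^ θ a =
        if fiberCard f = m then (N : ℂ) ^ Fintype.card I *
          (((∏ a, r a ^ m a) * ∏ i, G i (f i) : ℝ) : ℂ) else 0 := by
      intro f
      rw [← Finset.mul_sum, ← Finset.prod_univ_sum (fun _ : I => Finset.range N)
        (fun a t => (ζ ^ (N - m a + fiberCard f a)) ^ t)]
      split_ifs with h
      · have : ∀ a, ζ ^ (N - m a + fiberCard f a) = 1 := fun a => by
          rw [h, Nat.sub_add_cancel ((hmle a).trans (by omega)), hζ.pow_eq_one]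
        simp only [this, one_pow, Finset.sum_const, Finset.card_range, Finset.prod_const]
        rw [h, Finset.card_univ]
        push_cast
        rw [nsmul_eq_mul, mul_one]
        ring
      · obtain ⟨a, ha⟩ := Function.ne_iff.mp h
        refine mul_eq_zero_of_right _ (Finset.prod_eq_zero (Finset.mem_univ a) ?_)
        refine sum_range_pow_of_pow_eq_one ?_ fun h1 => ha ?_
        · rw [← pow_mul, mul_comm, pow_mul, hζ.pow_eq_one, one_pow]
        · have h2 := (hζ.pow_eq_one_iff_dvd _).mp h1
          have h3 := hmle a
          have h4 := fiberCard_le f a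
          obtain ⟨c, hc⟩ := h2
          have hc1 : c = 1 := by
            rcases c with _ | _ | c
            · omega
            · rfl
            · exfalso
              have : N * (c + 1 + 1) = N * c + 2 * N := by ring
              have h5 : 0 ≤ N * c := Nat.zero_le _
              omega
          subst hc1
          omega
    simp_rw [e2]
    rw [← Finset.sum_filter, columnCoeff, Finset.mul_sum]
    push_cast
    rw [Finset.mul_sum]
  have h1 : ‖∑ θ ∈ Θ, (∏ a, ζ ^ (θ a * (N - m a))) * ∏ i, y θ i‖ ≤ (N : ℝ) ^ Fintype.card I := by
    calc _ ≤ ∑ θ ∈ Θ, (1 : ℝ) := by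
          refine norm_sum_le_of_le _ fun θ _ => ?_
          rw [norm_mul, norm_prod]
          simp only [norm_pow, hζ1, one_pow, Finset.prod_const_one, one_mul]
          exact hbound θ
      _ = _ := by rw [Finset.sum_const, nsmul_eq_mul, mul_one, hcard]
  rw [key, norm_mul, Complex.norm_real, norm_pow, Complex.norm_natCast] at h1
  have hN' : (0 : ℝ) < (N : ℝ) ^ Fintype.card I := by positivity
  have h2 : |(∏ a, r a ^ m a) * columnCoeff G m| ≤ 1 := by
    rw [Real.norm_eq_abs] at h1
    nlinarith
  have h3 := (sq_le_one_iff_abs_le_one _).mpr h2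
  calc columnCoeff G m ^ 2 * ∏ a, (m a : ℝ) ^ m a
      = ((∏ a, r a ^ m a) * columnCoeff G m) ^ 2 := by
        rw [mul_pow, mul_comm, ← Finset.prod_pow]
        congr 1
        refine Finset.prod_congr rfl fun a _ => ?_
        rw [← pow_mul, mul_comm, pow_mul, hr, Real.sq_sqrt (Nat.cast_nonneg _)]
    _ ≤ 1 := h3

/-- An upper bound for `m! * e ^ m / m ^ m`. -/
def stirlingWeight (m : ℕ) : ℝ := if m = 0 then 1 else Real.exp 1 * m

lemma stirlingWeight_nonneg (m : ℕ) : 0 ≤ stirlingWeight m := by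
  unfold stirlingWeight
  split_ifs <;> positivity

lemma factorial_mul_exp_le (m : ℕ) :
    (m ! : ℝ) * Real.exp m ≤ stirlingWeight m * (m : ℝ) ^ m := by
  rcases m with _ | m
  · simp [stirlingWeight]
  · simp only [stirlingWeight, Nat.succ_ne_zero, if_false]
    induction m with
    | zero => simp
    | succ m ih =>
      have hm : (0 : ℝ) < (m + 1 : ℕ) := by positivity
      have hm2 : (0 : ℝ) < (m + 1 + 1 : ℕ) := by positivity
      have key : Real.exp 1 * ((m + 1 : ℕ) : ℝ) ^ (m + 2) ≤ ((m + 1 + 1 : ℕ) : ℝ) ^ (m + 2) := by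
        have h1 := Real.one_sub_inv_le_log_of_pos (x := ((m + 1 + 1 : ℕ) : ℝ) / (m + 1 : ℕ))
          (by positivity)
        have h2 : 1 - (((m + 1 + 1 : ℕ) : ℝ) / (m + 1 : ℕ))⁻¹ = 1 / (m + 2 : ℕ) := by
          push_cast
          field_simp
          ring
        rw [h2, div_le_iff₀ (by positivity), mul_comm] at h1
        have h3 : Real.exp 1 ≤ (((m + 1 + 1 : ℕ) : ℝ) / (m + 1 : ℕ)) ^ (m + 2) := by
          rw [← Real.exp_log (show 0 < ((m + 1 + 1 : ℕ) : ℝ) / (m + 1 : ℕ) by positivity),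
            ← Real.exp_nat_mul, Real.exp_le_exp]
          exact h1
        rw [div_pow, le_div_iff₀ (by positivity)] at h3
        exact h3
      calc ((m + 1 + 1)! : ℝ) * Real.exp ((m + 1 + 1 : ℕ) : ℝ)
          = (m + 1 + 1 : ℕ) * Real.exp 1 * (((m + 1)! : ℝ) * Real.exp ((m + 1 : ℕ) : ℝ)) := by
            rw [Nat.factorial_succ (m + 1), Nat.cast_succ (m + 1), Real.exp_add]
            push_cast
            ring
        _ ≤ (m + 1 + 1 : ℕ) * Real.exp 1 *
              (Real.exp 1 * (m + 1 : ℕ) * ((m + 1 : ℕ) : ℝ) ^ (m + 1)) := by gcongr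
        _ = (m + 1 + 1 : ℕ) * Real.exp 1 * (Real.exp 1 * ((m + 1 : ℕ) : ℝ) ^ (m + 2)) := by ring
        _ ≤ (m + 1 + 1 : ℕ) * Real.exp 1 * ((m + 1 + 1 : ℕ) : ℝ) ^ (m + 2) := by gcongr
        _ = _ := by ring

end PermanentOfProduct

/-! ### A uniform bound for the sums of subpermanents -/

section CrudeBound

variable {ι I : Type*} [Fintype ι] [DecidableEq ι] [Fintype I] [DecidableEq I]

/-- The columns are pairwise orthogonal and of length at most `1`. -/
def SubOrthonormal (G : Matrix ι I ℝ) : Prop :=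
  (∀ a b, a ≠ b → ∑ i, G i a * G i b = 0) ∧ ∀ a, ∑ i, G i a ^ 2 ≤ 1

/-- The permanent of a matrix with repeated columns as a coefficient. -/
lemma sum_perm_prod_eq (H : Matrix ι I ℝ) (f : ι → I) :
    ∑ τ : Equiv.Perm ι, ∏ i, H (τ i) (f i) =
      (∏ a, ((fiberCard f a)! : ℝ)) * columnCoeff H (fiberCard f) := by
  rw [columnCoeff, ← sum_perm_comp f fun g => ∏ i, H i (g i)]
  rw [← Equiv.sum_comp (Equiv.inv (Equiv.Perm ι))]
  refine Finset.sum_congr rfl fun τ _ => ?_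
  rw [← Equiv.prod_comp τ]
  simp

/-- The contribution of one type `m`. The factor `m!` is compensated by Cauchy's estimate for both
coefficients, which gains `m ^ m` in total. -/
lemma abs_type_term_le {G H : Matrix ι I ℝ} (hG : SubOrthonormal G) (hH : SubOrthonormal H)
    {s : I → ℝ} (hs : ∀ a, 0 ≤ s a) {m : I → ℕ} (hm : ∑ a, m a = Fintype.card ι) :
    |(∏ a, s a ^ m a) * ((∏ a, ((m a)! : ℝ)) * columnCoeff H m) * columnCoeff G m| ≤
      Real.exp (-Fintype.card ι) * ∏ a, (stirlingWeight (m a) * s a ^ m a) := by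
  set p := ∏ a, (m a : ℝ) ^ m a with hp
  have hp0 : 0 ≤ p := Finset.prod_nonneg fun a _ => by positivity
  have hs0 : 0 ≤ ∏ a, s a ^ m a := Finset.prod_nonneg fun a _ => pow_nonneg (hs a) _
  have h1 := columnCoeff_sq_mul_prod_le hG.1 hG.2 hm
  have h2 := columnCoeff_sq_mul_prod_le hH.1 hH.2 hm
  have h3 : |columnCoeff H m * columnCoeff G m| * p ≤ 1 := by
    have h4 : (columnCoeff H m * columnCoeff G m * p) ^ 2 ≤ 1 := by
      calc _ = (columnCoeff G m ^ 2 * p) * (columnCoeff H m ^ 2 * p) := by ring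
        _ ≤ 1 * 1 := mul_le_mul h1 h2 (by positivity) zero_le_one
        _ = 1 := one_mul 1
    have h5 := (sq_le_one_iff_abs_le_one _).mp h4
    rwa [abs_mul, abs_of_nonneg hp0] at h5
  have h6 : (∏ a, ((m a)! : ℝ)) * Real.exp (Fintype.card ι) ≤ (∏ a, stirlingWeight (m a)) * p := by
    rw [← hm, hp, ← Finset.prod_mul_distrib]
    push_cast
    rw [Real.exp_sum, ← Finset.prod_mul_distrib]
    exact Finset.prod_le_prod (fun a _ => by positivity) fun a _ => factorial_mul_exp_le (m a)
  have hw : 0 ≤ ∏ a, stirlingWeight (m a) := Finset.prod_nonneg fun a _ => stirlingWeight_nonneg _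
  have hc := abs_nonneg (columnCoeff H m * columnCoeff G m)
  have h7 : (∏ a, ((m a)! : ℝ)) ≤ Real.exp (-Fintype.card ι) * (∏ a, stirlingWeight (m a)) * p := by
    rw [Real.exp_neg, mul_assoc, inv_mul_eq_div, le_div_iff₀ (Real.exp_pos _)]
    exact h6
  calc _ = (∏ a, s a ^ m a) * ((∏ a, ((m a)! : ℝ)) * |columnCoeff H m * columnCoeff G m|) := by
        rw [mul_assoc, mul_assoc, abs_mul, abs_mul, abs_of_nonneg hs0, abs_of_nonneg
          (Finset.prod_nonneg fun a _ => Nat.cast_nonneg ((m a)!))]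
    _ ≤ (∏ a, s a ^ m a) * ((Real.exp (-Fintype.card ι) * (∏ a, stirlingWeight (m a)) * p) *
          |columnCoeff H m * columnCoeff G m|) := by gcongr
    _ = (Real.exp (-Fintype.card ι) * ((∏ a, stirlingWeight (m a)) * ∏ a, s a ^ m a)) *
          (|columnCoeff H m * columnCoeff G m| * p) := by ring
    _ ≤ (Real.exp (-Fintype.card ι) * ((∏ a, stirlingWeight (m a)) * ∏ a, s a ^ m a)) * 1 := by
        gcongr
    _ = _ := by rw [mul_one, Finset.prod_mul_distrib]

/-- The part of the permanent of `G * diagonal s * Hᵀ` that comes from the maps whose fibers have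
prescribed cardinalities. -/
lemma abs_sum_maps_le {G H : Matrix ι I ℝ} (hG : SubOrthonormal G) (hH : SubOrthonormal H)
    {s : I → ℝ} (hs : ∀ a, 0 ≤ s a) (P : (I → ℕ) → Prop) [DecidablePred P] :
    |∑ f : ι → I with P (fiberCard f), (∏ i, s (f i)) * (∏ i, G i (f i)) *
        ∑ τ : Equiv.Perm ι, ∏ i, H (τ i) (f i)| ≤
      Real.exp (-Fintype.card ι) *
        ∏ a, ∑ j ∈ Finset.range (Fintype.card ι + 1), stirlingWeight j * s a ^ j := by
  rw [Finset.prod_univ_sum (fun _ : I => Finset.range (Fintype.card ι + 1))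
    (fun a j => stirlingWeight j * s a ^ j), Finset.mul_sum,
    ← Finset.sum_fiberwise_of_maps_to (t := Fintype.piFinset fun _ : I =>
      Finset.range (Fintype.card ι + 1)) (g := fun f : ι → I => fiberCard f)
      (fun f _ => Fintype.mem_piFinset.mpr fun a => Finset.mem_range.mpr
        (Nat.lt_succ_of_le (fiberCard_le f a)))]
  refine (Finset.abs_sum_le_sum_abs _ _).trans (Finset.sum_le_sum fun m _ => ?_)
  have hnn : 0 ≤ Real.exp (-Fintype.card ι) * ∏ a, (stirlingWeight (m a) * s a ^ m a) :=
    mul_nonneg (Real.exp_nonneg _) (Finset.prod_nonneg fun a _ =>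
      mul_nonneg (stirlingWeight_nonneg _) (pow_nonneg (hs a) _))
  rw [Finset.filter_filter]
  by_cases hm : P m ∧ ∑ a, m a = Fintype.card ι
  · have e : (Finset.univ.filter fun f : ι → I => P (fiberCard f) ∧ fiberCard f = m) =
        Finset.univ.filter fun f : ι → I => fiberCard f = m := by
      refine Finset.filter_congr fun f _ => ⟨fun h => h.2, fun h => ⟨h ▸ hm.1, h⟩⟩
    rw [e, Finset.sum_congr rfl (g := fun f => (∏ a, s a ^ m a) *
      ((∏ a, ((m a)! : ℝ)) * columnCoeff H m) * ∏ i, G i (f i)) fun f hf => by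
        rw [sum_perm_prod_eq, prod_comp_eq_prod_pow, (Finset.mem_filter.mp hf).2]
        ring, ← Finset.mul_sum]
    exact abs_type_term_le hG hH hs hm.2
  · rw [Finset.filter_false_of_mem, Finset.sum_empty, abs_zero]
    · exact hnn
    · rintro f - ⟨h1, rfl⟩
      exact hm ⟨h1, sum_fiberCard f⟩

/-- Singular value decomposition of a matrix with vanishing row and column sums; the singular
vectors that belong to the singular value `0` are replaced by `0`. -/
lemma exists_singular_decomposition {L : Matrix ι ι ℝ} {ρ : ℝ} (hρ : 0 ≤ ρ) (hL : NormLE L ρ)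
    (hrow : ∀ i, ∑ j, L i j = 0) (hcol : ∀ j, ∑ i, L i j = 0) :
    ∃ (u v : Matrix ι ι ℝ) (s : ι → ℝ), SubOrthonormal u ∧ SubOrthonormal v ∧
      (∀ a, ∑ i, u i a = 0) ∧ (∀ a, ∑ i, v i a = 0) ∧ (∀ a, 0 ≤ s a) ∧ (∀ a, s a ≤ ρ) ∧
      ∑ a, s a ^ 2 = ∑ i, ∑ j, L i j ^ 2 ∧ ∀ i j, L i j = ∑ a, s a * (u i a * v j a) := by
  obtain ⟨U, μ, hU, hU', hB⟩ := exists_orthogonal_diagonalization (B := Lᵀ * L)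
    (by rw [Matrix.IsSymm, Matrix.transpose_mul, Matrix.transpose_transpose])
  have hgram : (L * U)ᵀ * (L * U) = Matrix.diagonal μ := by
    calc (L * U)ᵀ * (L * U) = Uᵀ * (Lᵀ * L) * U := by
          rw [Matrix.transpose_mul]; simp only [Matrix.mul_assoc]
      _ = (Uᵀ * U) * Matrix.diagonal μ * (Uᵀ * U) := by
          rw [hB]; simp only [Matrix.mul_assoc]
      _ = _ := by rw [hU', one_mul, mul_one]
  have hortho : ∀ a b, ∑ i, (L * U) i a * (L * U) i b = Matrix.diagonal μ a b := fun a b => by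
    rw [← hgram, Matrix.mul_apply]; rfl
  have hμ : ∀ a, ∑ i, (L * U) i a ^ 2 = μ a := fun a => by
    simpa [sq] using hortho a a
  have hU1 : ∀ a b, ∑ i, U i a * U i b = (1 : Matrix ι ι ℝ) a b := fun a b => by
    rw [← hU', Matrix.mul_apply]; rfl
  have hμ0 : ∀ a, 0 ≤ μ a := fun a => hμ a ▸ Finset.sum_nonneg fun _ _ => sq_nonneg _
  have hμρ : ∀ a, μ a ≤ ρ ^ 2 := fun a => by
    have h1 := hL fun j => U j a
    have h2 := hU1 a a
    have e : L *ᵥ (fun j => U j a) = fun i => (L * U) i a := by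
      funext i; simp [Matrix.mulVec, dotProduct, Matrix.mul_apply]
    rw [e] at h1
    simp only [dotProduct] at h1
    rw [h2, hortho a a] at h1
    simpa using h1
  have hzero : ∀ a, μ a = 0 → ∀ i, (L * U) i a = 0 := fun a ha i => by
    have h1 := hμ a
    rw [ha, Finset.sum_eq_zero_iff_of_nonneg fun _ _ => sq_nonneg _] at h1
    exact pow_eq_zero_iff (two_ne_zero) |>.mp (h1 i (Finset.mem_univ i))
  refine ⟨Matrix.of fun i a => (L * U) i a / Real.sqrt (μ a),
    Matrix.of fun i a => if μ a = 0 then 0 else U i a, fun a => Real.sqrt (μ a),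
    ⟨fun a b hab => ?_, fun a => ?_⟩, ⟨fun a b hab => ?_, fun a => ?_⟩, fun a => ?_, fun a => ?_,
    fun a => Real.sqrt_nonneg _, fun a => Real.sqrt_le_iff.mpr ⟨hρ, hμρ a⟩, ?_, fun i j => ?_⟩
  · have h1 := hortho a b
    rw [Matrix.diagonal_apply_ne _ hab] at h1
    simp only [Matrix.of_apply, div_mul_div_comm]
    rw [← Finset.sum_div, h1, zero_div]
  · simp only [Matrix.of_apply, div_pow]
    rw [← Finset.sum_div, hμ, Real.sq_sqrt (hμ0 a)]
    exact div_self_le_one _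
  · have h1 := hU1 a b
    rw [Matrix.one_apply_ne hab] at h1
    simp only [Matrix.of_apply]
    split_ifs <;> simp [h1]
  · have h1 := hU1 a a
    rw [Matrix.one_apply_eq] at h1
    simp only [Matrix.of_apply]
    split_ifs
    · simp
    · simp_rw [sq]
      exact h1.le
  · simp only [Matrix.of_apply, Matrix.mul_apply]
    rw [← Finset.sum_div, Finset.sum_comm]
    simp_rw [← Finset.sum_mul, hcol]
    simp
  · simp only [Matrix.of_apply]
    split_ifs with h
    · simp
    · have h1 : μ a * ∑ i, U i a = 0 := by
        calc μ a * ∑ i, U i a = ∑ i, (Lᵀ * (L * U)) i a := by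
              have : Lᵀ * (L * U) = U * Matrix.diagonal μ := by
                rw [← Matrix.mul_assoc, hB, Matrix.mul_assoc, hU', mul_one]
              rw [this, Finset.mul_sum]
              refine Finset.sum_congr rfl fun i _ => ?_
              rw [Matrix.mul_diagonal, mul_comm]
          _ = ∑ j, (∑ i, L j i) * (L * U) j a := by
              simp_rw [Matrix.mul_apply (M := Lᵀ), Finset.sum_mul]
              exact Finset.sum_comm
          _ = 0 := by simp [hrow]
      exact (mul_eq_zero.mp h1).resolve_left h
  · simp_rw [Real.sq_sqrt (hμ0 _), ← hμ]
    rw [Finset.sum_comm]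
    refine Finset.sum_congr rfl fun i _ => ?_
    have h1 : (L * U) * (L * U)ᵀ = L * Lᵀ := by
      rw [Matrix.transpose_mul, Matrix.mul_assoc, ← Matrix.mul_assoc U, hU, one_mul]
    have h2 := congrFun (congrFun h1 i) i
    rw [Matrix.mul_apply, Matrix.mul_apply] at h2
    simpa [sq] using h2
  · have h1 : L i j = ∑ a, (L * U) i a * U j a := by
      have : L = (L * U) * Uᵀ := by rw [Matrix.mul_assoc, hU, mul_one]
      conv_lhs => rw [this]
      rw [Matrix.mul_apply]
      rfl
    rw [h1]
    refine Finset.sum_congr rfl fun a _ => ?_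
    simp only [Matrix.of_apply]
    split_ifs with h
    · simp [hzero a h i]
    · have : Real.sqrt (μ a) ≠ 0 := fun h0 => h ((Real.sqrt_eq_zero (hμ0 a)).mp h0)
      field_simp

/-- Adjoin to the columns of a matrix the constant unit vector. -/
def borderColumns (u : Matrix ι I ℝ) : Matrix ι (Option I) ℝ :=
  Matrix.of fun i a => a.elim (Real.sqrt (Fintype.card ι))⁻¹ fun b => u i b

omit [DecidableEq ι] [Fintype I] [DecidableEq I] in
lemma subOrthonormal_borderColumns {u : Matrix ι I ℝ} (hu : SubOrthonormal u)
    (hsum : ∀ a, ∑ i, u i a = 0) : SubOrthonormal (borderColumns u) := by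
  constructor
  · rintro (_ | a) (_ | b) hab
    · exact absurd rfl hab
    · simp [borderColumns, ← Finset.mul_sum, hsum]
    · simp [borderColumns, ← Finset.sum_mul, hsum]
    · exact hu.1 a b fun h => hab (congrArg some h)
  · rintro (_ | a)
    · simp [borderColumns]
      exact mul_inv_le_one
    · exact hu.2 a

/-- Expanding products over maps into `Option I` by the set where the value is not `none`. -/
lemma sum_maps_option_eq (W : ι → Option I → ℝ) {k : ℕ} (hk : k ≤ Fintype.card ι) :
    ∑ f : ι → Option I with fiberCard f none = Fintype.card ι - k, ∏ i, W i (f i) =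
      ∑ R ∈ Finset.powersetCard k (Finset.univ : Finset ι),
        (∏ i ∈ R, ∑ a, W i (some a)) * ∏ i ∈ Rᶜ, W i none := by
  have hsupp : ∀ f : ι → Option I, (Finset.univ.filter fun i => f i ≠ none).card =
      Fintype.card ι - fiberCard f none := fun f => by
    have := Finset.card_filter_add_card_filter_not (s := (Finset.univ : Finset ι)) (fun i => f i = none)
    rw [Finset.card_univ] at this
    simp only [fiberCard]
    simp only [ne_eq]
    omega
  rw [← Finset.sum_fiberwise_of_maps_to (t := Finset.powersetCard k (Finset.univ : Finset ι))
    (g := fun f : ι → Option I => Finset.univ.filter fun i => f i ≠ none) (fun f hf => by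
      rw [Finset.mem_powersetCard, hsupp, (Finset.mem_filter.mp hf).2]
      exact ⟨Finset.subset_univ _, by omega⟩)]
  refine Finset.sum_congr rfl fun R hR => ?_
  rw [Finset.mem_powersetCard] at hR
  have e : ((Finset.univ.filter fun f : ι → Option I => fiberCard f none = Fintype.card ι - k).filter
      fun f => (Finset.univ.filter fun i => f i ≠ none) = R) =
      Fintype.piFinset fun i => if i ∈ R then (Finset.univ.erase none) else {none} := by
    ext f
    simp only [Finset.mem_filter, Finset.mem_univ, true_and, Fintype.mem_piFinset]
    constructor
    · rintro ⟨-, rfl⟩ i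
      by_cases h : f i = none <;> simp [h]
    · intro h
      have h1 : (Finset.univ.filter fun i => f i ≠ none) = R := by
        ext i
        have := h i
        by_cases hi : i ∈ R <;> simp [hi] at this ⊢ <;> assumption
      refine ⟨?_, h1⟩
      have h2 := hsupp f
      rw [h1, hR.2] at h2
      have := fiberCard_le f none
      omega
  rw [e, ← Finset.prod_univ_sum]
  rw [← Finset.prod_mul_prod_compl R]
  congr 1
  · refine Finset.prod_congr rfl fun i hi => ?_
    rw [if_pos hi, Finset.sum_erase_eq_sub (Finset.mem_univ _), Fintype.sum_option]
    ring
  · refine Finset.prod_congr rfl fun i hi => ?_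
    rw [if_neg (Finset.mem_compl.mp hi), Finset.sum_singleton]

end CrudeBound

section CrudeBound

variable {ι : Type*} [Fintype ι] [DecidableEq ι]

lemma sum_stirlingWeight_mul_pow_le {s ρ : ℝ} (hs : 0 ≤ s) (hsρ : s ≤ ρ) (hρ1 : ρ < 1) (n : ℕ) :
    ∑ j ∈ Finset.range (n + 1), stirlingWeight j * s ^ j ≤
      Real.exp (Real.exp 1 * ((1 - ρ)⁻¹) ^ 2 * s) := by
  have hs1 : ‖s‖ < 1 := by rw [Real.norm_of_nonneg hs]; linarith
  have hsum : Summable fun j : ℕ => (j : ℝ) * s ^ j := by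
    simpa using summable_pow_mul_geometric_of_norm_lt_one (R := ℝ) 1 hs1
  have h1 : ∑ j ∈ Finset.range n, ((j + 1 : ℕ) : ℝ) * s ^ (j + 1) ≤ s / (1 - s) ^ 2 := by
    rw [← tsum_coe_mul_geometric_of_norm_lt_one hs1]
    have h2 := hsum.sum_le_tsum (Finset.range (n + 1)) fun j _ => by positivity
    rw [Finset.sum_range_succ'] at h2
    simpa using h2
  have h3 : s / (1 - s) ^ 2 ≤ ((1 - ρ)⁻¹) ^ 2 * s := by
    rw [div_eq_inv_mul, ← inv_pow]
    have : (1 - s)⁻¹ ≤ (1 - ρ)⁻¹ := inv_anti₀ (by linarith) (by linarith)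
    have h0 : 0 ≤ (1 - s)⁻¹ := inv_nonneg.mpr (by linarith)
    gcongr
  rw [Finset.sum_range_succ']
  calc _ = Real.exp 1 * ∑ j ∈ Finset.range n, ((j + 1 : ℕ) : ℝ) * s ^ (j + 1) + 1 := by
        rw [Finset.mul_sum]
        simp [stirlingWeight, mul_assoc]
    _ ≤ Real.exp 1 * (((1 - ρ)⁻¹) ^ 2 * s) + 1 := by
        gcongr
        exact h1.trans h3
    _ = Real.exp 1 * ((1 - ρ)⁻¹) ^ 2 * s + 1 := by ring
    _ ≤ _ := Real.add_one_le_exp _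

lemma sum_stirlingWeight_le (n : ℕ) :
    ∑ j ∈ Finset.range (n + 1), stirlingWeight j ≤ Real.exp 1 * ((n : ℝ) + 1) ^ 2 := by
  calc _ ≤ ∑ j ∈ Finset.range (n + 1), Real.exp 1 * ((n : ℝ) + 1) := by
        refine Finset.sum_le_sum fun j hj => ?_
        have h1 : (j : ℝ) ≤ n := by exact_mod_cast Nat.lt_succ_iff.mp (Finset.mem_range.mp hj)
        unfold stirlingWeight
        split_ifs
        · have := Real.add_one_le_exp (1 : ℝ)
          nlinarith [(Nat.cast_nonneg n : (0 : ℝ) ≤ n)]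
        · gcongr
          linarith
    _ = _ := by
        rw [Finset.sum_const, Finset.card_range, nsmul_eq_mul]
        push_cast
        ring

/-- The singular value decomposition turns the sums of subpermanents into the part of the permanent
of `J + L` that comes from maps taking the value `none`, which stands for `J`, exactly `n - k`
times. -/
lemma sum_permSum_mul_pow_eq {L u v : Matrix ι ι ℝ} {s : ι → ℝ}
    (hL : ∀ i j, L i j = ∑ a, s a * (u i a * v j a)) {k : ℕ} (hk : k ≤ Fintype.card ι) :
    (∑ R ∈ Finset.powersetCard k Finset.univ, permSum L R Finset.univ) *
        ((Fintype.card ι : ℝ)⁻¹) ^ (Fintype.card ι - k) =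
      ∑ f : ι → Option ι with fiberCard f none = Fintype.card ι - k,
        (∏ i, (fun a : Option ι => a.elim 1 s) (f i)) * (∏ i, borderColumns u i (f i)) *
          ∑ τ : Equiv.Perm ι, ∏ i, borderColumns v (τ i) (f i) := by
  symm
  simp_rw [Finset.mul_sum]
  rw [Finset.sum_comm]
  simp_rw [← Finset.prod_mul_distrib]
  rw [Finset.sum_mul]
  simp_rw [permSum, Finset.sum_mul]
  rw [Finset.sum_comm (s := Finset.powersetCard k Finset.univ)]
  refine Finset.sum_congr rfl fun τ _ => ?_
  rw [sum_maps_option_eq (fun i (a : Option ι) => a.elim 1 s * borderColumns u i a *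
    borderColumns v (τ i) a) hk]
  refine Finset.sum_congr rfl fun R hR => ?_
  congr 1
  · refine Finset.prod_congr rfl fun i _ => ?_
    rw [if_pos (Finset.mem_univ _), hL]
    exact Finset.sum_congr rfl fun a _ => by simp [borderColumns, mul_assoc]
  · rw [Finset.prod_congr rfl (g := fun _ => (Fintype.card ι : ℝ)⁻¹), Finset.prod_const,
      Finset.card_compl, (Finset.mem_powersetCard.mp hR).2]
    intro i _
    simp only [borderColumns, Matrix.of_apply, Option.elim]
    rw [one_mul, ← mul_inv, Real.mul_self_sqrt (Nat.cast_nonneg _)]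

/-- A bound for the coefficients of the polynomial `z ↦ per (n (J + z L)) / n!` that is uniform in
the order `k` of the coefficient; it is used for large `k` only. -/
lemma abs_sum_permSum_le {L : Matrix ι ι ℝ} {ρ : ℝ} (hρ : 0 ≤ ρ) (hρ1 : ρ < 1) (hL : NormLE L ρ)
    (hrow : ∀ i, ∑ j, L i j = 0) (hcol : ∀ j, ∑ i, L i j = 0) {n : ℕ} (hn : Fintype.card ι = n)
    {k : ℕ} (hk : k ≤ n) :
    |(n : ℝ) ^ k / n ! * ∑ R ∈ Finset.powersetCard k Finset.univ, permSum L R Finset.univ| ≤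
      Real.exp 1 * ((n : ℝ) + 1) ^ 2 *
        Real.exp (Real.exp 1 * ((1 - ρ)⁻¹) ^ 2 * Real.sqrt (n * ∑ i, ∑ j, L i j ^ 2)) := by
  obtain ⟨u, v, s, hu, hv, hu0, hv0, hs0, hsρ, hs2, hdec⟩ :=
    exists_singular_decomposition hρ hL hrow hcol
  have h1 := abs_sum_maps_le (subOrthonormal_borderColumns hu hu0)
    (subOrthonormal_borderColumns hv hv0) (s := fun a : Option ι => a.elim 1 s)
    (by rintro (_ | a); exacts [zero_le_one, hs0 a]) (fun m => m none = Fintype.card ι - k)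
  rw [← sum_permSum_mul_pow_eq hdec (hn ▸ hk), Fintype.prod_option, hn] at h1
  simp only [Option.elim, one_pow, mul_one] at h1
  have hsum : ∑ a, s a ≤ Real.sqrt (n * ∑ i, ∑ j, L i j ^ 2) := by
    refine Real.le_sqrt_of_sq_le ?_
    rw [← hs2, ← hn]
    have := sq_sum_le_card_mul_sum_sq (s := (Finset.univ : Finset ι)) (f := s)
    simpa using this
  have hprod : ∏ a, ∑ j ∈ Finset.range (n + 1), stirlingWeight j * s a ^ j ≤
      Real.exp (Real.exp 1 * ((1 - ρ)⁻¹) ^ 2 * Real.sqrt (n * ∑ i, ∑ j, L i j ^ 2)) := by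
    calc _ ≤ ∏ a, Real.exp (Real.exp 1 * ((1 - ρ)⁻¹) ^ 2 * s a) :=
          Finset.prod_le_prod (fun a _ => Finset.sum_nonneg fun j _ =>
            mul_nonneg (stirlingWeight_nonneg _) (pow_nonneg (hs0 a) _)) fun a _ =>
            sum_stirlingWeight_mul_pow_le (hs0 a) (hsρ a) hρ1 n
      _ = Real.exp (Real.exp 1 * ((1 - ρ)⁻¹) ^ 2 * ∑ a, s a) := by
          rw [← Real.exp_sum, Finset.mul_sum]
      _ ≤ _ := by gcongr
  set P := ∑ R ∈ Finset.powersetCard k Finset.univ, permSum L R Finset.univ with hP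
  have hp0 : 0 ≤ ∏ a, ∑ j ∈ Finset.range (n + 1), stirlingWeight j * s a ^ j :=
    Finset.prod_nonneg fun a _ => Finset.sum_nonneg fun j _ =>
      mul_nonneg (stirlingWeight_nonneg _) (pow_nonneg (hs0 a) _)
  have hnn : (n : ℝ) ^ n / n ! ≤ Real.exp n := by
    have := Real.pow_div_factorial_le_exp (n : ℝ) (Nat.cast_nonneg n) n
    exact this
  have hscale : (n : ℝ) ^ k / n ! * P = (n : ℝ) ^ n / n ! * (P * ((n : ℝ)⁻¹) ^ (n - k)) := by
    rcases Nat.eq_zero_or_pos n with h0 | h0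
    · have : k = 0 := by omega
      subst this; subst h0; simp
    · have : (n : ℝ) ≠ 0 := by positivity
      rw [inv_pow]
      have e : (n : ℝ) ^ n = (n : ℝ) ^ k * (n : ℝ) ^ (n - k) := by rw [← pow_add]; congr 1; omega
      rw [e]
      field_simp
  rw [hscale, abs_mul, abs_of_nonneg (by positivity)]
  calc _ ≤ Real.exp n * (Real.exp (-n) * ((∑ j ∈ Finset.range (n + 1), stirlingWeight j) *
          ∏ a, ∑ j ∈ Finset.range (n + 1), stirlingWeight j * s a ^ j)) := by
        gcongr
    _ = (∑ j ∈ Finset.range (n + 1), stirlingWeight j) *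
          ∏ a, ∑ j ∈ Finset.range (n + 1), stirlingWeight j * s a ^ j := by
        rw [← mul_assoc, ← Real.exp_add]
        simp
    _ ≤ _ := by
        gcongr
        exact sum_stirlingWeight_le n

end CrudeBound

/-! ### Comparison of the permanent with the determinantal series -/

section Comparison

/-- The ratio `n ^ k / (n (n - 1) ⋯ (n - k + 1))`. -/
def fallScale (n k : ℕ) : ℝ := ((n - k)! : ℝ) * n ^ k / n !

lemma fallScale_zero (n : ℕ) : fallScale n 0 = 1 := by
  simp [fallScale, Nat.factorial_ne_zero]

lemma fallScale_nonneg (n k : ℕ) : 0 ≤ fallScale n k := by unfold fallScale; positivity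

lemma fallScale_succ {n k : ℕ} (hk : k < n) :
    fallScale n (k + 1) * (n - k) = fallScale n k * n := by
  have h1 : n - k = (n - (k + 1)) + 1 := by omega
  have h2 : ((n - k : ℕ) : ℝ) = n - k := Nat.cast_sub hk.le
  unfold fallScale
  rw [h1, Nat.factorial_succ, ← h1]
  push_cast
  rw [h2]
  ring

lemma fallScale_sub_one_le {n k : ℕ} (hk : k ≤ n) :
    fallScale n k - 1 ≤ fallScale n k * ((k : ℝ) ^ 2 / n) := by
  suffices h : fallScale n k * (1 - (k : ℝ) ^ 2 / n) ≤ 1 by linarith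
  induction k with
  | zero => simp [fallScale_zero]
  | succ k ih =>
    have hkn : (k : ℝ) + 1 ≤ n := by exact_mod_cast hk
    have hn : (0 : ℝ) < n := by linarith [(Nat.cast_nonneg k : (0 : ℝ) ≤ k)]
    have hnk : (0 : ℝ) < n - k := by linarith
    have h1 := fallScale_succ (show k < n by omega)
    refine le_trans ?_ (ih (by omega))
    have h2 : fallScale n (k + 1) = fallScale n k * (n / (n - k)) := by
      field_simp
      linarith
    rw [h2, mul_assoc]
    refine mul_le_mul_of_nonneg_left ?_ (fallScale_nonneg n k)
    rw [div_mul_eq_mul_div, div_le_iff₀ hnk]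
    have e1 : (n : ℝ) * (1 - ((k + 1 : ℕ) : ℝ) ^ 2 / n) = n - (k + 1) ^ 2 := by
      push_cast
      field_simp
    have e2 : (1 - (k : ℝ) ^ 2 / n) * (n - k) = n - k ^ 2 - k + k ^ 3 / n := by
      field_simp
      ring
    rw [e1, e2]
    have : 0 ≤ (k : ℝ) ^ 3 / n := by positivity
    nlinarith [(Nat.cast_nonneg k : (0 : ℝ) ≤ k)]

lemma one_le_fallScale {n k : ℕ} (hk : k ≤ n) : 1 ≤ fallScale n k := by
  induction k with
  | zero => simp [fallScale_zero]
  | succ k ih =>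
    have hkn : (k : ℝ) + 1 ≤ n := by exact_mod_cast hk
    have h1 := fallScale_succ (show k < n by omega)
    have h2 := ih (by omega)
    have hk0 : (0 : ℝ) ≤ k := Nat.cast_nonneg k
    nlinarith

/-- As long as `k ≤ (1 - z) n`, the factor `z ^ k` outweighs `fallScale n k`. -/
lemma fallScale_mul_pow_le {n k : ℕ} {z : ℝ} (hz : 0 ≤ z) (hk : k < n)
    (hkz : (k : ℝ) ≤ (1 - z) * n) :
    fallScale n k * z ^ k ≤ 1 := by
  induction k with
  | zero => simp [fallScale_zero]
  | succ k ih =>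
    have hkn : (k : ℝ) + 1 < n := by exact_mod_cast hk
    push_cast at hkz
    have h1 := fallScale_succ (show k < n by omega)
    have h2 := ih (by omega) (by linarith)
    have hnk : (0 : ℝ) < n - k := by linarith
    have h0 : 0 ≤ fallScale n k * z ^ k := mul_nonneg (fallScale_nonneg _ _) (pow_nonneg hz _)
    have e : fallScale n (k + 1) * z ^ (k + 1) = fallScale n k * z ^ k * (n * z / (n - k)) := by
      field_simp
      rw [pow_succ]
      linear_combination (z ^ k * z) * h1
    rw [e]
    have h3 : n * z / (n - k) ≤ 1 := by
      rw [div_le_one hnk]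
      linarith
    have h4 : 0 ≤ n * z / (n - k) := by positivity
    nlinarith

/-- The expansion of `per (n (J + z L)) / n!` in powers of `z`. -/
lemma permanent_div_factorial_eq {n : ℕ} (hn : 0 < n) (L : Matrix (Fin n) (Fin n) ℝ) (z : ℝ) :
    ((n : ℝ) • (J n + z • L)).permanent / n ! =
      ∑ k ∈ Finset.range (n + 1), z ^ k *
        ((n : ℝ) ^ k / n ! * ∑ R ∈ Finset.powersetCard k Finset.univ,
          permSum L R Finset.univ) := by
  have hn0 : (n : ℝ) ≠ 0 := by positivity
  rw [← Matrix.permanent_transpose, Matrix.permanent]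
  have e : ∀ σ : Equiv.Perm (Fin n), ∏ i, ((n : ℝ) • (J n + z • L))ᵀ (σ i) i =
      ∑ k ∈ Finset.range (n + 1), ∑ R ∈ Finset.powersetCard k Finset.univ,
        (n * z) ^ k * ∏ i ∈ R, L i (σ i) := by
    intro σ
    have e1 : ∀ i, ((n : ℝ) • (J n + z • L))ᵀ (σ i) i = 1 + n * z * L i (σ i) := by
      intro i
      simp [J, mul_inv_cancel₀ hn0, mul_assoc]
    simp_rw [e1]
    rw [Finset.prod_one_add, Finset.sum_powerset, Finset.card_univ, Fintype.card_fin]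
    refine Finset.sum_congr rfl fun k _ => Finset.sum_congr rfl fun R hR => ?_
    rw [Finset.prod_mul_distrib, Finset.prod_const, (Finset.mem_powersetCard.mp hR).2]
  simp_rw [e]
  rw [Finset.sum_comm, Finset.sum_div]
  refine Finset.sum_congr rfl fun k _ => ?_
  rw [Finset.sum_comm, Finset.mul_sum, Finset.mul_sum, Finset.sum_div]
  refine Finset.sum_congr rfl fun R _ => ?_
  simp only [permSum, Finset.mem_univ, if_true]
  rw [← Finset.mul_sum]
  ring

lemma fallScale_mul_subPermSum {n : ℕ} (L : Matrix (Fin n) (Fin n) ℝ) (k : ℕ) :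
    (n : ℝ) ^ k / n ! * ∑ R ∈ Finset.powersetCard k Finset.univ, permSum L R Finset.univ =
      fallScale n k * subPermSum L k := by
  rw [subPermSum_eq, ← Finset.sum_div, Fintype.card_fin, fallScale]
  have : ((n - k)! : ℝ) ≠ 0 := Nat.cast_ne_zero.mpr (Nat.factorial_ne_zero _)
  field_simp

/-- The determinantal series: the expansion of `det (1 - z ^ 2 • Lᵀ * L) ^ (-1 / 2)` in powers
of `z`. -/
def detSeries {n : ℕ} (L : Matrix (Fin n) (Fin n) ℝ) (z : ℝ) : ℝ :=
  ∑' k, detCoeff (bip L) k * z ^ k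

/-- A bound for the determinantal series; the weights `(j + 1) ^ 2` serve to bound its tails and
the effect of `fallScale`. -/
def seriesBound (ρ m : ℝ) : ℝ := ∑' j : ℕ, ((j : ℝ) + 1) ^ 2 * negBinom ρ m j

variable {n : ℕ} {L : Matrix (Fin n) (Fin n) ℝ} {ρ m z : ℝ}

lemma detCoeff_bip_nonneg (L : Matrix (Fin n) (Fin n) ℝ) (k : ℕ) : 0 ≤ detCoeff (bip L) k :=
  detCoeff_nonneg (bip_isSymm L) (trace_bip_pow_odd L) k

lemma detCoeff_bip_le (hρ : 0 < ρ) (hm : 0 < m) (hL : NormLE L ρ) (hL' : NormLE Lᵀ ρ)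
    (hT : ∑ i, ∑ j, L i j ^ 2 ≤ m * ρ ^ 2) (k : ℕ) :
    detCoeff (bip L) k ≤ negBinom ρ m k := by
  refine detCoeff_le_negBinom (bip_isSymm L) (trace_bip_pow_odd L) hρ hm (normLE_bip hL hL') ?_ k
  rw [sum_sum_bip L (g := fun x => x ^ 2) (by norm_num)]
  linarith

lemma summable_detCoeff_weight (hρ : 0 < ρ) (hρ1 : ρ < 1) (hm : 0 < m) (hL : NormLE L ρ)
    (hL' : NormLE Lᵀ ρ) (hT : ∑ i, ∑ j, L i j ^ 2 ≤ m * ρ ^ 2) :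
    Summable fun k : ℕ => ((k : ℝ) + 1) ^ 2 * detCoeff (bip L) k :=
  (summable_negBinom hρ hρ1 hm).of_nonneg_of_le
    (fun k => mul_nonneg (by positivity) (detCoeff_bip_nonneg L k))
    fun k => mul_le_mul_of_nonneg_left (detCoeff_bip_le hρ hm hL hL' hT k) (by positivity)

lemma tsum_detCoeff_weight_le (hρ : 0 < ρ) (hρ1 : ρ < 1) (hm : 0 < m) (hL : NormLE L ρ)
    (hL' : NormLE Lᵀ ρ) (hT : ∑ i, ∑ j, L i j ^ 2 ≤ m * ρ ^ 2) :
    ∑' k : ℕ, ((k : ℝ) + 1) ^ 2 * detCoeff (bip L) k ≤ seriesBound ρ m :=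
  (summable_detCoeff_weight hρ hρ1 hm hL hL' hT).tsum_le_tsum
    (fun k => mul_le_mul_of_nonneg_left (detCoeff_bip_le hρ hm hL hL' hT k) (by positivity))
    (summable_negBinom hρ hρ1 hm)

lemma detCoeff_mul_pow_le (hz : 0 ≤ z) (hz1 : z ≤ 1) (k : ℕ) :
    detCoeff (bip L) k * z ^ k ≤ ((k : ℝ) + 1) ^ 2 * detCoeff (bip L) k := by
  have h1 : z ^ k ≤ 1 := pow_le_one₀ hz hz1
  have h2 : (1 : ℝ) ≤ ((k : ℝ) + 1) ^ 2 :=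
    one_le_pow₀ (by linarith [(Nat.cast_nonneg k : (0 : ℝ) ≤ k)])
  have h3 := detCoeff_bip_nonneg L k
  nlinarith

lemma summable_detSeries (hρ : 0 < ρ) (hρ1 : ρ < 1) (hm : 0 < m) (hL : NormLE L ρ)
    (hL' : NormLE Lᵀ ρ) (hT : ∑ i, ∑ j, L i j ^ 2 ≤ m * ρ ^ 2) (hz : 0 ≤ z) (hz1 : z ≤ 1) :
    Summable fun k : ℕ => detCoeff (bip L) k * z ^ k :=
  (summable_detCoeff_weight hρ hρ1 hm hL hL' hT).of_nonneg_of_le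
    (fun k => mul_nonneg (detCoeff_bip_nonneg L k) (by positivity))
    fun k => detCoeff_mul_pow_le hz hz1 k

lemma one_le_detSeries (hρ : 0 < ρ) (hρ1 : ρ < 1) (hm : 0 < m) (hL : NormLE L ρ)
    (hL' : NormLE Lᵀ ρ) (hT : ∑ i, ∑ j, L i j ^ 2 ≤ m * ρ ^ 2) (hz : 0 ≤ z) (hz1 : z ≤ 1) :
    1 ≤ detSeries L z := by
  have h := (summable_detSeries hρ hρ1 hm hL hL' hT hz hz1).sum_le_tsum {0}
    fun k _ => mul_nonneg (detCoeff_bip_nonneg L k) (pow_nonneg hz k)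
  simpa [detSeries, detCoeff_zero] using h

lemma detSeries_le (hρ : 0 < ρ) (hρ1 : ρ < 1) (hm : 0 < m) (hL : NormLE L ρ)
    (hL' : NormLE Lᵀ ρ) (hT : ∑ i, ∑ j, L i j ^ 2 ≤ m * ρ ^ 2) (hz : 0 ≤ z) (hz1 : z ≤ 1) :
    detSeries L z ≤ seriesBound ρ m :=
  ((summable_detSeries hρ hρ1 hm hL hL' hT hz hz1).tsum_le_tsum
    (fun k => detCoeff_mul_pow_le hz hz1 k) (summable_detCoeff_weight hρ hρ1 hm hL hL' hT)).trans
    (tsum_detCoeff_weight_le hρ hρ1 hm hL hL' hT)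

lemma detSeries_sq_mul_det (hρ : 0 < ρ) (hρ1 : ρ < 1) (hm : 0 < m) (hL : NormLE L ρ)
    (hL' : NormLE Lᵀ ρ) (hT : ∑ i, ∑ j, L i j ^ 2 ≤ m * ρ ^ 2) (hz : 0 ≤ z) (hz1 : z ≤ 1) :
    detSeries L z ^ 2 * (1 - z ^ 2 • (Lᵀ * L)).det = 1 := by
  rw [← det_one_add_smul_bip]
  exact tsum_detCoeff_sq_mul_det (bip_isSymm L)
    (summable_detSeries hρ hρ1 hm hL hL' hT hz hz1).norm

/-- The tail of the determinantal series. -/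
lemma abs_sum_range_sub_detSeries_le (hρ : 0 < ρ) (hρ1 : ρ < 1) (hm : 0 < m) (hL : NormLE L ρ)
    (hL' : NormLE Lᵀ ρ) (hT : ∑ i, ∑ j, L i j ^ 2 ≤ m * ρ ^ 2) (hz : 0 ≤ z) (hz1 : z ≤ 1) (N : ℕ) :
    |∑ k ∈ Finset.range (N + 1), detCoeff (bip L) k * z ^ k - detSeries L z| ≤
      seriesBound ρ m / ((N : ℝ) + 1) ^ 2 := by
  have hs := summable_detSeries hρ hρ1 hm hL hL' hT hz hz1
  have hw := summable_detCoeff_weight hρ hρ1 hm hL hL' hT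
  have e := hs.sum_add_tsum_nat_add (N + 1)
  rw [detSeries, ← e, sub_add_cancel_left, abs_neg, abs_of_nonneg
    (tsum_nonneg fun k => mul_nonneg (detCoeff_bip_nonneg L _) (pow_nonneg hz _)),
    le_div_iff₀ (by positivity), ← tsum_mul_right]
  refine le_trans ?_ (tsum_detCoeff_weight_le hρ hρ1 hm hL hL' hT)
  have hw' := (summable_nat_add_iff (N + 1)).mpr hw
  have h1 : ∑' k : ℕ, (((k + (N + 1) : ℕ) : ℝ) + 1) ^ 2 * detCoeff (bip L) (k + (N + 1)) ≤
      ∑' k : ℕ, ((k : ℝ) + 1) ^ 2 * detCoeff (bip L) k := by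
    rw [← hw.sum_add_tsum_nat_add (N + 1)]
    exact le_add_of_nonneg_left (Finset.sum_nonneg fun k _ =>
      mul_nonneg (by positivity) (detCoeff_bip_nonneg L k))
  refine le_trans (Summable.tsum_le_tsum (fun k => ?_)
    (((summable_nat_add_iff (N + 1)).mpr hs).mul_right _) hw') h1
  have h2 : z ^ (k + (N + 1)) ≤ 1 := pow_le_one₀ hz hz1
  have h3 := detCoeff_bip_nonneg L (k + (N + 1))
  have h4 : ((N : ℝ) + 1) ^ 2 ≤ (((k + (N + 1) : ℕ) : ℝ) + 1) ^ 2 := by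
    push_cast
    gcongr
    linarith [(Nat.cast_nonneg k : (0 : ℝ) ≤ k)]
  calc _ ≤ detCoeff (bip L) (k + (N + 1)) * 1 * (((k + (N + 1) : ℕ) : ℝ) + 1) ^ 2 := by gcongr
    _ = _ := by ring

end Comparison

section Comparison

variable {n : ℕ} {L : Matrix (Fin n) (Fin n) ℝ} {ρ m z : ℝ}

/-- For the orders `k` above `h ^ 18`, where `h ^ 30 = n`, the uniform bound of the coefficients is
absorbed by the factor `z ^ k`. -/
lemma sum_Ico_abs_le {h T : ℝ} (hn : h ^ 30 = n) (h1 : 1 ≤ h) (hρ : 0 ≤ ρ) (hρ1 : ρ < 1)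
    (hL : NormLE L ρ) (hrow : ∀ i, ∑ j, L i j = 0) (hcol : ∀ j, ∑ i, L i j = 0)
    (hT : ∑ i, ∑ j, L i j ^ 2 ≤ T) (hz : 0 < z) (hz1 : z < 1)
    (hh : 123 + Real.exp 1 * ((1 - ρ)⁻¹) ^ 2 * Real.sqrt T ≤ -Real.log z * h ^ 3) {N : ℕ}
    (hN : h ^ 18 ≤ N + 1) :
    ∑ k ∈ Finset.Ico (N + 1) (n + 1), |z ^ k * ((n : ℝ) ^ k / n ! *
      ∑ R ∈ Finset.powersetCard k Finset.univ, permSum L R Finset.univ)| ≤ 1 / n := by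
  have hh0 : 0 < h := by linarith
  have hn0 : (0 : ℝ) < n := hn ▸ by positivity
  have hn1 : (1 : ℝ) ≤ n := by rw [← hn]; exact one_le_pow₀ h1
  set c := Real.exp 1 * ((1 - ρ)⁻¹) ^ 2 * Real.sqrt T with hc
  have hzN : z ^ (N + 1) ≤ Real.exp (Real.log z * h ^ 18) := by
    rw [← Real.exp_log (pow_pos hz (N + 1)), Real.exp_le_exp, Real.log_pow]
    push_cast
    have := Real.log_neg hz hz1
    nlinarith
  have hsq : Real.sqrt (n * ∑ i, ∑ j, L i j ^ 2) ≤ h ^ 15 * Real.sqrt T := by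
    calc _ ≤ Real.sqrt ((h ^ 15) ^ 2 * T) := by
          refine Real.sqrt_le_sqrt ?_
          rw [← pow_mul, hn]
          gcongr
      _ = _ := by rw [Real.sqrt_mul (by positivity), Real.sqrt_sq (by positivity)]
  have hterm : ∀ k ∈ Finset.Ico (N + 1) (n + 1), |z ^ k * ((n : ℝ) ^ k / n ! *
      ∑ R ∈ Finset.powersetCard k Finset.univ, permSum L R Finset.univ)| ≤
      Real.exp (Real.log z * h ^ 18) *
        (Real.exp 1 * ((n : ℝ) + 1) ^ 2 * Real.exp (c * h ^ 15)) := by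
    intro k hk
    rw [Finset.mem_Ico] at hk
    rw [abs_mul, abs_of_pos (pow_pos hz k)]
    refine mul_le_mul ((pow_le_pow_of_le_one hz.le hz1.le hk.1).trans hzN)
      ((abs_sum_permSum_le hρ hρ1 hL hrow hcol (Fintype.card_fin n) (by omega)).trans ?_)
      (abs_nonneg _) (Real.exp_nonneg _)
    refine mul_le_mul_of_nonneg_left (Real.exp_le_exp.mpr ?_) (by positivity)
    calc _ ≤ Real.exp 1 * ((1 - ρ)⁻¹) ^ 2 * (h ^ 15 * Real.sqrt T) := by gcongr
      _ = c * h ^ 15 := by rw [hc]; ring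
  rw [le_div_iff₀ hn0]
  have hexp : (n : ℝ) ^ 4 ≤ Real.exp (120 * h ^ 15) := by
    calc (n : ℝ) ^ 4 = h ^ 120 := by rw [← hn]; ring
      _ ≤ (Real.exp h) ^ 120 := by
          gcongr
          linarith [Real.add_one_le_exp h]
      _ = Real.exp (120 * h) := by rw [← Real.exp_nat_mul]; norm_num
      _ ≤ _ := by
          gcongr
          exact le_self_pow₀ h1 (by norm_num)
  have h4 : (4 : ℝ) ≤ Real.exp 2 := by
    have h5 := Real.add_one_le_exp (1 : ℝ)
    have h6 : Real.exp 2 = Real.exp 1 * Real.exp 1 := by rw [← Real.exp_add]; norm_num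
    rw [h6]
    nlinarith
  calc _ ≤ (∑ k ∈ Finset.Ico (N + 1) (n + 1), Real.exp (Real.log z * h ^ 18) *
        (Real.exp 1 * ((n : ℝ) + 1) ^ 2 * Real.exp (c * h ^ 15))) * (n : ℝ) := by
        gcongr with k hk
        exact hterm k hk
    _ ≤ ((n : ℝ) * (Real.exp (Real.log z * h ^ 18) *
        (Real.exp 1 * (2 * (n : ℝ)) ^ 2 * Real.exp (c * h ^ 15)))) * (n : ℝ) := by
        rw [Finset.sum_const, Nat.card_Ico, nsmul_eq_mul]
        gcongr
        · omega
        · linarith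
    _ = 4 * Real.exp 1 * (n : ℝ) ^ 4 * (Real.exp (c * h ^ 15) * Real.exp (Real.log z * h ^ 18)) := by
        ring
    _ ≤ Real.exp 2 * Real.exp 1 * Real.exp (120 * h ^ 15) *
          (Real.exp (c * h ^ 15) * Real.exp (Real.log z * h ^ 18)) := by gcongr
    _ = Real.exp (2 + 1 + 120 * h ^ 15 + (c * h ^ 15 + Real.log z * h ^ 18)) := by
        rw [Real.exp_add, Real.exp_add, Real.exp_add, Real.exp_add]
    _ ≤ 1 := by
        rw [Real.exp_le_one_iff]
        have h15 : 1 ≤ h ^ 15 := one_le_pow₀ h1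
        have h7 := mul_le_mul_of_nonneg_right hh (by positivity : 0 ≤ h ^ 15)
        have e : -Real.log z * h ^ 3 * h ^ 15 = -(Real.log z * h ^ 18) := by ring
        rw [e] at h7
        linarith

/-- The normalized permanent of `n (J + z L)` differs from the determinantal series by `O(1 / n)`,
uniformly in `L`. -/
lemma exists_abs_permanent_sub_detSeries_le {c T M : ℝ} (hρ : 0 < ρ) (hρ1 : ρ < 1) (hz : 0 < z)
    (hz1 : z < 1) (hc : 0 ≤ c) (hm : 0 < m) :
    ∃ H C : ℝ, ∀ (n : ℕ) (h : ℝ), h ^ 30 = n → H ≤ h → ∀ L : Matrix (Fin n) (Fin n) ℝ,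
      NormLE L ρ → NormLE Lᵀ ρ → (∀ i, ∑ j, L i j = 0) → (∀ j, ∑ i, L i j = 0) →
      (∀ i j, |L i j| ≤ c * h / n) → ∑ i, ∑ j, L i j ^ 2 ≤ T → T ≤ m * ρ ^ 2 →
      ∑ i, ∑ j, |L i j| ^ 3 ≤ M / n → ∑ i, ∑ j, L i j ^ 4 ≤ M / n ^ 2 →
      ∑ i, ∑ j, L i j ^ 6 ≤ M / n ^ 4 →
      |((n : ℝ) • (J n + z • L)).permanent / (n ! : ℝ) - detSeries L z| ≤ C / n := by
  set S := seriesBound ρ m with hS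
  obtain ⟨a, ha⟩ : ∃ a : ℝ, a = (1 - ρ)⁻¹ := ⟨_, rfl⟩
  obtain ⟨Q, hQ⟩ : ∃ Q : ℝ, Q = 2 * (c + (1 - ρ)⁻¹ * c ^ 2) * Real.exp 8 := ⟨_, rfl⟩
  set c' := 123 + Real.exp 1 * ((1 - ρ)⁻¹) ^ 2 * Real.sqrt T with hc'
  have hlog : 0 < -Real.log z := neg_pos.mpr (Real.log_neg hz hz1)
  have h1z : 0 < 1 - z := by linarith
  set C₁ := S * (24 * a ^ 2 * M + (36 * ((8 + 64 * a ^ 3) * M) + 78 * (8 * a ^ 3 * M)) + levelConst)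
    with hC₁
  refine ⟨2 + |2 * Q| + Q ^ 4 + (1 - z)⁻¹ + c' / (-Real.log z), C₁ + S + S + 1,
    fun n h hn hH L hL hL' hrow hcol hmax hT hTm hM3 hM4 hM6 => ?_⟩
  have hc'0 : 0 ≤ c' := by positivity
  have p1 : 0 ≤ |2 * Q| := abs_nonneg _
  have p2 : 0 ≤ Q ^ 4 := by positivity
  have p3 : 0 ≤ (1 - z)⁻¹ := by positivity
  have p4 : 0 ≤ c' / (-Real.log z) := by positivity
  have h2 : 2 ≤ h := by linarith
  have h1 : 1 ≤ h := by linarith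
  have h0 : 0 < h := by linarith
  have hle : ∀ j : ℕ, j ≠ 0 → h ≤ h ^ j := fun j hj => le_self_pow₀ h1 hj
  have hQ1 : 2 * Q ≤ h ^ 2 := by linarith [le_abs_self (2 * Q), hle 2 (by norm_num)]
  have hQ2 : Q ^ 4 ≤ h ^ 2 := by linarith [hle 2 (by norm_num)]
  have hlogh : c' ≤ -Real.log z * h ^ 3 := by
    have h3 : c' / (-Real.log z) ≤ h ^ 3 := by linarith [hle 3 (by norm_num)]
    rw [div_le_iff₀ hlog] at h3
    linarith
  have hn0 : (0 : ℝ) < n := hn ▸ by positivity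
  have hn0' : 0 < n := by exact_mod_cast hn0
  set N := ⌊h ^ 18⌋₊ with hN
  have hN1 : (N : ℝ) ≤ h ^ 18 := Nat.floor_le (by positivity)
  have hN2 : h ^ 18 ≤ N + 1 := (Nat.lt_floor_add_one _).le
  have hNz : h ^ 18 ≤ (1 - z) * n := by
    have h3 : (1 - z)⁻¹ ≤ h ^ 12 := by linarith [hle 12 (by norm_num)]
    rw [inv_le_iff_one_le_mul₀ h1z] at h3
    calc h ^ 18 = h ^ 18 * 1 := by ring
      _ ≤ h ^ 18 * (h ^ 12 * (1 - z)) := by gcongr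
      _ = (1 - z) * h ^ 30 := by ring
      _ = _ := by rw [hn]
  have hNn : N < n := by
    have h3 : (N : ℝ) < n := by nlinarith
    exact_mod_cast h3
  have hT' : ∑ i, ∑ j, L i j ^ 2 ≤ m * ρ ^ 2 := hT.trans hTm
  have hw := summable_detCoeff_weight hρ hρ1 hm hL hL' hT'
  have hwS : ∑ k ∈ Finset.range (N + 1), ((k : ℝ) + 1) ^ 2 * detCoeff (bip L) k ≤ S :=
    (hw.sum_le_tsum _ fun k _ => mul_nonneg (by positivity) (detCoeff_bip_nonneg L k)).trans
      (tsum_detCoeff_weight_le hρ hρ1 hm hL hL' hT')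
  have hdS : ∑ k ∈ Finset.range (N + 1), |detCoeff (bip L) k| ≤ S := by
    refine le_trans (Finset.sum_le_sum fun k _ => ?_) hwS
    rw [abs_of_nonneg (detCoeff_bip_nonneg L k)]
    exact le_mul_of_one_le_left (detCoeff_bip_nonneg L k)
      (one_le_pow₀ (by linarith [(Nat.cast_nonneg k : (0 : ℝ) ≤ k)]))
  have hS0 : 0 ≤ S := le_trans (Finset.sum_nonneg fun _ _ => abs_nonneg _) hdS
  have hscale : ∀ k ∈ Finset.range (N + 1), fallScale n k * z ^ k ≤ 1 := fun k hk => by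
    have hkN : k ≤ N := Nat.lt_succ_iff.mp (Finset.mem_range.mp hk)
    refine fallScale_mul_pow_le hz.le (by omega) ?_
    exact ((Nat.cast_le.mpr hkN).trans hN1).trans hNz
  have hlow := sum_abs_subPermSum_sub_detCoeff_le hn h2 hc hρ.le hρ1 hL hL' hrow hcol hmax hQ hQ1
    hQ2 hM3 hM4 hM6 hN1 hdS ha
  -- the coefficients of low order
  have e1 : |∑ k ∈ Finset.range (N + 1), z ^ k * (fallScale n k * subPermSum L k) -
      ∑ k ∈ Finset.range (N + 1), detCoeff (bip L) k * z ^ k| ≤ C₁ / n + S / n := by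
    rw [← Finset.sum_sub_distrib]
    refine (Finset.abs_sum_le_sum_abs _ _).trans ?_
    calc _ ≤ ∑ k ∈ Finset.range (N + 1), (|subPermSum L k - detCoeff (bip L) k| +
          ((k : ℝ) + 1) ^ 2 * detCoeff (bip L) k / n) := by
          refine Finset.sum_le_sum fun k hk => ?_
          have hkN : k ≤ n := by rw [Finset.mem_range] at hk; omega
          have hd := detCoeff_bip_nonneg L k
          have hk0 : (0 : ℝ) ≤ k := Nat.cast_nonneg k
          have hzk : 0 ≤ z ^ k := by positivity
          have e : z ^ k * (fallScale n k * subPermSum L k) - detCoeff (bip L) k * z ^ k =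
              fallScale n k * z ^ k * (subPermSum L k - detCoeff (bip L) k) +
              (fallScale n k - 1) * z ^ k * detCoeff (bip L) k := by ring
          rw [e]
          refine (abs_add_le _ _).trans (add_le_add ?_ ?_)
          · rw [abs_mul, abs_of_nonneg (mul_nonneg (fallScale_nonneg n k) hzk)]
            exact mul_le_of_le_one_left (abs_nonneg _) (hscale k hk)
          · rw [abs_of_nonneg (mul_nonneg (mul_nonneg (by linarith [one_le_fallScale hkN]) hzk) hd)]
            calc (fallScale n k - 1) * z ^ k * detCoeff (bip L) k
                ≤ fallScale n k * ((k : ℝ) ^ 2 / n) * z ^ k * detCoeff (bip L) k := by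
                  gcongr
                  exact fallScale_sub_one_le hkN
              _ = (fallScale n k * z ^ k) * ((k : ℝ) ^ 2 / n * detCoeff (bip L) k) := by ring
              _ ≤ 1 * (((k : ℝ) + 1) ^ 2 / n * detCoeff (bip L) k) := by
                  gcongr
                  · exact hscale k hk
                  · linarith
              _ = _ := by ring
      _ ≤ C₁ / n + S / n := by
          rw [Finset.sum_add_distrib, ← Finset.sum_div]
          gcongr
  have e2 := abs_sum_range_sub_detSeries_le hρ hρ1 hm hL hL' hT' hz.le hz1.le N
  have e3 : S / ((N : ℝ) + 1) ^ 2 ≤ S / n := by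
    gcongr
    calc (n : ℝ) = h ^ 30 := hn.symm
      _ ≤ h ^ 36 := pow_le_pow_right₀ h1 (by norm_num)
      _ = (h ^ 18) ^ 2 := by ring
      _ ≤ _ := by gcongr
  have e4 := sum_Ico_abs_le hn h1 hρ.le hρ1 hL hrow hcol hT hz hz1 hlogh hN2
  rw [permanent_div_factorial_eq hn0' L z, ← Finset.sum_range_add_sum_Ico _
    (show N + 1 ≤ n + 1 by omega)]
  have e5 := (Finset.abs_sum_le_sum_abs (fun k => z ^ k * ((n : ℝ) ^ k / n ! *
      ∑ R ∈ Finset.powersetCard k Finset.univ, permSum L R Finset.univ))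
      (Finset.Ico (N + 1) (n + 1))).trans e4
  simp_rw [fallScale_mul_subPermSum] at e5 ⊢
  set p := ∑ k ∈ Finset.range (N + 1), z ^ k * (fallScale n k * subPermSum L k)
  set q := ∑ k ∈ Finset.Ico (N + 1) (n + 1), z ^ k * (fallScale n k * subPermSum L k)
  set r := ∑ k ∈ Finset.range (N + 1), detCoeff (bip L) k * z ^ k
  have e6 : p + q - detSeries L z = (p - r) + (r - detSeries L z) + q := by ring
  rw [e6]
  calc _ ≤ |p - r| + |r - detSeries L z| + |q| :=
        (abs_add_le _ _).trans (add_le_add_left (abs_add_le _ _) _)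
    _ ≤ (C₁ / n + S / n) + S / n + 1 / n := by
        gcongr
        exact e2.trans e3
    _ = _ := by ring

end Comparison

/-! ### Doubly stochastic matrices -/

section DoublyStochastic

variable {ι : Type*} [Fintype ι] [DecidableEq ι]

omit [DecidableEq ι] in
lemma NormLE.transpose {B : Matrix ι ι ℝ} {ρ : ℝ} (h : NormLE B ρ) : NormLE Bᵀ ρ := by
  intro x
  set y := Bᵀ *ᵥ x with hy
  have h1 : y ⬝ᵥ y = x ⬝ᵥ (B *ᵥ y) := by
    rw [Matrix.dotProduct_mulVec x B y, hy, Matrix.mulVec_transpose]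
  have h2 := dotProduct_sq_le x (B *ᵥ y)
  rw [← h1] at h2
  have h3 := h y
  have hx := dotProduct_self_nonneg' x
  have hy0 := dotProduct_self_nonneg' y
  rcases hy0.eq_or_lt with h4 | h4
  · rw [← h4]
    positivity
  · have h5 : (y ⬝ᵥ y) * (y ⬝ᵥ y) ≤ (ρ ^ 2 * (x ⬝ᵥ x)) * (y ⬝ᵥ y) := by
      calc _ = (y ⬝ᵥ y) ^ 2 := by ring
        _ ≤ (x ⬝ᵥ x) * (ρ ^ 2 * (y ⬝ᵥ y)) := h2.trans (mul_le_mul_of_nonneg_left h3 hx)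
        _ = _ := by ring
    exact le_of_mul_le_mul_right h5 h4

lemma normLE_of_norm_toEuclideanCLM_le {B : Matrix ι ι ℝ} {ρ : ℝ}
    (h : ‖Matrix.toEuclideanCLM (n := ι) (𝕜 := ℝ) B‖ ≤ ρ) : NormLE B ρ := by
  intro x
  have h1 := (Matrix.toEuclideanCLM (n := ι) (𝕜 := ℝ) B).le_of_opNorm_le h (WithLp.toLp 2 x)
  have h2 := pow_le_pow_left₀ (norm_nonneg _) h1 2
  rw [mul_pow, EuclideanSpace.real_norm_sq_eq, EuclideanSpace.real_norm_sq_eq,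
    Matrix.toEuclideanCLM_toLp] at h2
  simpa [dotProduct, sq] using h2

omit [DecidableEq ι] in
lemma NormLE.smul {B : Matrix ι ι ℝ} {ρ : ℝ} (h : NormLE B ρ) (c : ℝ) : NormLE (c • B) (c * ρ) := by
  intro x
  rw [Matrix.smul_mulVec, smul_dotProduct, dotProduct_smul, smul_eq_mul, smul_eq_mul, mul_pow]
  have := mul_le_mul_of_nonneg_left (h x) (sq_nonneg c)
  linarith

/-- The permanent of a doubly stochastic matrix is positive, by Birkhoff's theorem. -/
lemma permanent_pos_of_mem_doublyStochastic {A : Matrix ι ι ℝ} (hA : A ∈ doublyStochastic ℝ ι) :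
    0 < A.permanent := by
  have h0 := (mem_doublyStochastic_iff_sum.mp hA).1
  obtain ⟨w, hw0, hw1, hw⟩ := exists_eq_sum_perm_of_mem_doublyStochastic hA
  obtain ⟨σ, hσ⟩ : ∃ σ, 0 < w σ := by
    by_contra! h
    have := Finset.sum_nonpos fun σ (_ : σ ∈ Finset.univ) => h σ
    linarith
  have hentry : ∀ i, 0 < A i (σ i) := fun i => by
    rw [← hw, Matrix.sum_apply]
    refine Finset.sum_pos' (fun τ _ => ?_) ⟨σ, Finset.mem_univ _, ?_⟩
    · rw [Matrix.smul_apply, Equiv.Perm.permMatrix, PEquiv.toMatrix_apply]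
      refine mul_nonneg (hw0 τ) ?_
      split_ifs <;> norm_num
    · simpa [Equiv.Perm.permMatrix, PEquiv.toMatrix_apply] using hσ
  rw [← Matrix.permanent_transpose, Matrix.permanent]
  exact Finset.sum_pos' (fun τ _ => Finset.prod_nonneg fun i _ => h0 _ _)
    ⟨σ, Finset.mem_univ _, Finset.prod_pos fun i _ => hentry i⟩

variable {n : ℕ} {A : Matrix (Fin n) (Fin n) ℝ}

lemma permanent_smul_pos (hA : A ∈ doublyStochastic ℝ (Fin n)) :
    0 < ((n : ℝ) • A).permanent := by
  rw [Matrix.permanent_smul, Fintype.card_fin]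
  refine mul_pos ?_ (permanent_pos_of_mem_doublyStochastic hA)
  rcases Nat.eq_zero_or_pos n with rfl | hn
  · norm_num
  · positivity

lemma sum_row_sub_J (hA : A ∈ doublyStochastic ℝ (Fin n)) (i : Fin n) :
    ∑ j, (A - J n) i j = 0 := by
  have hn : (n : ℝ) ≠ 0 := Nat.cast_ne_zero.mpr (Fin.pos i).ne'
  simp [J, Finset.sum_sub_distrib, (mem_doublyStochastic_iff_sum.mp hA).2.1 i, hn]

lemma sum_col_sub_J (hA : A ∈ doublyStochastic ℝ (Fin n)) (j : Fin n) :
    ∑ i, (A - J n) i j = 0 := by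
  have hn : (n : ℝ) ≠ 0 := Nat.cast_ne_zero.mpr (Fin.pos j).ne'
  simp [J, Finset.sum_sub_distrib, (mem_doublyStochastic_iff_sum.mp hA).2.2 j, hn]

/-- Since `A - J` annihilates constant vectors, `A'A` is the sum of `J` and `(A - J)'(A - J)`. -/
lemma detMatrix_eq (hA : A ∈ doublyStochastic ℝ (Fin n)) (s : ℝ) :
    detMatrix s A = 1 - s • ((A - J n)ᵀ * (A - J n)) := by
  have h : (A - J n)ᵀ * (A - J n) = Aᵀ * A - J n := by
    ext i j
    have hn : (n : ℝ) ≠ 0 := Nat.cast_ne_zero.mpr (Fin.pos i).ne'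
    have h1 := (mem_doublyStochastic_iff_sum.mp hA).2.2
    simp only [Matrix.mul_apply, Matrix.transpose_apply, Matrix.sub_apply, J, Matrix.of_apply,
      sub_mul, mul_sub, Finset.sum_sub_distrib]
    rw [← Finset.sum_mul, ← Finset.mul_sum, h1, h1]
    simp [hn]
  rw [detMatrix, h, smul_sub]
  abel

lemma one_add_J_sub_eq (A : Matrix (Fin n) (Fin n) ℝ) : 1 + J n - Aᵀ * A = detMatrix 1 A := by
  simp [detMatrix]

/-- The determinants `det (1 - s • Kᵀ * K)` in terms of the squared singular values of `K`. -/
lemma exists_det_one_sub_smul_eq_prod {K : Matrix ι ι ℝ} {ρ : ℝ} (hK : NormLE K ρ) :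
    ∃ μ : ι → ℝ, (∀ a, 0 ≤ μ a) ∧ (∀ a, μ a ≤ ρ ^ 2) ∧ ∑ a, μ a = ∑ i, ∑ j, K i j ^ 2 ∧
      ∀ s : ℝ, (1 - s • (Kᵀ * K)).det = ∏ a, (1 - s * μ a) := by
  obtain ⟨U, μ, -, hU', hB⟩ := exists_orthogonal_diagonalization (B := Kᵀ * K)
    (by rw [Matrix.IsSymm, Matrix.transpose_mul, Matrix.transpose_transpose])
  have hgram : (K * U)ᵀ * (K * U) = Matrix.diagonal μ := by
    calc (K * U)ᵀ * (K * U) = Uᵀ * (Kᵀ * K) * U := by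
          rw [Matrix.transpose_mul]; simp only [Matrix.mul_assoc]
      _ = (Uᵀ * U) * Matrix.diagonal μ * (Uᵀ * U) := by
          rw [hB]; simp only [Matrix.mul_assoc]
      _ = _ := by rw [hU', one_mul, mul_one]
  have hμ : ∀ a, (K *ᵥ fun j => U j a) ⬝ᵥ (K *ᵥ fun j => U j a) = μ a := fun a => by
    have h1 := congrFun (congrFun hgram a) a
    rw [Matrix.diagonal_apply_eq, Matrix.mul_apply] at h1
    exact h1
  have hU1 : ∀ a, (fun j => U j a) ⬝ᵥ (fun j => U j a) = 1 := fun a => by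
    have h1 := congrFun (congrFun hU' a) a
    rw [Matrix.one_apply_eq, Matrix.mul_apply] at h1
    exact h1
  refine ⟨μ, fun a => hμ a ▸ dotProduct_self_nonneg' _, fun a => ?_, ?_, fun s => ?_⟩
  · have h1 := hK fun j => U j a
    rwa [hμ, hU1, mul_one] at h1
  · have h1 := trace_pow_eq_sum hU' hB 1
    simp only [pow_one] at h1
    rw [← h1, Matrix.trace, Finset.sum_comm]
    simp [Matrix.mul_apply, sq]
  · have h1 := det_one_add_smul_eq_prod hU' hB (-s)
    simpa [sub_eq_add_neg] using h1

lemma det_one_sub_smul_pos {K : Matrix ι ι ℝ} {ρ s : ℝ} (hK : NormLE K ρ) (hs : 0 ≤ s)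
    (hsρ : s * ρ ^ 2 < 1) : 0 < (1 - s • (Kᵀ * K)).det := by
  obtain ⟨μ, -, hμρ, -, hdet⟩ := exists_det_one_sub_smul_eq_prod hK
  rw [hdet]
  refine Finset.prod_pos fun a _ => ?_
  have := mul_le_mul_of_nonneg_left (hμρ a) hs
  linarith

/-- Changing the factor `1` to `s` changes the logarithm of the determinant by `O(s - 1)`. -/
lemma abs_log_det_sub_log_det_le {K : Matrix ι ι ℝ} {ρ s r : ℝ} (hK : NormLE K ρ) (hs : 1 ≤ s)
    (hsr : s * ρ ^ 2 ≤ r) (hr : r < 1) :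
    |Real.log (1 - (1 : ℝ) • (Kᵀ * K)).det - Real.log (1 - s • (Kᵀ * K)).det| ≤
      (s - 1) * (1 - r)⁻¹ * ∑ i, ∑ j, K i j ^ 2 := by
  obtain ⟨μ, hμ0, hμρ, hsum, hdet⟩ := exists_det_one_sub_smul_eq_prod hK
  have hsμ : ∀ a, s * μ a ≤ r := fun a =>
    (mul_le_mul_of_nonneg_left (hμρ a) (by linarith)).trans hsr
  have hμs : ∀ a, μ a ≤ s * μ a := fun a => le_mul_of_one_le_left (hμ0 a) hs
  have p1 : ∀ a, 0 < 1 - 1 * μ a := fun a => by linarith [hsμ a, hμs a]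
  have p2 : ∀ a, 0 < 1 - s * μ a := fun a => by linarith [hsμ a]
  rw [hdet, hdet, Real.log_prod fun a _ => (p1 a).ne', Real.log_prod fun a _ => (p2 a).ne',
    ← Finset.sum_sub_distrib, ← hsum, Finset.mul_sum]
  refine (Finset.abs_sum_le_sum_abs _ _).trans (Finset.sum_le_sum fun a _ => ?_)
  rw [abs_of_nonneg (sub_nonneg.mpr (Real.log_le_log (p2 a) (by linarith [hμs a]))),
    ← Real.log_div (p1 a).ne' (p2 a).ne']
  have h1 : (1 - s * μ a)⁻¹ ≤ (1 - r)⁻¹ := inv_anti₀ (by linarith) (by linarith [hsμ a])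
  have h2 : 0 ≤ (s - 1) * μ a := mul_nonneg (by linarith) (hμ0 a)
  calc _ ≤ (1 - 1 * μ a) / (1 - s * μ a) - 1 := Real.log_le_sub_one_of_pos (div_pos (p1 a) (p2 a))
    _ = (s - 1) * μ a * (1 - s * μ a)⁻¹ := by
        rw [← div_eq_mul_inv, div_sub_one (p2 a).ne']
        congr 1
        ring
    _ ≤ (s - 1) * μ a * (1 - r)⁻¹ := by gcongr
    _ = _ := by ring

/-- The logarithm is Lipschitz on `[1/2, ∞)`. -/
lemma abs_log_sub_log_le {x y d : ℝ} (hy : 1 ≤ y) (hxy : |x - y| ≤ d) (hd : d ≤ 1 / 2) :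
    |Real.log x - Real.log y| ≤ 2 * d := by
  have hd0 : 0 ≤ d := (abs_nonneg _).trans hxy
  rw [abs_le] at hxy
  have hx : 1 / 2 ≤ x := by linarith
  have hx0 : 0 < x := by linarith
  have hy0 : 0 < y := by linarith
  rw [abs_le]
  constructor
  · have h1 := Real.log_le_sub_one_of_pos (div_pos hy0 hx0)
    rw [Real.log_div hy0.ne' hx0.ne'] at h1
    have h2 : y / x - 1 ≤ 2 * d := by
      rw [sub_le_iff_le_add, div_le_iff₀ hx0]
      nlinarith
    linarith
  · have h1 := Real.log_le_sub_one_of_pos (div_pos hx0 hy0)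
    rw [Real.log_div hx0.ne' hy0.ne'] at h1
    have h2 : x / y - 1 ≤ 2 * d := by
      rw [sub_le_iff_le_add, div_le_iff₀ hy0]
      nlinarith
    linarith

end DoublyStochastic

/-! ### Sequences of moderate deviation -/

section Moderate

variable {A : ∀ n : ℕ, Matrix (Fin n) (Fin n) ℝ}

lemma WeaklyBounded.exists_eventually_le {X : ∀ n : ℕ, Matrix (Fin n) (Fin n) ℝ}
    (hX : WeaklyBounded X) {p : ℝ} (hp : 1 ≤ p) :
    ∃ M : ℝ, ∀ᶠ n in atTop, absMoment p (X n) ≤ M := by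
  obtain ⟨M, hM, -⟩ := EReal.lt_iff_exists_real_btwn.mp (hX p hp)
  refine ⟨M, (eventually_lt_of_limsup_lt hM).mono fun n hn => ?_⟩
  exact (EReal.coe_lt_coe_iff.mp hn).le

/-- A bound for a moment of `n K` in terms of the entries of `K`. -/
lemma sum_abs_pow_le_of_absMoment_le {n p : ℕ} (hn : 0 < n) {K : Matrix (Fin n) (Fin n) ℝ} {M : ℝ}
    (h : absMoment p ((n : ℝ) • K) ≤ M) :
    (n : ℝ) ^ p * ∑ i, ∑ j, |K i j| ^ p ≤ M * n ^ 2 := by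
  have hn0 : (0 : ℝ) < n := by exact_mod_cast hn
  rw [absMoment, one_div, inv_mul_le_iff₀ (by positivity)] at h
  calc _ = ∑ i, ∑ j, |((n : ℝ) • K) i j| ^ (p : ℝ) := by
        simp_rw [Finset.mul_sum, Real.rpow_natCast, Matrix.smul_apply, smul_eq_mul, abs_mul, mul_pow,
          abs_of_pos hn0]
    _ ≤ _ := h.trans_eq (mul_comm _ _)

/-- The entries of `n K` are at most of order `h`, where `h ^ 30 = n`, if the moment of order `60`
is bounded. -/
lemma abs_apply_le_of_moment_le {n : ℕ} {h M : ℝ} (hn : h ^ 30 = n) (h0 : 0 < h) (hM : 1 ≤ M)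
    {K : Matrix (Fin n) (Fin n) ℝ}
    (hK : (n : ℝ) ^ 60 * ∑ i, ∑ j, |K i j| ^ 60 ≤ M * n ^ 2) (i j : Fin n) :
    |K i j| ≤ M * h / n := by
  have hn0 : (0 : ℝ) < n := hn ▸ by positivity
  have h1 : |K i j| ^ 60 ≤ ∑ i, ∑ j, |K i j| ^ 60 :=
    (Finset.single_le_sum (f := fun j => |K i j| ^ 60) (fun _ _ => by positivity)
      (Finset.mem_univ j)).trans
      (Finset.single_le_sum (f := fun i => ∑ j, |K i j| ^ 60)
        (fun _ _ => Finset.sum_nonneg fun _ _ => by positivity) (Finset.mem_univ i))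
  rw [le_div_iff₀ hn0]
  refine le_of_pow_le_pow_left₀ (n := 60) (by norm_num) (by positivity) ?_
  calc (|K i j| * n) ^ 60 = (n : ℝ) ^ 60 * |K i j| ^ 60 := by ring
    _ ≤ (n : ℝ) ^ 60 * ∑ i, ∑ j, |K i j| ^ 60 := by gcongr
    _ ≤ M * n ^ 2 := hK
    _ ≤ M ^ 60 * n ^ 2 := by
        gcongr
        exact le_self_pow₀ hM (by norm_num)
    _ = (M * h) ^ 60 := by rw [← hn]; ring

/-- The data extracted from a sequence of moderate deviation. -/
lemma ModerateDeviation.exists_bounds (hA : ModerateDeviation A) :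
    ∃ ρ M : ℝ, 1 / 2 ≤ ρ ∧ ρ < 1 ∧ 1 ≤ M ∧ (∀ n, NormLE (A n - J n) ρ) ∧
      ∀ᶠ n : ℕ in atTop, ∀ p ∈ ({2, 3, 4, 6, 60} : Finset ℕ),
        (n : ℝ) ^ p * ∑ i, ∑ j, |(A n - J n) i j| ^ p ≤ M * n ^ 2 := by
  obtain ⟨C, hC, hgap⟩ := hA.gap_bounded_below
  have hex : ∀ p : ℕ, ∃ M : ℝ, 1 ≤ p → ∀ᶠ n : ℕ in atTop,
      (n : ℝ) ^ p * ∑ i, ∑ j, |(A n - J n) i j| ^ p ≤ M * n ^ 2 := by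
    intro p
    by_cases hp : 1 ≤ p
    · obtain ⟨M, hM⟩ := hA.weaklyBounded.exists_eventually_le (p := p) (by exact_mod_cast hp)
      refine ⟨M, fun _ => ?_⟩
      filter_upwards [hM, eventually_gt_atTop 0] with n h1 h2
      exact sum_abs_pow_le_of_absMoment_le h2 h1
    · exact ⟨0, fun h => absurd h hp⟩
  choose M hM using hex
  refine ⟨max (1 - C) (1 / 2), 1 + ∑ p ∈ ({2, 3, 4, 6, 60} : Finset ℕ), |M p|, le_max_right _ _,
    max_lt (by linarith) (by norm_num),
    le_add_of_nonneg_right (Finset.sum_nonneg fun _ _ => abs_nonneg _), fun n => ?_, ?_⟩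
  · refine normLE_of_norm_toEuclideanCLM_le (le_max_of_le_left ?_)
    have := hgap n
    rw [gap] at this
    linarith
  · rw [eventually_all_finset]
    intro p hp
    have hp1 : 1 ≤ p := by
      simp only [Finset.mem_insert, Finset.mem_singleton] at hp
      omega
    filter_upwards [hM p hp1] with n hn
    refine hn.trans ?_
    gcongr
    have := Finset.single_le_sum (f := fun p => |M p|) (fun _ _ => abs_nonneg _) hp
    linarith [le_abs_self (M p)]

/-- The determinantal approximation, before taking logarithms. -/
lemma ModerateDeviation.exists_approximation (hA : ModerateDeviation A) :
    ∃ (D : ℕ → ℝ) (C S : ℝ), ∀ᶠ n : ℕ in atTop,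
      |((n : ℝ) • A n).permanent / (n ! : ℝ) - D n| ≤ C / n ∧ 1 ≤ D n ∧ D n ≤ S ∧
        D n ^ 2 * (1 - (1 : ℝ) • ((A n - J n)ᵀ * (A n - J n))).det = 1 := by
  obtain ⟨ρ₀, M, hρ₀, hρ₀1, hM, hK, hmom⟩ := hA.exists_bounds
  -- the rescaling `K = z L` makes room for a geometric factor in front of the coefficients
  set z := (1 + ρ₀) / 2 with hz
  have hz0 : 0 < z := by linarith
  have hz1 : z < 1 := by linarith
  have hzinv : z⁻¹ ≤ 2 := by
    rw [inv_le_comm₀ hz0 (by norm_num)]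
    linarith
  have hzinv0 : 0 < z⁻¹ := inv_pos.mpr hz0
  have hzinv1 : 1 ≤ z⁻¹ := (one_le_inv₀ hz0).mpr hz1.le
  set ρ := z⁻¹ * ρ₀ with hρ
  have hρ0 : 0 < ρ := by positivity
  have hρ1 : ρ < 1 := by
    rw [hρ, inv_mul_lt_iff₀ hz0]
    linarith
  set m := 64 * M / ρ ^ 2 with hm
  have hm0 : 0 < m := by positivity
  have hTm : 64 * M ≤ m * ρ ^ 2 := by rw [hm, div_mul_cancel₀ _ (by positivity)]
  obtain ⟨H, C, hmain⟩ := exists_abs_permanent_sub_detSeries_le (c := 2 * M) (T := 64 * M)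
    (M := 64 * M) hρ0 hρ1 hz0 hz1 (by positivity) hm0
  refine ⟨fun n => detSeries (z⁻¹ • (A n - J n)) z, C, seriesBound ρ m, ?_⟩
  have htend : Tendsto (fun n : ℕ => (n : ℝ) ^ (1 / 30 : ℝ)) atTop atTop :=
    (tendsto_rpow_atTop (by norm_num)).comp tendsto_natCast_atTop_atTop
  filter_upwards [hmom, htend.eventually_ge_atTop H, eventually_gt_atTop 0] with n hn hH hpos
  have hn0 : (0 : ℝ) < n := by exact_mod_cast hpos
  set h := (n : ℝ) ^ (1 / 30 : ℝ) with hh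
  have hh0 : 0 < h := Real.rpow_pos_of_pos hn0 _
  have hh30 : h ^ 30 = n := by
    rw [hh, ← Real.rpow_natCast, ← Real.rpow_mul hn0.le]
    norm_num
  set K := A n - J n with hKdef
  set L := z⁻¹ • K with hLdef
  have hL : NormLE L ρ := (hK n).smul _
  have hLabs : ∀ i j, |L i j| = z⁻¹ * |K i j| := fun i j => by
    rw [hLdef, Matrix.smul_apply, smul_eq_mul, abs_mul, abs_of_pos hzinv0]
  have hLmom : ∀ p ∈ ({2, 3, 4, 6, 60} : Finset ℕ), p ≤ 6 →
      (n : ℝ) ^ p * ∑ i, ∑ j, |L i j| ^ p ≤ 64 * M * n ^ 2 := fun p hp hp6 => by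
    have h64 : (z⁻¹) ^ p ≤ 64 := by
      calc (z⁻¹) ^ p ≤ (z⁻¹) ^ 6 := pow_le_pow_right₀ hzinv1 hp6
        _ ≤ 2 ^ 6 := by gcongr
        _ = 64 := by norm_num
    calc _ = (z⁻¹) ^ p * ((n : ℝ) ^ p * ∑ i, ∑ j, |K i j| ^ p) := by
          simp_rw [hLabs, mul_pow, ← Finset.mul_sum]
          ring
      _ ≤ 64 * (M * n ^ 2) := mul_le_mul h64 (hn p hp) (by positivity) (by norm_num)
      _ = _ := by ring
  have hrow : ∀ i, ∑ j, L i j = 0 := fun i => by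
    have := sum_row_sub_J (hA.doublyStochastic n) i
    simp only [hLdef, Matrix.smul_apply, smul_eq_mul, ← Finset.mul_sum]
    rw [this, mul_zero]
  have hcol : ∀ j, ∑ i, L i j = 0 := fun j => by
    have := sum_col_sub_J (hA.doublyStochastic n) j
    simp only [hLdef, Matrix.smul_apply, smul_eq_mul, ← Finset.mul_sum]
    rw [this, mul_zero]
  have hmax : ∀ i j, |L i j| ≤ 2 * M * h / n := fun i j => by
    rw [hLabs]
    calc _ ≤ 2 * (M * h / n) := by
          gcongr
          exact abs_apply_le_of_moment_le hh30 hh0 hM (hn 60 (by simp)) i j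
      _ = _ := by ring
  have hT : ∑ i, ∑ j, L i j ^ 2 ≤ 64 * M := by
    have h2 := hLmom 2 (by simp) (by norm_num)
    simp only [sq_abs] at h2
    rw [mul_comm (64 * M)] at h2
    exact le_of_mul_le_mul_left h2 (by positivity)
  have hM3 : ∑ i, ∑ j, |L i j| ^ 3 ≤ 64 * M / n := by
    have h2 := hLmom 3 (by simp) (by norm_num)
    rw [le_div_iff₀ hn0]
    refine le_of_mul_le_mul_left ?_ (by positivity : (0 : ℝ) < n ^ 2)
    linarith
  have hM4 : ∑ i, ∑ j, L i j ^ 4 ≤ 64 * M / n ^ 2 := by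
    have h2 := hLmom 4 (by simp) (by norm_num)
    simp only [Even.pow_abs (show Even 4 by decide)] at h2
    rw [le_div_iff₀ (by positivity)]
    refine le_of_mul_le_mul_left ?_ (by positivity : (0 : ℝ) < n ^ 2)
    linarith
  have hM6 : ∑ i, ∑ j, L i j ^ 6 ≤ 64 * M / n ^ 4 := by
    have h2 := hLmom 6 (by simp) (by norm_num)
    simp only [Even.pow_abs (show Even 6 by decide)] at h2
    rw [le_div_iff₀ (by positivity)]
    refine le_of_mul_le_mul_left ?_ (by positivity : (0 : ℝ) < n ^ 2)
    linarith
  have hzL : z • L = K := by rw [hLdef, smul_smul, mul_inv_cancel₀ hz0.ne', one_smul]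
  have hT' := hT.trans hTm
  refine ⟨?_, one_le_detSeries hρ0 hρ1 hm0 hL hL.transpose hT' hz0.le hz1.le,
    detSeries_le hρ0 hρ1 hm0 hL hL.transpose hT' hz0.le hz1.le, ?_⟩
  · have h2 := hmain n h hh30 hH L hL hL.transpose hrow hcol hmax hT hTm hM3 hM4 hM6
    rwa [hzL, hKdef, add_sub_cancel] at h2
  · have h2 := detSeries_sq_mul_det hρ0 hρ1 hm0 hL hL.transpose hT' hz0.le hz1.le
    have e : (1 : ℝ) • (Kᵀ * K) = z ^ 2 • (Lᵀ * L) := by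
      rw [one_smul, ← hzL, Matrix.transpose_smul, Matrix.smul_mul, Matrix.mul_smul, smul_smul, sq]
    rw [e]
    exact h2

/-- The determinants in the two approximations are positive, and their logarithms differ by
`O(1 / n)`. -/
lemma ModerateDeviation.exists_abs_log_det_sub_le (hA : ModerateDeviation A) :
    ∃ C : ℝ, ∀ᶠ n : ℕ in atTop, 0 < (detMatrix ((n : ℝ) / ((n : ℝ) - 1)) (A n)).det ∧
      |Real.log (detMatrix 1 (A n)).det -
        Real.log (detMatrix ((n : ℝ) / ((n : ℝ) - 1)) (A n)).det| ≤ C / n := by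
  obtain ⟨ρ, M, hρ, hρ1, hM, hK, hmom⟩ := hA.exists_bounds
  have hρ2 : ρ ^ 2 < 1 := by nlinarith
  set r := (1 + ρ ^ 2) / 2 with hr
  have hr1 : r < 1 := by linarith
  refine ⟨2 * (1 - r)⁻¹ * M, ?_⟩
  filter_upwards [hmom, eventually_ge_atTop 2,
    tendsto_natCast_atTop_atTop.eventually_ge_atTop (2 * (1 - r)⁻¹)] with n hn hn2 hnr
  have hn2' : (2 : ℝ) ≤ n := by exact_mod_cast hn2
  have hn1 : (0 : ℝ) < (n : ℝ) - 1 := by linarith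
  have hn0 : (0 : ℝ) < n := by linarith
  have h1r : 0 < 1 - r := by linarith
  set s := (n : ℝ) / ((n : ℝ) - 1) with hs
  have hs1 : s - 1 = 1 / ((n : ℝ) - 1) := by
    rw [hs]
    field_simp
    ring
  have hs1' : 0 < s - 1 := by rw [hs1]; positivity
  have hs2 : s - 1 ≤ 2 / n := by
    rw [hs1, div_le_div_iff₀ hn1 hn0]
    linarith
  have hs3 : s - 1 ≤ 1 - r := by
    refine hs2.trans ?_
    rw [← div_eq_mul_inv, div_le_iff₀ h1r] at hnr
    rw [div_le_iff₀ hn0]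
    linarith
  have hsr : s * ρ ^ 2 ≤ r := by
    have h3 : (s - 1) * ρ ^ 2 ≤ 1 - r := by nlinarith [sq_nonneg ρ]
    have h4 : 1 - r = r - ρ ^ 2 := by rw [hr]; ring
    linarith
  have hT : ∑ i, ∑ j, (A n - J n) i j ^ 2 ≤ M := by
    have h2 := hn 2 (by simp)
    simp only [sq_abs] at h2
    rw [mul_comm M] at h2
    exact le_of_mul_le_mul_left h2 (by positivity)
  rw [detMatrix_eq (hA.doublyStochastic n), detMatrix_eq (hA.doublyStochastic n)]
  refine ⟨det_one_sub_smul_pos (hK n) (by linarith) (hsr.trans_lt hr1), ?_⟩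
  calc _ ≤ (s - 1) * (1 - r)⁻¹ * ∑ i, ∑ j, (A n - J n) i j ^ 2 :=
        abs_log_det_sub_log_det_le (hK n) (by linarith) hsr hr1
    _ ≤ 2 / n * (1 - r)⁻¹ * M := by
        gcongr
    _ = _ := by ring

/-- The determinantal approximation with an explicit error bound. -/
lemma ModerateDeviation.exists_abs_log_permanent_sub_le (hA : ModerateDeviation A) :
    ∃ C : ℝ, ∀ᶠ n : ℕ in atTop, |Real.log ((n : ℝ) • A n).permanent -
      (Real.log (n ! : ℝ) - 1 / 2 * Real.log (detMatrix 1 (A n)).det)| ≤ C / n := by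
  obtain ⟨D, C, S, h⟩ := hA.exists_approximation
  refine ⟨2 * C, ?_⟩
  filter_upwards [h, eventually_gt_atTop 0,
    tendsto_natCast_atTop_atTop.eventually_ge_atTop (2 * C)] with n hn hpos hnC
  obtain ⟨h1, h2, -, h4⟩ := hn
  have hn0 : (0 : ℝ) < n := by exact_mod_cast hpos
  have hC : C / n ≤ 1 / 2 := by
    rw [div_le_div_iff₀ hn0 (by norm_num)]
    linarith
  have hfac : (n ! : ℝ) ≠ 0 := Nat.cast_ne_zero.mpr (Nat.factorial_ne_zero n)
  have hper := permanent_smul_pos (hA.doublyStochastic n)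
  have h5 := abs_log_sub_log_le h2 h1 hC
  rw [← detMatrix_eq (hA.doublyStochastic n)] at h4
  have hdet : Real.log (detMatrix 1 (A n)).det = -(2 * Real.log (D n)) := by
    have h6 : (detMatrix 1 (A n)).det = (D n ^ 2)⁻¹ := eq_inv_of_mul_eq_one_right h4
    rw [h6, Real.log_inv, Real.log_pow]
    push_cast
    rfl
  rw [Real.log_div hper.ne' hfac] at h5
  rw [hdet]
  have e : Real.log ((n : ℝ) • A n).permanent -
      (Real.log (n ! : ℝ) - 1 / 2 * -(2 * Real.log (D n))) =
      Real.log ((n : ℝ) • A n).permanent - Real.log (n ! : ℝ) - Real.log (D n) := by ring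
  rw [e]
  exact h5.trans_eq (by ring)

lemma ModerateDeviation.exists_permanent_div_factorial_le (hA : ModerateDeviation A) :
    ∃ M : ℝ, ∀ n : ℕ, ((n : ℝ) • A n).permanent / (n ! : ℝ) ≤ M := by
  obtain ⟨D, C, S, h⟩ := hA.exists_approximation
  have hb : IsBoundedUnder (· ≤ ·) atTop
      fun n : ℕ => ((n : ℝ) • A n).permanent / (n ! : ℝ) := by
    refine ⟨|C| + S, ?_⟩
    rw [eventually_map]
    filter_upwards [h, eventually_ge_atTop 1] with n hn hn1
    have hn1' : (1 : ℝ) ≤ n := by exact_mod_cast hn1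
    have h1 : C / n ≤ |C| := by
      rw [div_le_iff₀ (by linarith)]
      nlinarith [le_abs_self C, abs_nonneg C]
    linarith [le_abs_self (((n : ℝ) • A n).permanent / (n ! : ℝ) - D n), hn.1, hn.2.2.1]
  obtain ⟨M, hM⟩ := hb.bddAbove_range
  exact ⟨M, fun n => hM ⟨n, rfl⟩⟩

lemma ModerateDeviation.det_pos (hA : ModerateDeviation A) (n : ℕ) :
    0 < (1 + J n - (A n)ᵀ * A n).det := by
  obtain ⟨ρ, -, hρ, hρ1, -, hK, -⟩ := hA.exists_bounds
  rw [one_add_J_sub_eq, detMatrix_eq (hA.doublyStochastic n)]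
  exact det_one_sub_smul_pos (hK n) zero_le_one (by nlinarith)

lemma isBigO_one_div_of_abs_le {u : ℕ → ℝ} {C : ℝ} (h : ∀ᶠ n : ℕ in atTop, |u n| ≤ C / n) :
    u =O[atTop] fun n : ℕ => 1 / (n : ℝ) := by
  refine IsBigO.of_bound C (h.mono fun n hn => ?_)
  rw [Real.norm_eq_abs, Real.norm_of_nonneg (by positivity), mul_one_div]
  exact hn

end Moderate

end DetApprox

end

theorem mainTheorem1 (A : ∀ n : ℕ, Matrix (Fin n) (Fin n) ℝ)
    (hA : DetApprox.ModerateDeviation A) :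
    -- the logarithms below are logarithms of positive numbers
    (∀ n : ℕ, 0 < ((n : ℝ) • A n).permanent ∧ 0 < (1 + DetApprox.J n - (A n)ᵀ * A n).det) ∧
    -- the determinantal approximation
    ((fun n : ℕ => Real.log ((n : ℝ) • A n).permanent -
        (Real.log (n ! : ℝ) - 1 / 2 * Real.log (1 + DetApprox.J n - (A n)ᵀ * A n).det))
      =O[atTop] fun n : ℕ => 1 / (n : ℝ)) ∧
    -- the normalized permanents are bounded
    (∃ M : ℝ, ∀ n : ℕ, ((n : ℝ) • A n).permanent / (n ! : ℝ) ≤ M) ∧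
    -- the modified approximation, with `t² = n / (n - 1)`
    (∀ᶠ n : ℕ in atTop, 0 < (DetApprox.detMatrix ((n : ℝ) / ((n : ℝ) - 1)) (A n)).det) ∧
    ((fun n : ℕ => Real.log ((n : ℝ) • A n).permanent -
        (Real.log (n ! : ℝ) -
          1 / 2 * Real.log (DetApprox.detMatrix ((n : ℝ) / ((n : ℝ) - 1)) (A n)).det))
      =O[atTop] fun n : ℕ => 1 / (n : ℝ)) := by
  obtain ⟨C₁, h₁⟩ := hA.exists_abs_log_permanent_sub_le
  obtain ⟨C₂, h₂⟩ := hA.exists_abs_log_det_sub_le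
  refine ⟨fun n => ⟨DetApprox.permanent_smul_pos (hA.doublyStochastic n), hA.det_pos n⟩, ?_,
    hA.exists_permanent_div_factorial_le, h₂.mono fun n h => h.1, ?_⟩
  · simp only [DetApprox.one_add_J_sub_eq]
    exact DetApprox.isBigO_one_div_of_abs_le h₁
  · refine DetApprox.isBigO_one_div_of_abs_le (C := C₁ + C₂) ?_
    filter_upwards [h₁, h₂] with n h1 h2
    set p := Real.log ((n : ℝ) • A n).permanent
    set f := Real.log (n ! : ℝ)
    set d := Real.log (DetApprox.detMatrix 1 (A n)).det
    set d' := Real.log (DetApprox.detMatrix ((n : ℝ) / ((n : ℝ) - 1)) (A n)).det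
    have e : p - (f - 1 / 2 * d') = (p - (f - 1 / 2 * d)) + -(1 / 2) * (d - d') := by ring
    have h3 : |-(1 / 2) * (d - d')| ≤ C₂ / n := by
      rw [abs_mul, abs_neg, abs_of_pos (by norm_num : (0 : ℝ) < 1 / 2)]
      linarith [h2.2, abs_nonneg (d - d')]
    rw [e, add_div]
    exact (abs_add_le _ _).trans (add_le_add h1 h3)
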